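/- **Setting.** Inputs are $z\in\{0,1\}^{\binom n2}$, encoding graphs on the vertex set $V=[n]$, with neighbourhoods $N_t$; $\mathsf{Triangle}(z)=1$ iff the graph has a triangle. An *extended learning graph* for a function $f$ on a set $Z$ of inputs is a finite rooted acyclic directed (multi)graph whose vertices $v$ carry labels (index sets) $S(v)$, with empty root label. Every edge $e=(u,v)$ either loads one index $j\notin S(u)$, i.e. $S(v)=S(u)\cup\{j\}$, or is an empty transition, $S(v)=S(u)$, which is not counted in any complexity. It has weights $w^0_z(e),w^1_z(e)\ge 0$ depending on $z$ only through $z_{S(v)}$, with $w^0_x(e)=w^1_y(e)$ whenever $f(x)=0$, $f(y)=1$, $x_{S(u)}=y_{S(u)}$, $x_j\ne y_j$; and for every $y\in f^{-1}(1)$ a unit flow $p_y\ge 0$ from the root, vanishing on loading edges with $w_y^1(e)=0$, all of whose sinks have labels containing a $1$-certificate of $f$ for $y$. Put $C^0(x)=\sum_e w^0_x(e)$ and $C^1(y)=\sum_e p_y(e)^2/w^1_y(e)$, sums over loading edges. Its *complexity over graphs with $m$ edges* is $\sqrt{\max_x C^0(x)\cdot\max_y C^1(y)}$, with $x$ (resp.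 $y$) ranging over the negative (resp. positive) inputs with exactly $m$ edges (an empty maximum is $0$). $\mathsf{SparseLoad}_S$ is the path that loads $S=\{s_1,\dots,s_N\}$ one element at a time, the $k$-th edge having weight $w^b_z=3(|z_{\{s_1,\dots,s_{k-1}\}}|+1)\log(N+1)$ if $z_{s_k}=b$ and $w_z^b=3N\log(N+1)$ otherwise. **The learning graph $\mathcal G_{n,x,a,b}$.** Every edge below is a copy of $\mathsf{SparseLoad}$ loading the part of the new label not yet loaded, with weights multiplied by the factor in brackets. Write $u(N,k)=1/\binom Nk$, $c=u(n,x)$, $c'=c\,u(n-2,a-2)$. $X$ ranges over the $x$-subsets of $V$, and $X\times A$ is the set of pairs between $X$ and $A$. 1. For every $X$ and $t\in X$: load $\{t\}\times V$ $[c]$; then, for every pair $e$, load $e$ $[c$ if $e\subseteq N_t$, else $0]$. 2. For every $X$, a Johnson walk on the $a$-subsets $A$ of $V$, with label $X\times A$: from the root to every $(a-2)$-subset $[c\,u(n,a-2)]$; add one element $[c\,u(n,a-2)]$; add one more element $[c\,u(n-1,a-2)]$. 3. From every $(X,A)$ and for every $w\in V$, a Johnson walk on the $b$-subsets $B$ of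 $A$, with label $X\times A\cup\{w\}\times B$: to every $(b-2)$-subset of $A$ $[c'u(a,b-2)]$; add one element of $A$ $[c'u(a,b-2)]$; add one more $[c'u(a-1,b-2)]$. 4. From every $(X,A,w,B)$ and for every pair $e\subseteq B$: load $e$ $[c'u(a-2,b-2)$ if $e\subseteq N_w$ and $e\not\subseteq N_s$ for all $s\in X$; else $0]$. On a positive input each $X$ receives flow $c$. If there is a triangle with a vertex in $X$, one such triangle $(t,u,v)$ with $t\in X$ is fixed, and the flow goes through $\{t\}\times V$ and then $e=uv$. Otherwise a triangle $(t,u,v)$ is fixed, and the flow goes through the first walk, then $w=t$, then the second walk, then $e=uv$. In each walk all the initial subsets receive equal flow; then $u$ and, in the next stage, $v$ is added, and where that element is already in the set the flow is spread uniformly over all possible additions. **Theorem.** There is an absolute constant $C>0$ such that the following holds. (i) For all integers $1\le x\le n$ and $2\le b\le a\le n$, $\mathcal G_{n,x,a,b}$ is an extended learning graph for $\mathsf{Triangle}$ on all $n$-vertex graphs, and for every $m$ its complexity over graphs with $m$ edges is at most $$C\sqrt{\left(xm+(ax)^2\frac m{n^2}+\Big(\frac na\Big)^2\left(a x^2\frac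 m{n^2}+n\left(b^2\frac m{n^2}+\Big(\frac ab\Big)^2\Big(b+\frac{b^2}x\Big)\right)\right)\right)\log n}\,.$$ (ii) If $n\ge1$, $n^{5/4}\le m\le\binom n2$, $a=\lceil n^{3/4}\rceil$ and $b=x=\lceil \sqrt n/(m/n^2)^{1/3}\rceil$, then $\mathcal G_{n,x,a,b}$ is an extended learning graph for $\mathsf{Triangle}$, and its complexity over graphs with $m$ edges is at most $C\,n^{11/12}m^{1/6}\sqrt{\log n}$. -/

import Mathlib

/-! ## Extended learning graphs

Inputs are Boolean strings `z : ι → Bool` indexed by a finite set `ι`. -/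

/-- The data of an extended learning graph over the index set `ι`: a finite directed (multi)graph
with a root, a label `label v ⊆ ι` for every vertex, weights `weight b z e` (`b = false` is the
weight `w_z^0`, `b = true` is the weight `w_z^1`), and a flow `flow y e` for every input `y`.
The vertices of the graph are the root and the end points of the edges. -/
structure LGraph (ι : Type) where
  Vert : Type
  Edge : Type
  [fintypeEdge : Fintype Edge]
  root : Vert
  src : Edge → Vert
  tgt : Edge → Vert
  label : Vert → Finset ι
  weight : Bool → (ι → Bool) → Edge → ℝ
  flow : (ι → Bool) → Edge → ℝ

attribute [instance] LGraph.fintypeEdge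

/-- `x` and `y` agree on the index set `S`. -/
def AgreeOn {ι : Type} (S : Finset ι) (x y : ι → Bool) : Prop := ∀ i ∈ S, x i = y i

/-- `S` is a `1`-certificate for the function `f` with domain `Z` on the input `y`. -/
def IsOneCertificate {ι : Type} (Z : Set (ι → Bool)) (f : (ι → Bool) → Prop)
    (y : ι → Bool) (S : Finset ι) : Prop :=
  ∀ z ∈ Z, AgreeOn S z y → f z

namespace LGraph

variable {ι : Type}

/-- There is an edge from `u` to `v`. -/
def Adj (G : LGraph ι) (u v : G.Vert) : Prop := ∃ e, G.src e = u ∧ G.tgt e = v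

/-- The edge `e` loads an index. The other edges are the empty transitions, between two vertices
with the same label; they do not contribute to any complexity. -/
def Loading (G : LGraph ι) (e : G.Edge) : Prop := G.label (G.tgt e) ≠ G.label (G.src e)

open Classical in
/-- Outgoing flow minus incoming flow at the vertex `v`, for the input `y`. -/
noncomputable def netOut (G : LGraph ι) (y : ι → Bool) (v : G.Vert) : ℝ :=
  (∑ e, if G.src e = v then G.flow y e else 0) - ∑ e, if G.tgt e = v then G.flow y e else 0

/-- `G` is an extended learning graph for the Boolean function `f` with domain `Z`. -/
structure IsLearningGraphFor [DecidableEq ι] (G : LGraph ι) (Z : Set (ι → Bool))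
    (f : (ι → Bool) → Prop) : Prop where
  acyclic : ∀ v, ¬ Relation.TransGen G.Adj v v
  rooted : ∀ e, Relation.ReflTransGen G.Adj G.root (G.src e)
  label_root : G.label G.root = ∅
  label_step : ∀ e, G.Loading e →
    ∃ j, j ∉ G.label (G.src e) ∧ G.label (G.tgt e) = insert j (G.label (G.src e))
  weight_nonneg : ∀ b, ∀ z ∈ Z, ∀ e, 0 ≤ G.weight b z e
  weight_local : ∀ b, ∀ z ∈ Z, ∀ z' ∈ Z, ∀ e,
    AgreeOn (G.label (G.tgt e)) z z' → G.weight b z e = G.weight b z' e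
  weight_compat : ∀ x ∈ Z, ¬ f x → ∀ y ∈ Z, f y → ∀ e j, j ∉ G.label (G.src e) →
    G.label (G.tgt e) = insert j (G.label (G.src e)) →
    AgreeOn (G.label (G.src e)) x y → x j ≠ y j → G.weight false x e = G.weight true y e
  flow_nonneg : ∀ y ∈ Z, f y → ∀ e, 0 ≤ G.flow y e
  flow_root : ∀ y ∈ Z, f y → G.netOut y G.root = 1
  flow_source : ∀ y ∈ Z, f y → ∀ v, v ≠ G.root → G.netOut y v ≤ 0
  flow_support : ∀ y ∈ Z, f y → ∀ e, G.Loading e → G.weight true y e = 0 → G.flow y e = 0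
  sink_certificate : ∀ y ∈ Z, f y → ∀ v, G.netOut y v < 0 → IsOneCertificate Z f y (G.label v)

open Classical in
/-- Negative complexity on the input `x`. -/
noncomputable def negComplexity (G : LGraph ι) (x : ι → Bool) : ℝ :=
  ∑ e, if G.Loading e then G.weight false x e else 0

open Classical in
/-- Positive complexity on the input `y`. -/
noncomputable def posComplexity (G : LGraph ι) (y : ι → Bool) : ℝ :=
  ∑ e, if G.Loading e then (G.flow y e) ^ 2 / G.weight true y e else 0

/-- Complexity of `G` over the inputs in `Z`, for the function `f`: the geometric mean of the
maximal negative complexity over the negative inputs in `Z` and of the maximal positive complexity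
over the positive inputs in `Z` (for finite `ι` these are suprema of finite sets; the maximum over
an empty set is `0`). -/
noncomputable def complexity (G : LGraph ι) (Z : Set (ι → Bool)) (f : (ι → Bool) → Prop) : ℝ :=
  Real.sqrt ((⨆ x : {x // x ∈ Z ∧ ¬ f x}, G.negComplexity x.1) *
    ⨆ y : {y // y ∈ Z ∧ f y}, G.posComplexity y.1)

end LGraph

/-! ## The super edge `SparseLoad` -/

/-- The element of `S` loaded by the `k`-th edge of the path `SparseLoad S`, for a fixed
enumeration of `S`. -/
noncomputable def sparseElem {ι : Type} (S : Finset ι) (k : Fin S.card) : ι :=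
  (S.equivFin.symm k).1

/-- The set of the first `k` elements of `S` in the enumeration. -/
noncomputable def sparsePrefix {ι : Type} [DecidableEq ι] (S : Finset ι) (k : ℕ) : Finset ι :=
  (Finset.univ.filter fun i : Fin S.card => i.val < k).image (sparseElem S)

/-- The weight `w_z^b` of the `k`-th edge of the path `SparseLoad S`. -/
noncomputable def sparseWeight {ι : Type} [DecidableEq ι] (S : Finset ι) (b : Bool)
    (z : ι → Bool) (k : Fin S.card) : ℝ :=
  if z (sparseElem S k) = b then
    3 * ((((sparsePrefix S k).filter fun i => z i = true).card : ℝ) + 1)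
      * Real.log ((S.card : ℝ) + 1)
  else 3 * (S.card : ℝ) * Real.log ((S.card : ℝ) + 1)

/-- A learning graph all of whose edges are super edges of type `SparseLoad`: the edge `e` is
a copy of `SparseLoad` loading `label (tgt e) \ label (src e)`, with both weights multiplied by
`scale z e`, and it carries the flow `flow y e`. -/
structure SuperGraph (ι : Type) where
  Vert : Type
  Edge : Type
  [fintypeEdge : Fintype Edge]
  root : Vert
  src : Edge → Vert
  tgt : Edge → Vert
  label : Vert → Finset ι
  scale : (ι → Bool) → Edge → ℝ
  flow : (ι → Bool) → Edge → ℝ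

attribute [instance] SuperGraph.fintypeEdge

namespace SuperGraph

variable {ι : Type} [DecidableEq ι]

/-- The set loaded by the super edge `e`. -/
def loadSet (H : SuperGraph ι) (e : H.Edge) : Finset ι := H.label (H.tgt e) \ H.label (H.src e)

/-- The expansion: the super edge `e`, loading a set `S`, is replaced by the path `SparseLoad S`,
which starts at `src e`, goes through `|S|` new vertices, loading one element of `S` on every step,
and is closed by an empty transition from its last vertex to `tgt e`. -/
noncomputable def expansion (H : SuperGraph ι) : LGraph ι where
  Vert := H.Vert ⊕ (Σ e : H.Edge, Fin (H.loadSet e).card)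
  Edge := Σ e : H.Edge, Fin ((H.loadSet e).card + 1)
  root := Sum.inl H.root
  src p := Fin.cases (motive := fun _ => H.Vert ⊕ (Σ e : H.Edge, Fin (H.loadSet e).card))
    (Sum.inl (H.src p.1)) (fun i => Sum.inr ⟨p.1, i⟩) p.2
  tgt p := Fin.lastCases (motive := fun _ => H.Vert ⊕ (Σ e : H.Edge, Fin (H.loadSet e).card))
    (Sum.inl (H.tgt p.1)) (fun i => Sum.inr ⟨p.1, i⟩) p.2
  label v := match v with
    | Sum.inl v => H.label v
    | Sum.inr ⟨e, i⟩ => H.label (H.src e) ∪ sparsePrefix (H.loadSet e) (i.val + 1)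
  weight b z p := Fin.lastCases (motive := fun _ => ℝ) 0
    (fun i => H.scale z p.1 * sparseWeight (H.loadSet p.1) b z i) p.2
  flow y p := H.flow y p.1

end SuperGraph

/-! ## Graphs as inputs -/

/-- The `n choose 2` possible edges of a graph with vertex set `Fin n`: the index set of the
inputs. -/
abbrev Slot (n : ℕ) : Type := {e : Sym2 (Fin n) // ¬ e.IsDiag}

/-- The graph encoded by the input `z`. -/
def graphOf {n : ℕ} (z : Slot n → Bool) : SimpleGraph (Fin n) where
  Adj u v := ∃ h : ¬ (s(u, v)).IsDiag, z ⟨s(u, v), h⟩ = true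
  symm := ⟨by
    rintro u v ⟨h, hz⟩
    have key : s(u, v) = s(v, u) := Sym2.eq_swap
    refine ⟨key ▸ h, ?_⟩
    have hs : (⟨s(v, u), key ▸ h⟩ : Slot n) = ⟨s(u, v), h⟩ := Subtype.ext key.symm
    rw [hs]
    exact hz⟩
  loopless := ⟨by
    rintro u ⟨h, -⟩
    exact h (by simp)⟩

/-- The function `Triangle`. -/
def HasTriangle {n : ℕ} (z : Slot n → Bool) : Prop :=
  ∃ t u v, (graphOf z).Adj t u ∧ (graphOf z).Adj t v ∧ (graphOf z).Adj u v

/-- The inputs that encode a graph with `m` edges. -/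
def graphsWithEdges (n m : ℕ) : Set (Slot n → Bool) := {z | (graphOf z).edgeSet.ncard = m}

open Classical in
/-- The possible edges `X × A` between a vertex of `X` and a vertex of `A`. -/
noncomputable def crossSlots {n : ℕ} (X A : Finset (Fin n)) : Finset (Slot n) :=
  Finset.univ.filter fun e => ∃ u ∈ X, ∃ v ∈ A, e.1 = s(u, v)

/-- The pair `e` is in `(N_t)²`: both its ends are neighbours of `t`. -/
def InNbhd {n : ℕ} (z : Slot n → Bool) (t : Fin n) (e : Slot n) : Prop :=
  ∀ u ∈ e.1, (graphOf z).Adj t u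

/-- The pair `e` is in `Δ(X)`: its ends have no common neighbour in `X`. -/
def InDelta {n : ℕ} (z : Slot n → Bool) (X : Finset (Fin n)) (e : Slot n) : Prop :=
  ∀ t ∈ X, ¬ InNbhd z t e

/-! ## The learning graph for `Triangle` -/

/-- The vertices.
* `root` carries the empty label.
* `star X t` and `starPair X t e` belong to the part that searches for a triangle with a vertex
  `t` in `X`: first `{t} × V` is loaded, then a pair `e`.
* `walkA X A` belongs to the walk on the sets `A`, with `X × A` loaded.
* `walkB X A w B` belongs to the walk on the subsets `B` of `A`, with `{w} × B` also loaded.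
* `pair X A w B e` is reached when the pair `e` is loaded as well. -/
inductive TriVert (n : ℕ) : Type
  | root
  | star (X : Finset (Fin n)) (t : Fin n)
  | starPair (X : Finset (Fin n)) (t : Fin n) (e : Slot n)
  | walkA (X A : Finset (Fin n))
  | walkB (X A : Finset (Fin n)) (w : Fin n) (B : Finset (Fin n))
  | pair (X A : Finset (Fin n)) (w : Fin n) (B : Finset (Fin n)) (e : Slot n)

/-- The super edges, for `|X| = x`, `|A| = a` and `|B| = b`. Each of the two Johnson walks has one
stage (`walkA0`, `walkB0`) that loads all but two elements of the set, and two stages that add one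
element `j`. -/
inductive TriEdge (n x a b : ℕ) : Type
  | star (X : Finset (Fin n)) (t : Fin n) (hX : X.card = x) (ht : t ∈ X)
  | starPair (X : Finset (Fin n)) (t : Fin n) (e : Slot n) (hX : X.card = x) (ht : t ∈ X)
  | walkA0 (X A : Finset (Fin n)) (hX : X.card = x) (hA : A.card = a - 2)
  | walkA1 (X A : Finset (Fin n)) (j : Fin n) (hX : X.card = x) (hA : A.card = a - 2)
      (hj : j ∉ A)
  | walkA2 (X A : Finset (Fin n)) (j : Fin n) (hX : X.card = x) (hA : A.card = a - 1)
      (hj : j ∉ A)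
  | walkB0 (X A : Finset (Fin n)) (w : Fin n) (B : Finset (Fin n)) (hX : X.card = x)
      (hA : A.card = a) (hBA : B ⊆ A) (hB : B.card = b - 2)
  | walkB1 (X A : Finset (Fin n)) (w : Fin n) (B : Finset (Fin n)) (j : Fin n) (hX : X.card = x)
      (hA : A.card = a) (hBA : B ⊆ A) (hB : B.card = b - 2) (hjA : j ∈ A) (hj : j ∉ B)
  | walkB2 (X A : Finset (Fin n)) (w : Fin n) (B : Finset (Fin n)) (j : Fin n) (hX : X.card = x)
      (hA : A.card = a) (hBA : B ⊆ A) (hB : B.card = b - 1) (hjA : j ∈ A) (hj : j ∉ B)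
  | pair (X A : Finset (Fin n)) (w : Fin n) (B : Finset (Fin n)) (e : Slot n) (hX : X.card = x)
      (hA : A.card = a) (hBA : B ⊆ A) (hB : B.card = b) (he : ∀ u ∈ e.1, u ∈ B)

namespace TriEdge

variable {n x a b : ℕ}

/-- An injective code, used only to see that there are finitely many super edges. -/
def code : TriEdge n x a b → ℕ × Finset (Fin n) × Finset (Fin n) × Finset (Fin n) ×
    Option (Fin n) × Option (Fin n) × Option (Slot n)
  | star X t _ _ => (0, X, ∅, ∅, some t, none, none)
  | starPair X t e _ _ => (1, X, ∅, ∅, some t, none, some e)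
  | walkA0 X A _ _ => (2, X, A, ∅, none, none, none)
  | walkA1 X A j _ _ _ => (3, X, A, ∅, none, some j, none)
  | walkA2 X A j _ _ _ => (4, X, A, ∅, none, some j, none)
  | walkB0 X A w B _ _ _ _ => (5, X, A, B, some w, none, none)
  | walkB1 X A w B j _ _ _ _ _ _ => (6, X, A, B, some w, some j, none)
  | walkB2 X A w B j _ _ _ _ _ _ => (7, X, A, B, some w, some j, none)
  | pair X A w B e _ _ _ _ _ => (8, X, A, B, some w, none, some e)

theorem code_fst_lt (e : TriEdge n x a b) : e.code.1 < 9 := by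
  cases e <;> simp [code]

theorem code_injective : Function.Injective (code : TriEdge n x a b → _) := by
  intro e e' h
  cases e <;> cases e' <;> simp_all [code]

noncomputable instance : Fintype (TriEdge n x a b) :=
  Fintype.ofInjective
    (fun e => ((⟨e.code.1, e.code_fst_lt⟩ : Fin 9), e.code.2))
    (fun e e' h => code_injective (by
      simp only [Prod.mk.injEq, Fin.mk.injEq] at h
      exact Prod.ext h.1 h.2))

def src : TriEdge n x a b → TriVert n
  | star _ _ _ _ => .root
  | starPair X t _ _ _ => .star X t
  | walkA0 _ _ _ _ => .root
  | walkA1 X A _ _ _ _ => .walkA X A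
  | walkA2 X A _ _ _ _ => .walkA X A
  | walkB0 X A _ _ _ _ _ _ => .walkA X A
  | walkB1 X A w B _ _ _ _ _ _ _ => .walkB X A w B
  | walkB2 X A w B _ _ _ _ _ _ _ => .walkB X A w B
  | pair X A w B _ _ _ _ _ _ => .walkB X A w B

def tgt : TriEdge n x a b → TriVert n
  | star X t _ _ => .star X t
  | starPair X t e _ _ => .starPair X t e
  | walkA0 X A _ _ => .walkA X A
  | walkA1 X A j _ _ _ => .walkA X (insert j A)
  | walkA2 X A j _ _ _ => .walkA X (insert j A)
  | walkB0 X A w B _ _ _ _ => .walkB X A w B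
  | walkB1 X A w B j _ _ _ _ _ _ => .walkB X A w (insert j B)
  | walkB2 X A w B j _ _ _ _ _ _ => .walkB X A w (insert j B)
  | pair X A w B e _ _ _ _ _ => .pair X A w B e

end TriEdge

/-- The labels of the vertices. -/
noncomputable def triLabel {n : ℕ} : TriVert n → Finset (Slot n)
  | .root => ∅
  | .star _ t => crossSlots {t} Finset.univ
  | .starPair _ t e => crossSlots {t} Finset.univ ∪ {e}
  | .walkA X A => crossSlots X A
  | .walkB X A w B => crossSlots X A ∪ crossSlots {w} B
  | .pair X A w B e => (crossSlots X A ∪ crossSlots {w} B) ∪ {e}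

/-- The factor `1 / (N choose k)` of a uniform distribution on the `k`-subsets of an `N`-set. -/
noncomputable def unif (N k : ℕ) : ℝ := 1 / (N.choose k : ℝ)

open Classical in
/-- The rescaling factors of the super edges. The factor `unif n x` comes from the search on `X`,
and each Johnson walk on the `k`-subsets of an `N`-set has the factors `unif N (k - 2)`,
`unif N (k - 2)` and `unif (N - 1) (k - 2)` on its three stages and `unif (N - 2) (k - 2)` on what
follows. Only pairs in `(N_t)²` and in `Δ(X, B, w) = (N_w)² ∩ Δ(X) ∩ B²` are queried in the last
stages. -/
noncomputable def triScale {n x a b : ℕ} (z : Slot n → Bool) : TriEdge n x a b → ℝ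
  | .star _ _ _ _ => unif n x
  | .starPair _ t e _ _ => if InNbhd z t e then unif n x else 0
  | .walkA0 _ _ _ _ => unif n x * unif n (a - 2)
  | .walkA1 _ _ _ _ _ _ => unif n x * unif n (a - 2)
  | .walkA2 _ _ _ _ _ _ => unif n x * unif (n - 1) (a - 2)
  | .walkB0 _ _ _ _ _ _ _ _ => unif n x * unif (n - 2) (a - 2) * unif a (b - 2)
  | .walkB1 _ _ _ _ _ _ _ _ _ _ _ => unif n x * unif (n - 2) (a - 2) * unif a (b - 2)
  | .walkB2 _ _ _ _ _ _ _ _ _ _ _ => unif n x * unif (n - 2) (a - 2) * unif (a - 1) (b - 2)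
  | .pair X _ w _ e _ _ _ _ _ =>
      if InNbhd z w e ∧ InDelta z X e then
        unif n x * unif (n - 2) (a - 2) * unif (a - 2) (b - 2) else 0

open Classical in
/-- A triangle `(t, u, v)` of the graph encoded by `z`, with `t` in `X` if the graph has a triangle
with a vertex in `X`. -/
noncomputable def chosenTriangle {n : ℕ} (z : Slot n → Bool) (X : Finset (Fin n)) :
    Option (Fin n × Fin n × Fin n) :=
  if h : ∃ p : Fin n × Fin n × Fin n, p.1 ∈ X ∧ (graphOf z).Adj p.1 p.2.1 ∧
      (graphOf z).Adj p.1 p.2.2 ∧ (graphOf z).Adj p.2.1 p.2.2 then some h.choose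
  else if h : ∃ p : Fin n × Fin n × Fin n, (graphOf z).Adj p.1 p.2.1 ∧
      (graphOf z).Adj p.1 p.2.2 ∧ (graphOf z).Adj p.2.1 p.2.2 then some h.choose
  else none

/-- Flow in the first incremental stage of a Johnson walk on the `k`-subsets of an `N`-set, on the
edge that adds `j` to the `(k-2)`-set `A`: every `A` receives the same flow; it goes to `u`, or
uniformly to all `j ∉ A` if `u` is already in `A`. -/
noncomputable def walkFlow1 {n : ℕ} (N k : ℕ) (u : Fin n) (A : Finset (Fin n)) (j : Fin n) : ℝ :=
  if u ∈ A then unif N (k - 2) / ((N : ℝ) - k + 2)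
  else if j = u then unif N (k - 2) else 0

/-- Flow in the second incremental stage, on the edge that adds `j` to the `(k-1)`-set `A`: every
`A` that contains `u` receives the same flow; it goes to `v`, or uniformly to all `j ∉ A` if `v` is
already in `A`. -/
noncomputable def walkFlow2 {n : ℕ} (N k : ℕ) (u v : Fin n) (A : Finset (Fin n)) (j : Fin n) : ℝ :=
  if u ∈ A then
    if v ∈ A then unif (N - 1) (k - 2) / ((N : ℝ) - k + 1)
    else if j = v then unif (N - 1) (k - 2) else 0
  else 0

/-- The flow in the part of the graph that belongs to `X`, when it is routed towards the triangle
`(t, u, v)`: if `t ∈ X` it goes to `star X t` and then to the pair `uv`; otherwise it follows the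
walk towards the sets `A` that contain `u` and `v`, the vertex `w = t`, the walk towards the subsets
`B` that contain `u` and `v`, and then the pair `uv`. -/
noncomputable def triFlowTo {n x a b : ℕ} (t u v : Fin n) : TriEdge n x a b → ℝ
  | .star X t' _ _ => if t ∈ X ∧ t' = t then unif n x else 0
  | .starPair X t' e _ _ => if t ∈ X ∧ t' = t ∧ e.1 = s(u, v) then unif n x else 0
  | .walkA0 X _ _ _ => if t ∉ X then unif n x * unif n (a - 2) else 0
  | .walkA1 X A j _ _ _ => if t ∉ X then unif n x * walkFlow1 n a u A j else 0
  | .walkA2 X A j _ _ _ => if t ∉ X then unif n x * walkFlow2 n a u v A j else 0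
  | .walkB0 X A w _ _ _ _ _ =>
      if t ∉ X ∧ u ∈ A ∧ v ∈ A ∧ w = t then
        unif n x * unif (n - 2) (a - 2) * unif a (b - 2) else 0
  | .walkB1 X A w B j _ _ _ _ _ _ =>
      if t ∉ X ∧ u ∈ A ∧ v ∈ A ∧ w = t then
        unif n x * unif (n - 2) (a - 2) * walkFlow1 a b u B j else 0
  | .walkB2 X A w B j _ _ _ _ _ _ =>
      if t ∉ X ∧ u ∈ A ∧ v ∈ A ∧ w = t then
        unif n x * unif (n - 2) (a - 2) * walkFlow2 a b u v B j else 0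
  | .pair X _ w _ e _ _ _ _ _ =>
      if t ∉ X ∧ w = t ∧ e.1 = s(u, v) then
        unif n x * unif (n - 2) (a - 2) * unif (a - 2) (b - 2) else 0

/-- The set `X` to which a super edge belongs. -/
def TriEdge.setX {n x a b : ℕ} : TriEdge n x a b → Finset (Fin n)
  | .star X _ _ _ => X
  | .starPair X _ _ _ _ => X
  | .walkA0 X _ _ _ => X
  | .walkA1 X _ _ _ _ _ => X
  | .walkA2 X _ _ _ _ _ => X
  | .walkB0 X _ _ _ _ _ _ _ => X
  | .walkB1 X _ _ _ _ _ _ _ _ _ _ => X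
  | .walkB2 X _ _ _ _ _ _ _ _ _ _ => X
  | .pair X _ _ _ _ _ _ _ _ _ => X

/-- The flow on the input `y`. -/
noncomputable def triFlow {n x a b : ℕ} (y : Slot n → Bool) (e : TriEdge n x a b) : ℝ :=
  match chosenTriangle y e.setX with
  | none => 0
  | some (t, u, v) => triFlowTo t u v e

/-- The learning graph for `Triangle` with super edges `SparseLoad` and parameters `|X| = x`,
`|A| = a`, `|B| = b`. -/
noncomputable def triangleSuperGraph (n x a b : ℕ) : SuperGraph (Slot n) where
  Vert := TriVert n
  Edge := TriEdge n x a b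
  root := .root
  src := TriEdge.src
  tgt := TriEdge.tgt
  label := triLabel
  scale := triScale
  flow := triFlow

/-- The learning graph for `Triangle`: the expansion of `triangleSuperGraph`. -/
noncomputable def triangleLearningGraph (n x a b : ℕ) : LGraph (Slot n) :=
  (triangleSuperGraph n x a b).expansion

/-! ## The super edge `SparseLoad`: combinatorics of the enumeration -/

section SparseLoad

variable {ι : Type}

/-! The positive side costs only a constant. One `SparseLoad` path has positive complexity at most
`2` (`sum_inv_sparseWeight_true_le`): the ones met along the path contribute a harmonic sum, which
the logarithm in the weights cancels, and the zeros contribute `N` terms of size `1/N`. Every super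
edge carries a flow at most its scale (`triFlowTo_le_triScale`), so `flow² / scale ≤ flow`, and the
positive complexity is at most twice the total flow over all edges. A unit flow through a graph with
levels `0, …, 7` has total at most `7`, so the bound is `14` on every positive input
(`IsLayered.posComplexity_le`).

The flow is legitimate because the factors on the stages of a Johnson walk are the uniform weights
on the sets through which the flow passes: all `(k-2)`-sets, then the `(k-1)`-sets containing `u`,
then the `k`-sets containing `u` and `v`. Conservation is the identity that relates the binomial
coefficients of `N` and `N - 1` (`unif_pred_mul`). The restriction of the last queries to pairs
without a common neighbour in `X` does not block the flow: if the chosen triangle `(t, u, v)` has `t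
∉ X`, then no triangle meets `X`, so `u` and `v` have no common neighbour there.

The negative side is a computation of averages. Loading `S` costs `|S| (ones in S + 1)` up to a
logarithm (`sum_sparseWeight_false_le`). The scales turn the sum over super edges into averages over
`X`, `A`, `B`, multiplied by ratios such as `n(n-1) / (a(a-1))` that account for the walk. Costs are
bounded by expressions affine in adjacency indicators, so their averages involve the graph only
through the degree sum `2m`. The last stage needs more: each pair `e` in `V` is in equally many sets
`A` and `B`, so the walks cancel, and what remains for each `e` is the average over `X` of `|D|`
when `X` misses the common neighbourhood `D` of `e`. This is at most `n / x`, whatever `D` is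
(`sum_disjoint_le`). Hence the term `n³ / x`.

The nine contributions add up to at most `20` times `triBound`, which is a sum of six monomials. For
part (ii), with `n = r⁴`, `m = q³ r⁸`, `a ≈ r³` and `b = x ≈ r² / q`, each monomial is `O(r¹⁰ q)`,
and `r¹⁰ q` is the square of `n^(11/12) m^(1/6)`. -/

theorem sparseElem_mem (S : Finset ι) (k : Fin S.card) : sparseElem S k ∈ S :=
  (S.equivFin.symm k).2

theorem sparseElem_injective (S : Finset ι) : Function.Injective (sparseElem S) := fun _ _ h =>
  S.equivFin.symm.injective (Subtype.ext h)

theorem log_card_succ_nonneg (S : Finset ι) : 0 ≤ Real.log ((S.card : ℝ) + 1) :=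
  Real.log_nonneg (by linarith [(Nat.cast_nonneg S.card : (0 : ℝ) ≤ S.card)])

/-- The number of ones of `z` on the set `S`. -/
def onesOn (z : ι → Bool) (S : Finset ι) : ℕ := (S.filter fun i => z i = true).card

theorem onesOn_mono (z : ι → Bool) {S T : Finset ι} (h : S ⊆ T) : onesOn z S ≤ onesOn z T :=
  Finset.card_le_card (Finset.filter_subset_filter _ h)

theorem sum_ones_sparseElem (S : Finset ι) (z : ι → Bool) :
    (∑ k : Fin S.card, if z (sparseElem S k) = true then (1 : ℝ) else 0) = onesOn z S := by
  have h : (∑ i ∈ S, if z i = true then (1 : ℝ) else 0) =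
      ∑ k : Fin S.card, if z (sparseElem S k) = true then (1 : ℝ) else 0 := by
    rw [← Finset.sum_coe_sort S, ← S.equivFin.symm.sum_comp]
    rfl
  rw [← h, Finset.sum_ite]
  simp [onesOn]

variable [DecidableEq ι]

theorem mem_sparsePrefix {S : Finset ι} {k : ℕ} {i : ι} :
    i ∈ sparsePrefix S k ↔ ∃ l : Fin S.card, l.val < k ∧ sparseElem S l = i := by
  simp [sparsePrefix]

@[simp] theorem sparsePrefix_zero (S : Finset ι) : sparsePrefix S 0 = ∅ := by
  simp [sparsePrefix]

theorem sparsePrefix_subset (S : Finset ι) (k : ℕ) : sparsePrefix S k ⊆ S := by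
  intro i hi
  obtain ⟨l, -, rfl⟩ := mem_sparsePrefix.1 hi
  exact sparseElem_mem S l

@[simp] theorem sparsePrefix_card (S : Finset ι) : sparsePrefix S S.card = S := by
  refine (sparsePrefix_subset S _).antisymm fun i hi => mem_sparsePrefix.2
    ⟨S.equivFin ⟨i, hi⟩, Fin.is_lt _, ?_⟩
  simp [sparseElem]

theorem sparsePrefix_succ (S : Finset ι) (k : Fin S.card) :
    sparsePrefix S (k.val + 1) = insert (sparseElem S k) (sparsePrefix S k.val) := by
  ext i
  simp only [mem_sparsePrefix, Finset.mem_insert]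
  constructor
  · rintro ⟨l, hl, rfl⟩
    rcases Nat.lt_succ_iff_lt_or_eq.1 hl with h | h
    · exact Or.inr ⟨l, h, rfl⟩
    · exact Or.inl (by rw [Fin.ext h])
  · rintro (rfl | ⟨l, hl, rfl⟩)
    · exact ⟨k, Nat.lt_succ_self _, rfl⟩
    · exact ⟨l, by omega, rfl⟩

theorem sparseElem_notMem_sparsePrefix (S : Finset ι) (k : Fin S.card) :
    sparseElem S k ∉ sparsePrefix S k.val := by
  intro h
  obtain ⟨l, hl, h⟩ := mem_sparsePrefix.1 h
  rw [sparseElem_injective S h] at hl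
  exact lt_irrefl _ hl

theorem sparseWeight_nonneg (S : Finset ι) (b : Bool) (z : ι → Bool) (k : Fin S.card) :
    0 ≤ sparseWeight S b z k := by
  have := log_card_succ_nonneg S
  unfold sparseWeight
  split_ifs <;> positivity

theorem sparseWeight_pos (S : Finset ι) (b : Bool) (z : ι → Bool) (k : Fin S.card) :
    0 < sparseWeight S b z k := by
  have h0 : 0 < S.card := k.pos
  have h1 : (0 : ℝ) < S.card := by exact_mod_cast h0
  have : 0 < Real.log ((S.card : ℝ) + 1) := Real.log_pos (by linarith)
  unfold sparseWeight
  split_ifs <;> positivity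

theorem filter_sparsePrefix_congr {S : Finset ι} {k : ℕ} {z z' : ι → Bool}
    (h : AgreeOn (sparsePrefix S k) z z') :
    (sparsePrefix S k).filter (fun i => z i = true) =
      (sparsePrefix S k).filter fun i => z' i = true :=
  Finset.filter_congr fun i hi => by rw [h i hi]

theorem sparseWeight_congr {S : Finset ι} (b : Bool) {z z' : ι → Bool} (k : Fin S.card)
    (h : AgreeOn (sparsePrefix S (k.val + 1)) z z') :
    sparseWeight S b z k = sparseWeight S b z' k := by
  rw [sparsePrefix_succ] at h
  have h1 : z (sparseElem S k) = z' (sparseElem S k) := h _ (Finset.mem_insert_self _ _)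
  unfold sparseWeight
  rw [h1, filter_sparsePrefix_congr fun i hi => h i (Finset.mem_insert_of_mem hi)]

/-- If `z` has `0` and `z'` has `1` at the loaded element, both weights are the cheap one, which
sees only the common prefix. In the opposite case both are the expensive one, which is independent
of the input. -/
theorem sparseWeight_compat {S : Finset ι} {z z' : ι → Bool} (k : Fin S.card)
    (h : AgreeOn (sparsePrefix S k.val) z z') (hk : z (sparseElem S k) ≠ z' (sparseElem S k)) :
    sparseWeight S false z k = sparseWeight S true z' k := by
  unfold sparseWeight
  rw [filter_sparsePrefix_congr h]
  cases h1 : z (sparseElem S k) <;> cases h2 : z' (sparseElem S k) <;> simp_all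

/-- Negative complexity of `SparseLoad`. -/
theorem sum_sparseWeight_false_le (S : Finset ι) (z : ι → Bool) :
    ∑ k, sparseWeight S false z k ≤
      6 * ((S.card : ℝ) * (onesOn z S + 1)) * Real.log ((S.card : ℝ) + 1) := by
  have hL := log_card_succ_nonneg S
  set L := Real.log ((S.card : ℝ) + 1)
  -- At a zero the prefix count is at most the number of all ones; at a one the price `3 N L` is
  -- charged to that one.
  have h : ∀ k, sparseWeight S false z k ≤ 3 * ((onesOn z S : ℝ) + 1) * L +
      3 * (S.card : ℝ) * L * if z (sparseElem S k) = true then (1 : ℝ) else 0 := by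
    intro k
    have h1 : ((((sparsePrefix S k).filter fun i => z i = true).card : ℝ)) ≤ onesOn z S := by
      exact_mod_cast onesOn_mono z (sparsePrefix_subset S k)
    unfold sparseWeight
    split_ifs with h2 h3
    · simp [h2] at h3
    · rw [mul_zero, add_zero]
      gcongr
    · have : 0 ≤ 3 * ((onesOn z S : ℝ) + 1) * L := by positivity
      linarith
    · simp_all
  calc ∑ k, sparseWeight S false z k ≤ _ := Finset.sum_le_sum fun k _ => h k
    _ = 3 * ((S.card : ℝ) * (onesOn z S + 1)) * L + 3 * ((S.card : ℝ) * onesOn z S) * L := by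
        rw [Finset.sum_add_distrib, ← Finset.mul_sum _ _ (3 * (S.card : ℝ) * L),
          sum_ones_sparseElem]
        simp only [Finset.sum_const, Finset.card_univ, Fintype.card_fin, nsmul_eq_mul]
        ring
    _ ≤ 3 * ((S.card : ℝ) * (onesOn z S + 1)) * L +
          3 * ((S.card : ℝ) * (onesOn z S + 1)) * L := by
        gcongr
        linarith
    _ = _ := by ring

/-- The successive ones are met with prefix counts `0, 1, 2, …`, so the reciprocals form a harmonic
sum. -/
theorem sum_inv_count_succ (p : ℕ → Prop) [DecidablePred p] (N : ℕ) :
    (∑ k ∈ Finset.range N, if p k then ((Nat.count p k : ℝ) + 1)⁻¹ else 0) =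
      (harmonic (Nat.count p N) : ℝ) := by
  induction N with
  | zero => simp
  | succ N ih =>
    rw [Finset.sum_range_succ, ih, Nat.count_succ]
    split_ifs
    · rw [harmonic_succ]
      push_cast
      ring
    · simp

theorem card_filter_sparsePrefix (S : Finset ι) (z : ι → Bool) (k : Fin S.card)
    [DecidablePred fun l => ∃ h : l < S.card, z (sparseElem S ⟨l, h⟩) = true] :
    ((sparsePrefix S k).filter fun i => z i = true).card =
      Nat.count (fun l => ∃ h : l < S.card, z (sparseElem S ⟨l, h⟩) = true) k := by
  rw [Nat.count_eq_card_filter_range]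
  symm
  refine Finset.card_bij (fun l hl => sparseElem S ⟨l, (Finset.mem_filter.1 hl).2.1⟩) ?_ ?_ ?_
  · intro l hl
    obtain ⟨h1, h2, h3⟩ := Finset.mem_filter.1 hl
    exact Finset.mem_filter.2 ⟨mem_sparsePrefix.2 ⟨_, Finset.mem_range.1 h1, rfl⟩, h3⟩
  · intro l _ l' _ h
    simpa using sparseElem_injective S h
  · intro i hi
    obtain ⟨h1, h2⟩ := Finset.mem_filter.1 hi
    obtain ⟨l, hl, rfl⟩ := mem_sparsePrefix.1 h1
    exact ⟨l, Finset.mem_filter.2 ⟨Finset.mem_range.2 hl, l.2, h2⟩, rfl⟩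

/-- Positive complexity of `SparseLoad`. -/
theorem sum_inv_sparseWeight_true_le (S : Finset ι) (z : ι → Bool) :
    ∑ k, (sparseWeight S true z k)⁻¹ ≤ 2 := by
  classical
  rcases Nat.eq_zero_or_pos S.card with h0 | h0
  · have : IsEmpty (Fin S.card) := by rw [h0]; infer_instance
    simp
  have h1 : (1 : ℝ) ≤ S.card := by exact_mod_cast h0
  set L := Real.log ((S.card : ℝ) + 1) with hL
  -- This holds as `log 2 > 2/3`. The last step needs `2 + L ≤ 6 L` only, which is weaker.
  have hL2 : (2 / 3 : ℝ) ≤ L := by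
    have : Real.log 2 ≤ L := Real.log_le_log (by norm_num) (by linarith)
    linarith [Real.log_two_gt_d9]
  let p : ℕ → Prop := fun l => ∃ h : l < S.card, z (sparseElem S ⟨l, h⟩) = true
  have h : ∀ k : Fin S.card, (sparseWeight S true z k)⁻¹ ≤
      (3 * L)⁻¹ * (if p k then ((Nat.count p k : ℝ) + 1)⁻¹ else 0) +
        (3 * L)⁻¹ * (S.card : ℝ)⁻¹ := by
    intro k
    have hp : p k ↔ z (sparseElem S k) = true := ⟨fun h => h.2, fun h => ⟨k.2, h⟩⟩
    unfold sparseWeight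
    rw [card_filter_sparsePrefix]
    by_cases hz : z (sparseElem S k) = true
    · rw [if_pos hz, if_pos (hp.2 hz), ← mul_inv]
      have : 0 ≤ (3 * L)⁻¹ * (S.card : ℝ)⁻¹ := by positivity
      refine le_add_of_le_of_nonneg (le_of_eq ?_) this
      change (3 * ((Nat.count p k : ℝ) + 1) * L)⁻¹ = _
      ring_nf
    · rw [if_neg hz, if_neg (mt hp.1 hz), ← mul_inv]
      rw [mul_zero, zero_add]
      apply le_of_eq
      rw [← hL]
      ring_nf
  have hsum : (∑ k : Fin S.card, if p k then ((Nat.count p k : ℝ) + 1)⁻¹ else 0) ≤ 1 + L := by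
    rw [Fin.sum_univ_eq_sum_range (fun k => if p k then ((Nat.count p k : ℝ) + 1)⁻¹ else 0)]
    rw [sum_inv_count_succ p S.card]
    refine (harmonic_le_one_add_log _).trans ?_
    have hc : (Nat.count p S.card : ℝ) ≤ S.card := by exact_mod_cast Nat.count_le p
    -- Without ones, `Real.log 0 = 0` is a default value and monotonicity of the logarithm does not
    -- apply.
    rcases Nat.eq_zero_or_pos (Nat.count p S.card) with h3 | h3
    · rw [h3]
      simp
      linarith
    · have : Real.log (Nat.count p S.card) ≤ L :=
        Real.log_le_log (by exact_mod_cast h3) (by linarith)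
      linarith
  calc ∑ k, (sparseWeight S true z k)⁻¹ ≤ _ := Finset.sum_le_sum fun k _ => h k
    _ = (3 * L)⁻¹ * (∑ k : Fin S.card, if p k then ((Nat.count p k : ℝ) + 1)⁻¹ else 0) +
          (3 * L)⁻¹ := by
        rw [Finset.sum_add_distrib, ← Finset.mul_sum]
        simp
        field_simp
    _ ≤ (3 * L)⁻¹ * (1 + L) + (3 * L)⁻¹ := by gcongr
    _ ≤ 2 := by
        rw [← mul_add_one, inv_mul_le_iff₀ (by linarith)]
        linarith

end SparseLoad

/-! ### Expansion of super edges into paths. -/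

namespace SuperGraph

variable {ι : Type} [DecidableEq ι]

/-- There is a super edge from `u` to `v`. -/
def Adj (H : SuperGraph ι) (u v : H.Vert) : Prop := ∃ e, H.src e = u ∧ H.tgt e = v

open Classical in
/-- Outgoing flow minus incoming flow at the vertex `v`, for the input `y`. -/
noncomputable def netOut (H : SuperGraph ι) (y : ι → Bool) (v : H.Vert) : ℝ :=
  (∑ e, if H.src e = v then H.flow y e else 0) - ∑ e, if H.tgt e = v then H.flow y e else 0

/-- Conditions on a super graph under which its expansion is a learning graph. All edges go from
one level to the next one. -/
structure IsLayered (H : SuperGraph ι) (f : (ι → Bool) → Prop) (level : H.Vert → ℕ) :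
    Prop where
  level_root : level H.root = 0
  level_step : ∀ e, level (H.tgt e) = level (H.src e) + 1
  rooted : ∀ e, Relation.ReflTransGen H.Adj H.root (H.src e)
  label_root : H.label H.root = ∅
  label_mono : ∀ e, H.label (H.src e) ⊆ H.label (H.tgt e)
  scale_nonneg : ∀ z e, 0 ≤ H.scale z e
  scale_local : ∀ z z' e, AgreeOn (H.label (H.src e)) z z' → H.scale z e = H.scale z' e
  flow_nonneg : ∀ y, f y → ∀ e, 0 ≤ H.flow y e
  flow_le_scale : ∀ y, f y → ∀ e, H.flow y e ≤ H.scale y e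
  flow_root : ∀ y, f y → H.netOut y H.root = 1
  flow_source : ∀ y, f y → ∀ v, v ≠ H.root → H.netOut y v ≤ 0
  sink_certificate : ∀ y, f y → ∀ v, H.netOut y v < 0 →
    IsOneCertificate Set.univ f y (H.label v)

section Expansion

variable (H : SuperGraph ι)

/-- Splitting off the last edge of each path suits targets and weights, since that edge is the empty
transition; splitting off the first edge, as in `expansion_sum'`, suits sources. -/
theorem expansion_sum (F : H.expansion.Edge → ℝ) :
    ∑ p, F p = ∑ e, ((∑ i : Fin (H.loadSet e).card, F ⟨e, i.castSucc⟩) + F ⟨e, Fin.last _⟩) := by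
  refine Eq.trans (Fintype.sum_sigma F) (Finset.sum_congr rfl fun e _ => ?_)
  rw [Fin.sum_univ_castSucc]

theorem expansion_sum' (F : H.expansion.Edge → ℝ) :
    ∑ p, F p = ∑ e, (F ⟨e, 0⟩ + ∑ i : Fin (H.loadSet e).card, F ⟨e, i.succ⟩) := by
  refine Eq.trans (Fintype.sum_sigma F) (Finset.sum_congr rfl fun e _ => ?_)
  rw [Fin.sum_univ_succ]

theorem expansion_src_zero (e : H.Edge) : H.expansion.src ⟨e, 0⟩ = Sum.inl (H.src e) := rfl

theorem expansion_src_succ (e : H.Edge) (i : Fin (H.loadSet e).card) :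
    H.expansion.src ⟨e, i.succ⟩ = Sum.inr ⟨e, i⟩ := rfl

theorem expansion_tgt_last (e : H.Edge) :
    H.expansion.tgt ⟨e, Fin.last _⟩ = Sum.inl (H.tgt e) := by
  simp [expansion]

theorem expansion_tgt_castSucc (e : H.Edge) (i : Fin (H.loadSet e).card) :
    H.expansion.tgt ⟨e, i.castSucc⟩ = Sum.inr ⟨e, i⟩ := by
  simp [expansion]

theorem expansion_weight_last (b : Bool) (z : ι → Bool) (e : H.Edge) :
    H.expansion.weight b z ⟨e, Fin.last _⟩ = 0 := by
  simp [expansion]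

theorem expansion_weight_castSucc (b : Bool) (z : ι → Bool) (e : H.Edge)
    (i : Fin (H.loadSet e).card) : H.expansion.weight b z ⟨e, i.castSucc⟩ =
      H.scale z e * sparseWeight (H.loadSet e) b z i := by
  simp [expansion]

theorem expansion_label_src (e : H.Edge) (k : Fin ((H.loadSet e).card + 1)) :
    H.expansion.label (H.expansion.src ⟨e, k⟩) =
      H.label (H.src e) ∪ sparsePrefix (H.loadSet e) k.val := by
  cases k using Fin.cases with
  | zero => rw [expansion_src_zero]; simp [expansion]
  | succ i => rfl

theorem expansion_label_tgt_castSucc (e : H.Edge) (i : Fin (H.loadSet e).card) :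
    H.expansion.label (H.expansion.tgt ⟨e, i.castSucc⟩) =
      H.label (H.src e) ∪ sparsePrefix (H.loadSet e) (i.val + 1) := by
  rw [expansion_tgt_castSucc]
  rfl

theorem expansion_label_tgt_castSucc_eq_insert (e : H.Edge) (i : Fin (H.loadSet e).card) :
    H.expansion.label (H.expansion.tgt ⟨e, i.castSucc⟩) =
      insert (sparseElem (H.loadSet e) i)
        (H.expansion.label (H.expansion.src ⟨e, i.castSucc⟩)) := by
  rw [expansion_label_tgt_castSucc, expansion_label_src, sparsePrefix_succ,
    Finset.union_insert]
  rfl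

theorem sparseElem_notMem_label_src (e : H.Edge) (i : Fin (H.loadSet e).card) :
    sparseElem (H.loadSet e) i ∉ H.expansion.label (H.expansion.src ⟨e, i.castSucc⟩) := by
  rw [expansion_label_src, Finset.mem_union, not_or]
  exact ⟨(Finset.mem_sdiff.1 (sparseElem_mem (H.loadSet e) i)).2,
    sparseElem_notMem_sparsePrefix _ i⟩

theorem expansion_loading_castSucc (e : H.Edge) (i : Fin (H.loadSet e).card) :
    H.expansion.Loading ⟨e, i.castSucc⟩ := by
  intro h
  apply sparseElem_notMem_label_src H e i
  rw [← h, expansion_label_tgt_castSucc_eq_insert]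
  exact Finset.mem_insert_self _ _

/-- The closing edge of a path is an empty transition: all of `loadSet e` is loaded by then, and
monotonicity of the labels makes the union equal to the target label. -/
theorem expansion_label_last {e : H.Edge} (h : H.label (H.src e) ⊆ H.label (H.tgt e)) :
    H.expansion.label (H.expansion.tgt ⟨e, Fin.last _⟩) =
      H.expansion.label (H.expansion.src ⟨e, Fin.last _⟩) := by
  rw [expansion_label_src, Fin.val_last, sparsePrefix_card, expansion_tgt_last, loadSet,
    Finset.union_sdiff_of_subset h]
  rfl

theorem netOut_expansion_inl (y : ι → Bool) (v : H.Vert) :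
    H.expansion.netOut y (Sum.inl v) = H.netOut y v := by
  unfold LGraph.netOut netOut
  congr 1
  · refine (expansion_sum' H _).trans (Finset.sum_congr rfl fun e _ => ?_)
    have h : ∀ i : Fin (H.loadSet e).card,
        ¬ H.expansion.src ⟨e, i.succ⟩ = (Sum.inl v : H.expansion.Vert) := by
      intro i h
      rw [expansion_src_succ] at h
      cases h
    rw [Finset.sum_eq_zero fun i _ => if_neg (h i), add_zero, expansion_src_zero]
    by_cases hv : H.src e = v
    · rw [if_pos hv, if_pos (by rw [hv])]; rfl
    · exact (if_neg fun h => hv (Sum.inl.inj h)).trans (if_neg hv).symm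
  · refine (expansion_sum H _).trans (Finset.sum_congr rfl fun e _ => ?_)
    have h : ∀ i : Fin (H.loadSet e).card,
        ¬ H.expansion.tgt ⟨e, i.castSucc⟩ = (Sum.inl v : H.expansion.Vert) := by
      intro i h
      rw [expansion_tgt_castSucc] at h
      cases h
    rw [Finset.sum_eq_zero fun i _ => if_neg (h i), zero_add, expansion_tgt_last]
    by_cases hv : H.tgt e = v
    · rw [if_pos hv, if_pos (by rw [hv])]; rfl
    · exact (if_neg fun h => hv (Sum.inl.inj h)).trans (if_neg hv).symm

/-- An inner vertex of a path has one edge in and one edge out, both carrying the flow of the same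
super edge. -/
theorem netOut_expansion_inr (y : ι → Bool) (p : Σ e : H.Edge, Fin (H.loadSet e).card) :
    H.expansion.netOut y (Sum.inr p) = 0 := by
  unfold LGraph.netOut
  rw [sub_eq_zero]
  refine (expansion_sum' H _).trans (Eq.trans (Finset.sum_congr rfl fun e _ => ?_)
    (expansion_sum H _).symm)
  rw [if_neg (by rw [expansion_src_zero]; exact Sum.inl_ne_inr),
    if_neg (by rw [expansion_tgt_last]; exact Sum.inl_ne_inr), add_zero, zero_add]
  refine Finset.sum_congr rfl fun i _ => ?_
  rw [expansion_src_succ, expansion_tgt_castSucc]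
  rfl

/-- Every vertex on the path that replaces `e` is reached from `src e`. -/
theorem expansion_reaches_src (e : H.Edge) (k : Fin ((H.loadSet e).card + 1)) :
    Relation.ReflTransGen H.expansion.Adj (Sum.inl (H.src e)) (H.expansion.src ⟨e, k⟩) := by
  induction k using Fin.induction with
  | zero => exact .refl
  | succ i ih => exact ih.tail ⟨⟨e, i.castSucc⟩, rfl, expansion_tgt_castSucc H e i⟩

theorem expansion_reaches {u v : H.Vert} (h : Relation.ReflTransGen H.Adj u v) :
    Relation.ReflTransGen H.expansion.Adj (Sum.inl u) (Sum.inl v) := by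
  induction h with
  | refl => exact .refl
  | tail _ hab ih =>
    obtain ⟨e, rfl, rfl⟩ := hab
    exact (ih.trans (expansion_reaches_src H e (Fin.last _))).tail
      ⟨⟨e, Fin.last _⟩, rfl, expansion_tgt_last H e⟩

/-- The level of a vertex of the expansion. -/
def expansionLevel (level : H.Vert → ℕ) : H.expansion.Vert → ℕ ×ₗ ℕ
  | Sum.inl v => toLex (level v, 0)
  | Sum.inr ⟨e, i⟩ => toLex (level (H.src e), i.val + 1)

theorem expansionLevel_src (level : H.Vert → ℕ) (e : H.Edge)
    (k : Fin ((H.loadSet e).card + 1)) :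
    H.expansionLevel level (H.expansion.src ⟨e, k⟩) = toLex (level (H.src e), k.val) := by
  cases k using Fin.cases with
  | zero => rfl
  | succ i => rfl

/-- Along a path the second coordinate grows while the first stays fixed; the closing edge raises
the first. A strictly increasing rank excludes cycles. -/
theorem expansionLevel_lt {level : H.Vert → ℕ}
    (hl : ∀ e, level (H.src e) < level (H.tgt e)) (p : H.expansion.Edge) :
    H.expansionLevel level (H.expansion.src p) <
      H.expansionLevel level (H.expansion.tgt p) := by
  obtain ⟨e, k⟩ := p
  rw [expansionLevel_src]
  cases k using Fin.lastCases with
  | last =>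
    rw [expansion_tgt_last]
    exact Prod.Lex.toLex_lt_toLex.2 (Or.inl (hl e))
  | cast i =>
    rw [expansion_tgt_castSucc]
    exact Prod.Lex.toLex_lt_toLex.2 (Or.inr ⟨rfl, Nat.lt_succ_self _⟩)

theorem expansion_acyclic {level : H.Vert → ℕ}
    (hl : ∀ e, level (H.src e) < level (H.tgt e)) (v : H.expansion.Vert) :
    ¬ Relation.TransGen H.expansion.Adj v v := by
  have h : ∀ u w, Relation.TransGen H.expansion.Adj u w →
      H.expansionLevel level u < H.expansionLevel level w := by
    intro u w huw
    induction huw with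
    | single h =>
      obtain ⟨e, rfl, rfl⟩ := h
      exact H.expansionLevel_lt hl e
    | tail _ h ih =>
      obtain ⟨e, rfl, rfl⟩ := h
      exact ih.trans (H.expansionLevel_lt hl e)
  exact fun hv => lt_irrefl _ (h v v hv)

end Expansion

/-! ### Correctness and complexity of the expansion. -/

namespace IsLayered

variable {H : SuperGraph ι} {f : (ι → Bool) → Prop} {level : H.Vert → ℕ}

/-- Weights are products. The scale is determined by the label of the source of the super edge, so
locality and compatibility reduce to those of `SparseLoad`. Sparse weights are positive, so a
vanishing weight means a vanishing scale, hence no flow. -/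
theorem isLearningGraphFor (h : H.IsLayered f level) :
    H.expansion.IsLearningGraphFor Set.univ f where
  acyclic := H.expansion_acyclic (level := level) fun e => by
    rw [h.level_step e]; exact Nat.lt_succ_self _
  rooted := fun ⟨e, k⟩ => (H.expansion_reaches (h.rooted e)).trans (H.expansion_reaches_src e k)
  label_root := h.label_root
  label_step := by
    rintro ⟨e, k⟩ hk
    cases k using Fin.lastCases with
    | last => exact absurd (H.expansion_label_last (h.label_mono e)) hk
    | cast i => exact ⟨_, H.sparseElem_notMem_label_src e i,
        H.expansion_label_tgt_castSucc_eq_insert e i⟩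
  weight_nonneg := by
    rintro b z - ⟨e, k⟩
    cases k using Fin.lastCases with
    | last => rw [expansion_weight_last]
    | cast i =>
      rw [expansion_weight_castSucc]
      exact mul_nonneg (h.scale_nonneg z e) (sparseWeight_nonneg _ _ _ _)
  weight_local := by
    rintro b z - z' - ⟨e, k⟩ hz
    cases k using Fin.lastCases with
    | last => rw [expansion_weight_last, expansion_weight_last]
    | cast i =>
      rw [expansion_label_tgt_castSucc] at hz
      rw [expansion_weight_castSucc, expansion_weight_castSucc,
        h.scale_local z z' e fun j hj => hz j (Finset.mem_union_left _ hj),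
        sparseWeight_congr b i fun j hj => hz j (Finset.mem_union_right _ hj)]
  weight_compat := by
    rintro x - - y - - ⟨e, k⟩ j hj hj' hxy hne
    cases k using Fin.lastCases with
    | last => rw [expansion_weight_last, expansion_weight_last]
    | cast i =>
      -- The labels determine the loaded index, since the element of the path is not in the source
      -- label.
      have hij : sparseElem (H.loadSet e) i = j := by
        have : sparseElem (H.loadSet e) i ∈
            insert j (H.expansion.label (H.expansion.src ⟨e, i.castSucc⟩)) := by
          rw [← hj', expansion_label_tgt_castSucc_eq_insert]
          exact Finset.mem_insert_self _ _
        exact (Finset.mem_insert.1 this).resolve_right (H.sparseElem_notMem_label_src e i)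
      subst hij
      rw [expansion_label_src] at hxy
      rw [expansion_weight_castSucc, expansion_weight_castSucc,
        h.scale_local x y e fun j hj => hxy j (Finset.mem_union_left _ hj),
        sparseWeight_compat i (fun j hj => hxy j (Finset.mem_union_right _ hj)) hne]
  flow_nonneg := fun y _ hy ⟨e, _⟩ => h.flow_nonneg y hy e
  flow_root := fun y _ hy => (H.netOut_expansion_inl y H.root).trans (h.flow_root y hy)
  flow_source := by
    rintro y - hy (v | p) hv
    · rw [netOut_expansion_inl]
      exact h.flow_source y hy v fun h => hv (by rw [h]; rfl)
    · rw [netOut_expansion_inr]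
  flow_support := by
    rintro y - hy ⟨e, k⟩ hk hw
    cases k using Fin.lastCases with
    | last => exact absurd (H.expansion_label_last (h.label_mono e)) hk
    | cast i =>
      rw [expansion_weight_castSucc] at hw
      have h0 := (mul_eq_zero.1 hw).resolve_right (sparseWeight_pos _ _ _ _).ne'
      exact le_antisymm (h0 ▸ h.flow_le_scale y hy e) (h.flow_nonneg y hy e)
  sink_certificate := by
    rintro y - hy (v | p) hv
    · rw [netOut_expansion_inl] at hv
      exact h.sink_certificate y hy v hv
    · rw [netOut_expansion_inr] at hv
      exact absurd hv (lt_irrefl _)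

theorem negComplexity_le (h : H.IsLayered f level) (z : ι → Bool) :
    H.expansion.negComplexity z ≤ ∑ e, H.scale z e *
      (6 * (((H.loadSet e).card : ℝ) * (onesOn z (H.loadSet e) + 1)) *
        Real.log (((H.loadSet e).card : ℝ) + 1)) := by
  unfold LGraph.negComplexity
  refine (expansion_sum H _).trans_le (Finset.sum_le_sum fun e _ => ?_)
  have hlast : ¬ H.expansion.Loading ⟨e, Fin.last _⟩ := fun hl =>
    hl (H.expansion_label_last (h.label_mono e))
  rw [if_neg hlast, add_zero]
  refine le_trans (le_of_eq ?_) (mul_le_mul_of_nonneg_left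
    (sum_sparseWeight_false_le (H.loadSet e) z) (h.scale_nonneg z e))
  rw [Finset.mul_sum]
  refine Finset.sum_congr rfl fun i _ => ?_
  rw [if_pos (H.expansion_loading_castSucc e i), expansion_weight_castSucc]

set_option linter.unusedSectionVars false in
/-- The total flow is bounded by the length of the paths. -/
theorem sum_flow_le (h : H.IsLayered f level) {L : ℕ} (hL : ∀ e, level (H.tgt e) ≤ L)
    {y : ι → Bool} (hy : f y) : ∑ e, H.flow y e ≤ L := by
  classical
  -- The vertex type need not be finite, so the sums run over the root and the end points of edges.
  let V : Finset H.Vert := insert H.root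
    (Finset.univ.image H.src ∪ Finset.univ.image H.tgt)
  have hsrc : ∀ e, H.src e ∈ V := fun e => by simp [V]
  have htgt : ∀ e, H.tgt e ∈ V := fun e => by simp [V]
  -- Summation by parts. The choice `g = 1` gives total net flow `0`; the choice `g = level` gives
  -- minus the total flow, as each edge raises the level by one.
  have key : ∀ g : H.Vert → ℝ, ∑ v ∈ V, g v * H.netOut y v =
      ∑ e, (g (H.src e) - g (H.tgt e)) * H.flow y e := by
    intro g
    have h1 : ∀ s : H.Edge → H.Vert, (∀ e, s e ∈ V) →
        ∑ v ∈ V, g v * (∑ e, if s e = v then H.flow y e else 0) =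
          ∑ e, g (s e) * H.flow y e := by
      intro s hs
      simp_rw [Finset.mul_sum]
      rw [Finset.sum_comm]
      refine Finset.sum_congr rfl fun e _ => ?_
      rw [Finset.sum_eq_single (s e)]
      · simp
      · intro v _ hv
        rw [if_neg (Ne.symm hv), mul_zero]
      · exact fun hn => absurd (hs e) hn
    unfold netOut
    simp_rw [mul_sub, sub_mul]
    rw [Finset.sum_sub_distrib, Finset.sum_sub_distrib, ← h1 H.src hsrc, ← h1 H.tgt htgt]
  have h0 : ∑ v ∈ V, H.netOut y v = 0 := by
    have := key fun _ => 1
    simpa using this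
  have h1 : ∑ e, H.flow y e = -∑ v ∈ V, (level v : ℝ) * H.netOut y v := by
    rw [key fun v => (level v : ℝ), ← Finset.sum_neg_distrib]
    refine Finset.sum_congr rfl fun e _ => ?_
    rw [h.level_step e]
    push_cast
    ring
  have hroot : H.root ∈ V := Finset.mem_insert_self _ _
  rw [← Finset.add_sum_erase V _ hroot, h.flow_root y hy] at h0
  rw [h1, ← Finset.add_sum_erase V _ hroot, h.level_root]
  -- Away from the root the net flow is nonpositive with sum `-1`, so replacing each level by its
  -- bound `L` can only decrease the sum.
  have h2 : ∑ v ∈ V.erase H.root, (L : ℝ) * H.netOut y v ≤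
      ∑ v ∈ V.erase H.root, (level v : ℝ) * H.netOut y v := by
    refine Finset.sum_le_sum fun v hv => ?_
    obtain ⟨hv, hvV⟩ := Finset.mem_erase.1 hv
    have hlv : level v ≤ L := by
      rcases Finset.mem_union.1 ((Finset.mem_insert.1 hvV).resolve_left hv) with hv | hv
      · obtain ⟨e, -, rfl⟩ := Finset.mem_image.1 hv
        have := h.level_step e
        have := hL e
        omega
      · obtain ⟨e, -, rfl⟩ := Finset.mem_image.1 hv
        exact hL e
    exact mul_le_mul_of_nonpos_right (by exact_mod_cast hlv) (h.flow_source y hy v hv)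
  rw [← Finset.mul_sum, show ∑ v ∈ V.erase H.root, H.netOut y v = -1 by linarith] at h2
  push_cast
  linarith

/-- On one path the flow `f` is constant and the scale `s` factors out, which leaves `f² / s` times
a sum of inverse sparse weights. That sum is at most `2`, and `f ≤ s` gives at most `2 f`; then the
total flow is bounded by `sum_flow_le`. -/
theorem posComplexity_le (h : H.IsLayered f level) {L : ℕ} (hL : ∀ e, level (H.tgt e) ≤ L)
    {y : ι → Bool} (hy : f y) : H.expansion.posComplexity y ≤ 2 * L := by
  unfold LGraph.posComplexity
  refine le_trans ((expansion_sum H _).trans_le (Finset.sum_le_sum fun e _ => ?_))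
    ((Finset.mul_sum _ _ _).symm.trans_le
      (mul_le_mul_of_nonneg_left (h.sum_flow_le hL hy) zero_le_two))
  have hlast : ¬ H.expansion.Loading ⟨e, Fin.last _⟩ := fun hl =>
    hl (H.expansion_label_last (h.label_mono e))
  rw [if_neg hlast, add_zero]
  have hf := h.flow_nonneg y hy e
  have hs := h.flow_le_scale y hy e
  -- This covers `scale = 0` too: the quotient is then `0` by convention.
  have h1 : H.flow y e ^ 2 / H.scale y e ≤ H.flow y e := by
    refine div_le_of_le_mul₀ (hf.trans hs) hf ?_
    rw [pow_two]
    exact mul_le_mul_of_nonneg_left hs hf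
  calc _ = (H.flow y e ^ 2 / H.scale y e) * ∑ i, (sparseWeight (H.loadSet e) true y i)⁻¹ := by
        rw [Finset.mul_sum]
        refine Finset.sum_congr rfl fun i _ => ?_
        rw [if_pos (H.expansion_loading_castSucc e i), expansion_weight_castSucc,
          ← div_div, div_eq_mul_inv (_ / _)]
        rfl
    _ ≤ H.flow y e * 2 := mul_le_mul h1 (sum_inv_sparseWeight_true_le _ _)
        (Finset.sum_nonneg fun i _ => inv_nonneg.2 (sparseWeight_nonneg _ _ _ _)) hf
    _ = _ := mul_comm _ _

end IsLayered

end SuperGraph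

/-! ## Sums over the super edges -/

section EdgeSum

open Finset

variable {n : ℕ}

/-- The pairs of elements of `B`. -/
def pairsIn (B : Finset (Fin n)) : Finset (Slot n) := univ.filter fun e => ∀ u ∈ e.1, u ∈ B

theorem mem_pairsIn {B : Finset (Fin n)} {e : Slot n} : e ∈ pairsIn B ↔ ∀ u ∈ e.1, u ∈ B := by
  simp [pairsIn]

/-- The sum over the super edges that belong to a fixed set `X`, given the summands for the nine
kinds of edges. -/
noncomputable def localSum (a b : ℕ) (X : Finset (Fin n)) (f₁ : Fin n → ℝ)
    (f₂ : Fin n → Slot n → ℝ) (f₃ : Finset (Fin n) → ℝ) (f₄ f₅ : Finset (Fin n) → Fin n → ℝ)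
    (f₆ : Finset (Fin n) → Fin n → Finset (Fin n) → ℝ)
    (f₇ f₈ : Finset (Fin n) → Fin n → Finset (Fin n) → Fin n → ℝ)
    (f₉ : Finset (Fin n) → Fin n → Finset (Fin n) → Slot n → ℝ) : ℝ :=
  (∑ t ∈ X, f₁ t) + ((∑ t ∈ X, ∑ e, f₂ t e) + ((∑ A ∈ powersetCard (a - 2) univ, f₃ A) +
  ((∑ A ∈ powersetCard (a - 2) univ, ∑ j ∈ univ \ A, f₄ A j) +
  ((∑ A ∈ powersetCard (a - 1) univ, ∑ j ∈ univ \ A, f₅ A j) +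
  ((∑ A ∈ powersetCard a univ, ∑ w, ∑ B ∈ powersetCard (b - 2) A, f₆ A w B) +
  ((∑ A ∈ powersetCard a univ, ∑ w, ∑ B ∈ powersetCard (b - 2) A, ∑ j ∈ A \ B, f₇ A w B j) +
  ((∑ A ∈ powersetCard a univ, ∑ w, ∑ B ∈ powersetCard (b - 1) A, ∑ j ∈ A \ B, f₈ A w B j) +
  (∑ A ∈ powersetCard a univ, ∑ w, ∑ B ∈ powersetCard b A, ∑ e ∈ pairsIn B, f₉ A w B e))))))))

/-- The nine kinds of super edges as iterated dependent sums. -/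
abbrev TriEdgeSum (n x a b : ℕ) : Type :=
  Σ X : ↥(powersetCard x (univ : Finset (Fin n))),
    (↥X.1 ⊕ ((Σ _ : ↥X.1, Slot n) ⊕ (↥(powersetCard (a - 2) (univ : Finset (Fin n))) ⊕
    ((Σ A : ↥(powersetCard (a - 2) (univ : Finset (Fin n))), ↥(univ \ A.1)) ⊕
    ((Σ A : ↥(powersetCard (a - 1) (univ : Finset (Fin n))), ↥(univ \ A.1)) ⊕
    ((Σ A : ↥(powersetCard a (univ : Finset (Fin n))), Σ _ : Fin n,
      ↥(powersetCard (b - 2) A.1)) ⊕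
    ((Σ A : ↥(powersetCard a (univ : Finset (Fin n))), Σ _ : Fin n,
      Σ B : ↥(powersetCard (b - 2) A.1), ↥(A.1 \ B.1)) ⊕
    ((Σ A : ↥(powersetCard a (univ : Finset (Fin n))), Σ _ : Fin n,
      Σ B : ↥(powersetCard (b - 1) A.1), ↥(A.1 \ B.1)) ⊕
    (Σ A : ↥(powersetCard a (univ : Finset (Fin n))), Σ _ : Fin n,
      Σ B : ↥(powersetCard b A.1), ↥(pairsIn B.1))))))))))

/-- The super edge given by an element of `TriEdgeSum`. -/
def TriEdgeSum.toEdge {x a b : ℕ} : TriEdgeSum n x a b → TriEdge n x a b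
  | ⟨X, .inl t⟩ => .star X.1 t.1 (mem_powersetCard_univ.1 X.2) t.2
  | ⟨X, .inr (.inl ⟨t, e⟩)⟩ => .starPair X.1 t.1 e (mem_powersetCard_univ.1 X.2) t.2
  | ⟨X, .inr (.inr (.inl A))⟩ =>
      .walkA0 X.1 A.1 (mem_powersetCard_univ.1 X.2) (mem_powersetCard_univ.1 A.2)
  | ⟨X, .inr (.inr (.inr (.inl ⟨A, j⟩)))⟩ =>
      .walkA1 X.1 A.1 j.1 (mem_powersetCard_univ.1 X.2) (mem_powersetCard_univ.1 A.2)
        (mem_sdiff.1 j.2).2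
  | ⟨X, .inr (.inr (.inr (.inr (.inl ⟨A, j⟩))))⟩ =>
      .walkA2 X.1 A.1 j.1 (mem_powersetCard_univ.1 X.2) (mem_powersetCard_univ.1 A.2)
        (mem_sdiff.1 j.2).2
  | ⟨X, .inr (.inr (.inr (.inr (.inr (.inl ⟨A, w, B⟩)))))⟩ =>
      .walkB0 X.1 A.1 w B.1 (mem_powersetCard_univ.1 X.2) (mem_powersetCard_univ.1 A.2)
        (mem_powersetCard.1 B.2).1 (mem_powersetCard.1 B.2).2
  | ⟨X, .inr (.inr (.inr (.inr (.inr (.inr (.inl ⟨A, w, B, j⟩))))))⟩ =>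
      .walkB1 X.1 A.1 w B.1 j.1 (mem_powersetCard_univ.1 X.2) (mem_powersetCard_univ.1 A.2)
        (mem_powersetCard.1 B.2).1 (mem_powersetCard.1 B.2).2 (mem_sdiff.1 j.2).1
        (mem_sdiff.1 j.2).2
  | ⟨X, .inr (.inr (.inr (.inr (.inr (.inr (.inr (.inl ⟨A, w, B, j⟩)))))))⟩ =>
      .walkB2 X.1 A.1 w B.1 j.1 (mem_powersetCard_univ.1 X.2) (mem_powersetCard_univ.1 A.2)
        (mem_powersetCard.1 B.2).1 (mem_powersetCard.1 B.2).2 (mem_sdiff.1 j.2).1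
        (mem_sdiff.1 j.2).2
  | ⟨X, .inr (.inr (.inr (.inr (.inr (.inr (.inr (.inr ⟨A, w, B, e⟩)))))))⟩ =>
      .pair X.1 A.1 w B.1 e.1 (mem_powersetCard_univ.1 X.2) (mem_powersetCard_univ.1 A.2)
        (mem_powersetCard.1 B.2).1 (mem_powersetCard.1 B.2).2 (mem_pairsIn.1 e.2)

/-- The element of `TriEdgeSum` that gives a super edge. -/
def TriEdge.toSum {x a b : ℕ} : TriEdge n x a b → TriEdgeSum n x a b
  | .star X t hX ht => ⟨⟨X, mem_powersetCard_univ.2 hX⟩, .inl ⟨t, ht⟩⟩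
  | .starPair X t e hX ht => ⟨⟨X, mem_powersetCard_univ.2 hX⟩, .inr (.inl ⟨⟨t, ht⟩, e⟩)⟩
  | .walkA0 X A hX hA => ⟨⟨X, mem_powersetCard_univ.2 hX⟩,
      .inr (.inr (.inl ⟨A, mem_powersetCard_univ.2 hA⟩))⟩
  | .walkA1 X A j hX hA hj => ⟨⟨X, mem_powersetCard_univ.2 hX⟩, .inr (.inr (.inr (.inl
      ⟨⟨A, mem_powersetCard_univ.2 hA⟩, ⟨j, mem_sdiff.2 ⟨mem_univ _, hj⟩⟩⟩)))⟩
  | .walkA2 X A j hX hA hj => ⟨⟨X, mem_powersetCard_univ.2 hX⟩, .inr (.inr (.inr (.inr (.inl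
      ⟨⟨A, mem_powersetCard_univ.2 hA⟩, ⟨j, mem_sdiff.2 ⟨mem_univ _, hj⟩⟩⟩))))⟩
  | .walkB0 X A w B hX hA hBA hB => ⟨⟨X, mem_powersetCard_univ.2 hX⟩,
      .inr (.inr (.inr (.inr (.inr (.inl ⟨⟨A, mem_powersetCard_univ.2 hA⟩, w,
        ⟨B, mem_powersetCard.2 ⟨hBA, hB⟩⟩⟩)))))⟩
  | .walkB1 X A w B j hX hA hBA hB hjA hj => ⟨⟨X, mem_powersetCard_univ.2 hX⟩,
      .inr (.inr (.inr (.inr (.inr (.inr (.inl ⟨⟨A, mem_powersetCard_univ.2 hA⟩, w,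
        ⟨B, mem_powersetCard.2 ⟨hBA, hB⟩⟩, ⟨j, mem_sdiff.2 ⟨hjA, hj⟩⟩⟩))))))⟩
  | .walkB2 X A w B j hX hA hBA hB hjA hj => ⟨⟨X, mem_powersetCard_univ.2 hX⟩,
      .inr (.inr (.inr (.inr (.inr (.inr (.inr (.inl ⟨⟨A, mem_powersetCard_univ.2 hA⟩, w,
        ⟨B, mem_powersetCard.2 ⟨hBA, hB⟩⟩, ⟨j, mem_sdiff.2 ⟨hjA, hj⟩⟩⟩)))))))⟩
  | .pair X A w B e hX hA hBA hB he => ⟨⟨X, mem_powersetCard_univ.2 hX⟩,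
      .inr (.inr (.inr (.inr (.inr (.inr (.inr (.inr ⟨⟨A, mem_powersetCard_univ.2 hA⟩, w,
        ⟨B, mem_powersetCard.2 ⟨hBA, hB⟩⟩, ⟨e, mem_pairsIn.2 he⟩⟩)))))))⟩

/-- Super edges as elements of `TriEdgeSum`. -/
def triEdgeEquiv (n x a b : ℕ) : TriEdge n x a b ≃ TriEdgeSum n x a b where
  toFun := TriEdge.toSum
  invFun := TriEdgeSum.toEdge
  left_inv e := by cases e <;> rfl
  right_inv s := by
    rcases s with ⟨X, t | ⟨t, e⟩ | A | ⟨A, j⟩ | ⟨A, j⟩ | ⟨A, w, B⟩ | ⟨A, w, B, j⟩ |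
      ⟨A, w, B, j⟩ | ⟨A, w, B, e⟩⟩ <;> rfl

theorem sum_coe_eq {α : Type} {s : Finset α} {F : s → ℝ} {f : α → ℝ} (h : ∀ i : s, F i = f i) :
    ∑ i, F i = ∑ i ∈ s, f i :=
  (Fintype.sum_congr _ _ h).trans (Finset.sum_coe_sort s f)

/-- The functions `f₁, …, f₉` take the data of an edge without the proofs of its side conditions.
The sum over the edge type becomes nested sums over `Finset`s, where sums can be exchanged and
averaged. -/
theorem sum_triEdge {x a b : ℕ} (F : TriEdge n x a b → ℝ)
    (f₁ : Finset (Fin n) → Fin n → ℝ) (f₂ : Finset (Fin n) → Fin n → Slot n → ℝ)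
    (f₃ : Finset (Fin n) → Finset (Fin n) → ℝ)
    (f₄ f₅ : Finset (Fin n) → Finset (Fin n) → Fin n → ℝ)
    (f₆ : Finset (Fin n) → Finset (Fin n) → Fin n → Finset (Fin n) → ℝ)
    (f₇ f₈ : Finset (Fin n) → Finset (Fin n) → Fin n → Finset (Fin n) → Fin n → ℝ)
    (f₉ : Finset (Fin n) → Finset (Fin n) → Fin n → Finset (Fin n) → Slot n → ℝ)
    (h₁ : ∀ X t hX ht, F (.star X t hX ht) = f₁ X t)
    (h₂ : ∀ X t e hX ht, F (.starPair X t e hX ht) = f₂ X t e)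
    (h₃ : ∀ X A hX hA, F (.walkA0 X A hX hA) = f₃ X A)
    (h₄ : ∀ X A j hX hA hj, F (.walkA1 X A j hX hA hj) = f₄ X A j)
    (h₅ : ∀ X A j hX hA hj, F (.walkA2 X A j hX hA hj) = f₅ X A j)
    (h₆ : ∀ X A w B hX hA hBA hB, F (.walkB0 X A w B hX hA hBA hB) = f₆ X A w B)
    (h₇ : ∀ X A w B j hX hA hBA hB hjA hj,
      F (.walkB1 X A w B j hX hA hBA hB hjA hj) = f₇ X A w B j)
    (h₈ : ∀ X A w B j hX hA hBA hB hjA hj,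
      F (.walkB2 X A w B j hX hA hBA hB hjA hj) = f₈ X A w B j)
    (h₉ : ∀ X A w B e hX hA hBA hB he, F (.pair X A w B e hX hA hBA hB he) = f₉ X A w B e) :
    ∑ e, F e = ∑ X ∈ powersetCard x univ, localSum a b X (f₁ X) (f₂ X) (f₃ X) (f₄ X) (f₅ X)
      (f₆ X) (f₇ X) (f₈ X) (f₉ X) := by
  rw [← (triEdgeEquiv n x a b).symm.sum_comp, Fintype.sum_sigma]
  refine sum_coe_eq fun X => ?_
  unfold localSum
  simp only [Fintype.sum_sum_type]
  congr 1
  · exact sum_coe_eq fun t => h₁ ..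
  congr 1
  · rw [Fintype.sum_sigma]
    exact sum_coe_eq fun t => Fintype.sum_congr _ _ fun e => h₂ ..
  congr 1
  · exact sum_coe_eq fun A => h₃ ..
  congr 1
  · rw [Fintype.sum_sigma]
    exact sum_coe_eq fun A => sum_coe_eq fun j => h₄ ..
  congr 1
  · rw [Fintype.sum_sigma]
    exact sum_coe_eq fun A => sum_coe_eq fun j => h₅ ..
  congr 1
  · simp only [Fintype.sum_sigma]
    exact sum_coe_eq fun A => Fintype.sum_congr _ _ fun w => sum_coe_eq fun B => h₆ ..
  congr 1
  · simp only [Fintype.sum_sigma]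
    exact sum_coe_eq fun A => Fintype.sum_congr _ _ fun w => sum_coe_eq fun B =>
      sum_coe_eq fun j => h₇ ..
  congr 1
  · simp only [Fintype.sum_sigma]
    exact sum_coe_eq fun A => Fintype.sum_congr _ _ fun w => sum_coe_eq fun B =>
      sum_coe_eq fun j => h₈ ..
  · simp only [Fintype.sum_sigma]
    exact sum_coe_eq fun A => Fintype.sum_congr _ _ fun w => sum_coe_eq fun B =>
      sum_coe_eq fun e => h₉ ..

end EdgeSum

/-! ## The flow in a Johnson walk -/

section Johnson

open Finset

variable {n : ℕ}

theorem unif_nonneg (N k : ℕ) : 0 ≤ unif N k := by unfold unif; positivity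

theorem card_mul_unif {U : Finset (Fin n)} {k : ℕ} (h : k ≤ U.card) :
    ((powersetCard k U).card : ℝ) * unif U.card k = 1 := by
  have : ((U.card.choose k : ℕ) : ℝ) ≠ 0 := by exact_mod_cast (Nat.choose_pos h).ne'
  rw [card_powersetCard, unif, mul_one_div_cancel this]

/-- The uniform weights on the `k`-subsets of an `N`-set and of an `(N-1)`-set. -/
theorem unif_pred_mul {N k : ℕ} (hN : 1 ≤ N) (h : k + 1 ≤ N) :
    unif (N - 1) k * ((N : ℝ) - k) = N * unif N k := by
  obtain ⟨M, rfl⟩ := Nat.exists_eq_add_of_le' hN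
  have h1 : ((M.choose k : ℕ) : ℝ) ≠ 0 := by exact_mod_cast (Nat.choose_pos (by omega)).ne'
  have h2 : (((M + 1).choose k : ℕ) : ℝ) ≠ 0 := by
    exact_mod_cast (Nat.choose_pos (by omega)).ne'
  have h3 := Nat.choose_mul_succ_eq M k
  have h4 : ((M.choose k : ℕ) : ℝ) * ((M : ℝ) + 1) = ((M + 1).choose k : ℕ) * ((M : ℝ) + 1 - k) := by
    have := congrArg (fun q : ℕ => (q : ℝ)) h3
    push_cast [Nat.cast_sub (show k ≤ M + 1 by omega)] at this
    exact this
  unfold unif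
  simp only [Nat.add_sub_cancel]
  push_cast
  field_simp
  linarith

theorem walkFlow1_nonneg {N k : ℕ} (h : k ≤ N) (u : Fin n) (A : Finset (Fin n)) (j : Fin n) :
    0 ≤ walkFlow1 N k u A j := by
  have h1 : (k : ℝ) ≤ N := by exact_mod_cast h
  have h2 := unif_nonneg N (k - 2)
  unfold walkFlow1
  split_ifs
  · exact div_nonneg h2 (by linarith)
  · exact h2
  · exact le_rfl

theorem walkFlow1_le {N k : ℕ} (h : k ≤ N) (u : Fin n) (A : Finset (Fin n)) (j : Fin n) :
    walkFlow1 N k u A j ≤ unif N (k - 2) := by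
  have h1 : (k : ℝ) ≤ N := by exact_mod_cast h
  have h2 := unif_nonneg N (k - 2)
  unfold walkFlow1
  split_ifs
  · exact div_le_self h2 (by linarith)
  · exact le_rfl
  · exact h2

theorem walkFlow2_nonneg {N k : ℕ} (h : k ≤ N) (u v : Fin n) (A : Finset (Fin n)) (j : Fin n) :
    0 ≤ walkFlow2 N k u v A j := by
  have h1 : (k : ℝ) ≤ N := by exact_mod_cast h
  have h2 := unif_nonneg (N - 1) (k - 2)
  unfold walkFlow2
  split_ifs
  · exact div_nonneg h2 (by linarith)
  · exact h2
  · exact le_rfl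
  · exact le_rfl

theorem walkFlow2_le {N k : ℕ} (h : k ≤ N) (u v : Fin n) (A : Finset (Fin n)) (j : Fin n) :
    walkFlow2 N k u v A j ≤ unif (N - 1) (k - 2) := by
  have h1 : (k : ℝ) ≤ N := by exact_mod_cast h
  have h2 := unif_nonneg (N - 1) (k - 2)
  unfold walkFlow2
  split_ifs
  · exact div_le_self h2 (by linarith)
  · exact le_rfl
  · exact h2
  · exact h2

variable {U A : Finset (Fin n)} {k : ℕ} {u v : Fin n}

theorem cast_card_sdiff (hA : A ⊆ U) : (((U \ A).card : ℕ) : ℝ) = U.card - A.card := by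
  rw [card_sdiff_of_subset hA, Nat.cast_sub (card_le_card hA)]

/-- Outgoing flow of the first incremental stage. -/
theorem sum_walkFlow1_out (hk : 2 ≤ k) (hkU : k ≤ U.card) (hu : u ∈ U) (hAU : A ⊆ U)
    (hA : A.card = k - 2) :
    ∑ j ∈ U \ A, walkFlow1 U.card k u A j = unif U.card (k - 2) := by
  have h1 : (k : ℝ) ≤ U.card := by exact_mod_cast hkU
  unfold walkFlow1
  split_ifs with huA
  · rw [sum_const, nsmul_eq_mul, cast_card_sdiff hAU, hA, Nat.cast_sub hk]
    have : (U.card : ℝ) - k + 2 ≠ 0 := by linarith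
    push_cast
    field_simp
    ring
  · rw [sum_ite_eq', if_pos (mem_sdiff.2 ⟨hu, huA⟩)]

/-- Incoming flow of the first incremental stage. -/
theorem sum_walkFlow1_in (hk : 2 ≤ k) (hkU : k ≤ U.card) (hA : A.card = k - 1) :
    ∑ j ∈ A, walkFlow1 U.card k u (A.erase j) j =
      if u ∈ A then unif (U.card - 1) (k - 2) else 0 := by
  have h1 : (k : ℝ) ≤ U.card := by exact_mod_cast hkU
  split_ifs with huA
  · rw [← add_sum_erase A _ huA]
    have h2 : ∀ j ∈ A.erase u, walkFlow1 U.card k u (A.erase j) j =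
        unif U.card (k - 2) / ((U.card : ℝ) - k + 2) := by
      intro j hj
      unfold walkFlow1
      rw [if_pos (mem_erase.2 ⟨(mem_erase.1 hj).1.symm, huA⟩)]
    rw [sum_congr rfl h2, sum_const, card_erase_of_mem huA, hA, nsmul_eq_mul]
    unfold walkFlow1
    rw [if_neg (notMem_erase u A), if_pos rfl]
    -- The edge adding `u` brings `unif N (k-2)`, and each of the `k-2` others brings the part
    -- `1/(N-k+2)` of it. The total, `N/(N-k+2)` times `unif N (k-2)`, is `unif (N-1) (k-2)`.
    have h3 := unif_pred_mul (N := U.card) (k := k - 2) (by omega) (by omega)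
    have h4 : (U.card : ℝ) - k + 2 ≠ 0 := by linarith
    rw [show k - 1 - 1 = k - 2 by omega]
    rw [Nat.cast_sub hk] at h3 ⊢
    push_cast at h3 ⊢
    rw [← mul_left_inj' h4]
    field_simp
    linarith
  · refine sum_eq_zero fun j hj => ?_
    unfold walkFlow1
    rw [if_neg fun h => huA (mem_of_mem_erase h), if_neg]
    rintro rfl
    exact huA hj

/-- Outgoing flow of the second incremental stage. -/
theorem sum_walkFlow2_out (hk : 2 ≤ k) (hkU : k ≤ U.card) (hv : v ∈ U) (hAU : A ⊆ U)
    (hA : A.card = k - 1) :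
    ∑ j ∈ U \ A, walkFlow2 U.card k u v A j =
      if u ∈ A then unif (U.card - 1) (k - 2) else 0 := by
  have h1 : (k : ℝ) ≤ U.card := by exact_mod_cast hkU
  unfold walkFlow2
  split_ifs with huA hvA
  · rw [sum_const, nsmul_eq_mul, cast_card_sdiff hAU, hA, Nat.cast_sub (by omega)]
    have : (U.card : ℝ) - k + 1 ≠ 0 := by linarith
    push_cast
    field_simp
    ring
  · rw [sum_ite_eq', if_pos (mem_sdiff.2 ⟨hv, hvA⟩)]
  · exact sum_const_zero

/-- Incoming flow of the second incremental stage. -/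
theorem sum_walkFlow2_in (hk : 2 ≤ k) (hkU : k ≤ U.card) (huv : u ≠ v) (hA : A.card = k) :
    ∑ j ∈ A, walkFlow2 U.card k u v (A.erase j) j =
      if u ∈ A ∧ v ∈ A then unif (U.card - 2) (k - 2) else 0 := by
  have h1 : (k : ℝ) ≤ U.card := by exact_mod_cast hkU
  split_ifs with h
  · obtain ⟨huA, hvA⟩ := h
    have huA' : u ∈ A.erase v := mem_erase.2 ⟨huv, huA⟩
    rw [← add_sum_erase A _ hvA, ← add_sum_erase _ _ huA']
    have h2 : ∀ j ∈ (A.erase v).erase u, walkFlow2 U.card k u v (A.erase j) j =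
        unif (U.card - 1) (k - 2) / ((U.card : ℝ) - k + 1) := by
      intro j hj
      obtain ⟨hju, hj⟩ := mem_erase.1 hj
      obtain ⟨hjv, hj⟩ := mem_erase.1 hj
      unfold walkFlow2
      rw [if_pos (mem_erase.2 ⟨hju.symm, huA⟩), if_pos (mem_erase.2 ⟨hjv.symm, hvA⟩)]
    rw [sum_congr rfl h2, sum_const, card_erase_of_mem huA', card_erase_of_mem hvA, hA,
      nsmul_eq_mul]
    unfold walkFlow2
    rw [if_pos huA', if_neg (notMem_erase v A), if_pos rfl, if_neg (notMem_erase u A), zero_add]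
    -- The edge adding `v` brings `unif (N-1) (k-2)`, the edge adding `u` nothing, and each of the
    -- `k-2` others the part `1/(N-k+1)`. The same identity with `N-1` for `N` gives `unif (N-2)
    -- (k-2)`.
    have h3 := unif_pred_mul (N := U.card - 1) (k := k - 2) (by omega) (by omega)
    have h4 : (U.card : ℝ) - k + 1 ≠ 0 := by linarith
    rw [show k - 1 - 1 = k - 2 by omega]
    rw [show U.card - 1 - 1 = U.card - 2 by omega] at h3
    rw [Nat.cast_sub hk, Nat.cast_sub (by omega : 1 ≤ U.card)] at h3
    rw [Nat.cast_sub hk]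
    push_cast at h3 ⊢
    rw [← mul_left_inj' h4]
    field_simp
    linarith
  · refine sum_eq_zero fun j hj => ?_
    unfold walkFlow2
    split_ifs with h3 h4 h4
    · exact absurd ⟨mem_of_mem_erase h3, mem_of_mem_erase h4⟩ h
    · subst h4
      exact absurd ⟨mem_of_mem_erase h3, hj⟩ h
    · rfl
    · rfl

/-- The edges of an incremental stage that lead to the set `A₀`. -/
theorem sum_insert_eq (U A₀ : Finset (Fin n)) (k : ℕ) (φ : Finset (Fin n) → Fin n → ℝ) :
    (∑ A ∈ powersetCard k U, ∑ j ∈ U \ A, if insert j A = A₀ then φ A j else 0) =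
      if A₀ ⊆ U ∧ A₀.card = k + 1 then ∑ j ∈ A₀, φ (A₀.erase j) j else 0 := by
  split_ifs with h
  · obtain ⟨h1, h2⟩ := h
    rw [sum_sigma', ← sum_filter]
    refine sum_bij' (fun p _ => p.2) (fun j _ => ⟨A₀.erase j, j⟩) ?_ ?_ ?_ ?_ ?_
    · rintro ⟨A, j⟩ hp
      rw [← (mem_filter.1 hp).2]
      exact mem_insert_self _ _
    · intro j hj
      simp only [mem_filter, mem_sigma, mem_powersetCard, mem_sdiff]
      refine ⟨⟨⟨(erase_subset _ _).trans h1, ?_⟩, h1 hj, notMem_erase _ _⟩, insert_erase hj⟩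
      rw [card_erase_of_mem hj, h2]
      rfl
    · rintro ⟨A, j⟩ hp
      simp only [mem_filter, mem_sigma, mem_sdiff] at hp
      rw [← hp.2, erase_insert hp.1.2.2]
    · intro j _
      rfl
    · rintro ⟨A, j⟩ hp
      simp only [mem_filter, mem_sigma, mem_sdiff] at hp
      rw [← hp.2, erase_insert hp.1.2.2]
  · refine sum_eq_zero fun A hA => sum_eq_zero fun j hj => if_neg ?_
    rintro rfl
    obtain ⟨h1, h2⟩ := mem_powersetCard.1 hA
    obtain ⟨h3, h4⟩ := mem_sdiff.1 hj
    exact h ⟨insert_subset h3 h1, by rw [card_insert_of_notMem h4, h2]⟩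

end Johnson

/-! ## Certificates, locality of the scale, and the chosen triangles -/

section Locality

open Finset

variable {n : ℕ}

theorem mem_crossSlots {X A : Finset (Fin n)} {e : Slot n} :
    e ∈ crossSlots X A ↔ ∃ u ∈ X, ∃ v ∈ A, e.1 = s(u, v) := by
  simp [crossSlots]

theorem crossSlots_mono {X X' A A' : Finset (Fin n)} (hX : X ⊆ X') (hA : A ⊆ A') :
    crossSlots X A ⊆ crossSlots X' A' := by
  intro e he
  obtain ⟨u, hu, v, hv, h⟩ := mem_crossSlots.1 he
  exact mem_crossSlots.2 ⟨u, hX hu, v, hA hv, h⟩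

theorem adj_congr {S : Finset (Slot n)} {z z' : Slot n → Bool} {u v : Fin n}
    (h : AgreeOn S z z') (hS : ∀ e : Slot n, e.1 = s(u, v) → e ∈ S) :
    (graphOf z).Adj u v ↔ (graphOf z').Adj u v := by
  refine exists_congr fun hd => ?_
  rw [h _ (hS ⟨s(u, v), hd⟩ rfl)]

theorem inNbhd_congr {S : Finset (Slot n)} {z z' : Slot n → Bool} {t : Fin n}
    {B : Finset (Fin n)} {e : Slot n} (h : AgreeOn S z z') (hS : crossSlots {t} B ⊆ S)
    (he : ∀ u ∈ e.1, u ∈ B) : InNbhd z t e ↔ InNbhd z' t e :=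
  forall₂_congr fun u hu => adj_congr h fun _ he' =>
    hS (mem_crossSlots.2 ⟨t, mem_singleton_self t, u, he u hu, he'⟩)

theorem inDelta_congr {S : Finset (Slot n)} {z z' : Slot n → Bool} {X A : Finset (Fin n)}
    {e : Slot n} (h : AgreeOn S z z') (hS : crossSlots X A ⊆ S) (he : ∀ u ∈ e.1, u ∈ A) :
    InDelta z X e ↔ InDelta z' X e :=
  forall₂_congr fun _ ht => not_congr (inNbhd_congr h
    ((crossSlots_mono (singleton_subset_iff.2 ht) subset_rfl).trans hS) he)

theorem inNbhd_iff {z : Slot n → Bool} {t u v : Fin n} {e : Slot n} (he : e.1 = s(u, v)) :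
    InNbhd z t e ↔ (graphOf z).Adj t u ∧ (graphOf z).Adj t v := by
  simp [InNbhd, he]

theorem triScale_nonneg {x a b : ℕ} (z : Slot n → Bool) (e : TriEdge n x a b) :
    0 ≤ triScale z e := by
  have := unif_nonneg
  cases e <;> simp only [triScale] <;> (try split_ifs) <;>
    first
    | exact le_rfl
    | exact this _ _
    | exact mul_nonneg (this _ _) (this _ _)
    | exact mul_nonneg (mul_nonneg (this _ _) (this _ _)) (this _ _)

/-- Only two kinds of scales depend on the input. For `starPair` the neighbourhood of `t` is already
loaded. For `pair` the inclusions `e ⊆ B ⊆ A` make `e ⊆ N_w` visible in `{w} × B` and `e ∈ Δ(X)`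
visible in `X × A`. -/
theorem triScale_local {x a b : ℕ} {z z' : Slot n → Bool} (e : TriEdge n x a b)
    (h : AgreeOn (triLabel e.src) z z') : triScale z e = triScale z' e := by
  classical
  cases e with
  | starPair X t e hX ht =>
    simp only [triScale]
    exact if_congr (inNbhd_congr h subset_rfl fun _ _ => mem_univ _) rfl rfl
  | pair X A w B e hX hA hBA hB he =>
    simp only [triScale]
    exact if_congr (and_congr (inNbhd_congr h subset_union_right he)
      (inDelta_congr h subset_union_left fun u hu => hBA (he u hu))) rfl rfl
  | _ => rfl

theorem isOneCertificate_of_triangle {y : Slot n → Bool} {t u v : Fin n} {S : Finset (Slot n)}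
    (htu : (graphOf y).Adj t u) (htv : (graphOf y).Adj t v) (huv : (graphOf y).Adj u v)
    (h₁ : ∀ e : Slot n, e.1 = s(t, u) → e ∈ S) (h₂ : ∀ e : Slot n, e.1 = s(t, v) → e ∈ S)
    (h₃ : ∀ e : Slot n, e.1 = s(u, v) → e ∈ S) :
    IsOneCertificate Set.univ HasTriangle y S := fun _ _ hz =>
  ⟨t, u, v, (adj_congr hz h₁).2 htu, (adj_congr hz h₂).2 htv, (adj_congr hz h₃).2 huv⟩

/-- The triple `p` is a triangle of the graph encoded by `y`, through `X` if possible. -/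
structure IsChosen (y : Slot n → Bool) (X : Finset (Fin n)) (p : Fin n × Fin n × Fin n) :
    Prop where
  eq : chosenTriangle y X = some p
  adj₁ : (graphOf y).Adj p.1 p.2.1
  adj₂ : (graphOf y).Adj p.1 p.2.2
  adj₃ : (graphOf y).Adj p.2.1 p.2.2
  avoid : p.1 ∉ X → ∀ t ∈ X, ¬ ((graphOf y).Adj t p.2.1 ∧ (graphOf y).Adj t p.2.2)

/-- When the second branch of `chosenTriangle` is taken, no triangle has a vertex in `X`; a common
neighbour of `u` and `v` in `X` would make one with the edge `uv`. In the first branch `avoid` is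
vacuous. -/
theorem exists_isChosen {y : Slot n → Bool} (hy : HasTriangle y) (X : Finset (Fin n)) :
    ∃ p, IsChosen y X p := by
  by_cases h₁ : ∃ p : Fin n × Fin n × Fin n, p.1 ∈ X ∧ (graphOf y).Adj p.1 p.2.1 ∧
      (graphOf y).Adj p.1 p.2.2 ∧ (graphOf y).Adj p.2.1 p.2.2
  · refine ⟨h₁.choose, ?_, h₁.choose_spec.2.1, h₁.choose_spec.2.2.1, h₁.choose_spec.2.2.2,
      fun h => absurd h₁.choose_spec.1 h⟩
    unfold chosenTriangle
    rw [dif_pos h₁]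
  · have h₂ : ∃ p : Fin n × Fin n × Fin n, (graphOf y).Adj p.1 p.2.1 ∧
        (graphOf y).Adj p.1 p.2.2 ∧ (graphOf y).Adj p.2.1 p.2.2 := by
      obtain ⟨t, u, v, h⟩ := hy
      exact ⟨(t, u, v), h⟩
    refine ⟨h₂.choose, ?_, h₂.choose_spec.1, h₂.choose_spec.2.1, h₂.choose_spec.2.2,
      fun _ t ht h => h₁ ⟨(t, h₂.choose.2), ht, h.1, h.2, h₂.choose_spec.2.2⟩⟩
    unfold chosenTriangle
    rw [dif_neg h₁, dif_pos h₂]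

theorem triFlow_eq {x a b : ℕ} {y : Slot n → Bool} {e : TriEdge n x a b}
    {p : Fin n × Fin n × Fin n} (h : IsChosen y e.setX p) :
    triFlow y e = triFlowTo p.1 p.2.1 p.2.2 e := by
  obtain ⟨t, u, v⟩ := p
  unfold triFlow
  rw [h.eq]

theorem triFlowTo_nonneg {x a b : ℕ} (han : a ≤ n) (hba : b ≤ a) (t u v : Fin n)
    (e : TriEdge n x a b) : 0 ≤ triFlowTo t u v e := by
  have h := unif_nonneg
  cases e <;> simp only [triFlowTo] <;> split_ifs <;>
    first
    | exact le_rfl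
    | exact h _ _
    | exact mul_nonneg (h _ _) (h _ _)
    | exact mul_nonneg (h _ _) (walkFlow1_nonneg han _ _ _)
    | exact mul_nonneg (h _ _) (walkFlow2_nonneg han _ _ _ _)
    | exact mul_nonneg (mul_nonneg (h _ _) (h _ _)) (h _ _)
    | exact mul_nonneg (mul_nonneg (h _ _) (h _ _)) (walkFlow1_nonneg hba _ _ _)
    | exact mul_nonneg (mul_nonneg (h _ _) (h _ _)) (walkFlow2_nonneg hba _ _ _ _)

/-- The two conditional scales do not vanish where flow passes: `u` and `v` are neighbours of `t`,
and for `t ∉ X` the property `avoid` says that `uv` is in `Δ(X)`. On the other edges the flow is at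
most the uniform weight of the stage. -/
theorem triFlowTo_le_triScale {x a b : ℕ} (han : a ≤ n) (hba : b ≤ a) {y : Slot n → Bool}
    {p : Fin n × Fin n × Fin n} (e : TriEdge n x a b) (hp : IsChosen y e.setX p) :
    triFlowTo p.1 p.2.1 p.2.2 e ≤ triScale y e := by
  have h := unif_nonneg
  have h0 := triScale_nonneg y e
  cases e with
  | star X t hX ht =>
    simp only [triFlowTo]
    split_ifs
    · exact le_rfl
    · exact h0
  | starPair X t e hX ht =>
    simp only [triFlowTo]
    split_ifs with h1
    · simp only [triScale]
      rw [if_pos]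
      rw [h1.2.1]
      exact (inNbhd_iff h1.2.2).2 ⟨hp.adj₁, hp.adj₂⟩
    · exact h0
  | walkA0 X A hX hA =>
    simp only [triFlowTo]
    split_ifs
    · exact h0
    · exact le_rfl
  | walkA1 X A j hX hA hj =>
    simp only [triFlowTo]
    split_ifs
    · exact h0
    · exact mul_le_mul_of_nonneg_left (walkFlow1_le han _ _ _) (h _ _)
  | walkA2 X A j hX hA hj =>
    simp only [triFlowTo]
    split_ifs
    · exact h0
    · exact mul_le_mul_of_nonneg_left (walkFlow2_le han _ _ _ _) (h _ _)
  | walkB0 X A w B hX hA hBA hB =>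
    simp only [triFlowTo]
    split_ifs
    · exact le_rfl
    · exact h0
  | walkB1 X A w B j hX hA hBA hB hjA hj =>
    simp only [triFlowTo]
    split_ifs
    · exact mul_le_mul_of_nonneg_left (walkFlow1_le hba _ _ _) (mul_nonneg (h _ _) (h _ _))
    · exact h0
  | walkB2 X A w B j hX hA hBA hB hjA hj =>
    simp only [triFlowTo]
    split_ifs
    · exact mul_le_mul_of_nonneg_left (walkFlow2_le hba _ _ _ _) (mul_nonneg (h _ _) (h _ _))
    · exact h0
  | pair X A w B e hX hA hBA hB he =>
    simp only [triFlowTo]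
    split_ifs with h1
    · simp only [triScale]
      rw [if_pos]
      refine ⟨?_, fun t ht h2 => hp.avoid h1.1 t ht ((inNbhd_iff h1.2.2).1 h2)⟩
      rw [h1.2.1]
      exact (inNbhd_iff h1.2.2).2 ⟨hp.adj₁, hp.adj₂⟩
    · exact h0

end Locality

/-! ## Levels and reachability -/

section Levels

open Finset

variable {n x a b : ℕ}

/-- The level of a vertex. -/
def triLevel (a b : ℕ) : TriVert n → ℕ
  | .root => 0
  | .star _ _ => 1
  | .starPair _ _ _ => 2
  | .walkA _ A => A.card + 3 - a
  | .walkB _ _ _ B => B.card + 6 - b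
  | .pair _ _ _ _ _ => 7

/-- Sets `A` of sizes `a-2, a-1, a` have levels `1, 2, 3`, and sets `B` of sizes `b-2, b-1, b` have
levels `4, 5, 6`; the natural subtraction does not truncate at these sizes. -/
theorem triLevel_tgt (hb : 2 ≤ b) (hba : b ≤ a) (e : TriEdge n x a b) :
    triLevel a b e.tgt = triLevel a b e.src + 1 := by
  cases e <;> simp only [TriEdge.tgt, TriEdge.src, triLevel] <;>
    (try rw [card_insert_of_notMem ‹_›]) <;> omega

theorem triLevel_tgt_le (hb : 2 ≤ b) (ha : 2 ≤ a) (e : TriEdge n x a b) :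
    triLevel a b e.tgt ≤ 7 := by
  cases e <;> simp only [TriEdge.tgt, triLevel] <;>
    (try rw [card_insert_of_notMem ‹_›]) <;> omega

theorem triLabel_mono (e : TriEdge n x a b) : triLabel e.src ⊆ triLabel e.tgt := by
  cases e with
  | star | walkA0 => exact empty_subset _
  | starPair | walkB0 | pair => exact subset_union_left
  | walkA1 | walkA2 => exact crossSlots_mono subset_rfl (subset_insert _ _)
  | walkB1 | walkB2 =>
    exact union_subset_union subset_rfl (crossSlots_mono subset_rfl (subset_insert _ _))

/-- The vertex `v` is reached from the root. -/
def TriReachable (n x a b : ℕ) (v : TriVert n) : Prop :=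
  Relation.ReflTransGen (triangleSuperGraph n x a b).Adj TriVert.root v

theorem TriReachable.step (e : TriEdge n x a b) (h : TriReachable n x a b e.src) :
    TriReachable n x a b e.tgt :=
  Relation.ReflTransGen.tail h ⟨e, rfl, rfl⟩

theorem triReachable_walkA0 {X A : Finset (Fin n)} (hX : X.card = x) (hA : A.card = a - 2) :
    TriReachable n x a b (.walkA X A) :=
  TriReachable.step (.walkA0 X A hX hA) .refl

theorem triReachable_walkA1 (ha : 2 ≤ a) {X A : Finset (Fin n)} (hX : X.card = x)
    (hA : A.card = a - 1) : TriReachable n x a b (.walkA X A) := by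
  obtain ⟨j, hj⟩ : A.Nonempty := card_pos.1 (by omega)
  have hc : (A.erase j).card = a - 2 := by rw [card_erase_of_mem hj]; omega
  have := TriReachable.step (.walkA1 X (A.erase j) j hX hc (notMem_erase j A))
    (triReachable_walkA0 (b := b) hX hc)
  rwa [TriEdge.tgt, insert_erase hj] at this

theorem triReachable_walkA2 (ha : 2 ≤ a) {X A : Finset (Fin n)} (hX : X.card = x)
    (hA : A.card = a) : TriReachable n x a b (.walkA X A) := by
  obtain ⟨j, hj⟩ : A.Nonempty := card_pos.1 (by omega)
  have hc : (A.erase j).card = a - 1 := by rw [card_erase_of_mem hj]; omega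
  have := TriReachable.step (.walkA2 X (A.erase j) j hX hc (notMem_erase j A))
    (triReachable_walkA1 (b := b) ha hX hc)
  rwa [TriEdge.tgt, insert_erase hj] at this

theorem triReachable_walkB0 (ha : 2 ≤ a) {X A B : Finset (Fin n)} (w : Fin n)
    (hX : X.card = x) (hA : A.card = a) (hBA : B ⊆ A) (hB : B.card = b - 2) :
    TriReachable n x a b (.walkB X A w B) :=
  TriReachable.step (.walkB0 X A w B hX hA hBA hB) (triReachable_walkA2 ha hX hA)

theorem triReachable_walkB1 (ha : 2 ≤ a) (hb : 2 ≤ b) {X A B : Finset (Fin n)} (w : Fin n)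
    (hX : X.card = x) (hA : A.card = a) (hBA : B ⊆ A) (hB : B.card = b - 1) :
    TriReachable n x a b (.walkB X A w B) := by
  obtain ⟨j, hj⟩ : B.Nonempty := card_pos.1 (by omega)
  have hc : (B.erase j).card = b - 2 := by rw [card_erase_of_mem hj]; omega
  have hs := (erase_subset j B).trans hBA
  have := TriReachable.step (.walkB1 X A w (B.erase j) j hX hA hs hc (hBA hj) (notMem_erase j B))
    (triReachable_walkB0 ha w hX hA hs hc)
  rwa [TriEdge.tgt, insert_erase hj] at this

theorem triReachable_walkB2 (ha : 2 ≤ a) (hb : 2 ≤ b) {X A B : Finset (Fin n)} (w : Fin n)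
    (hX : X.card = x) (hA : A.card = a) (hBA : B ⊆ A) (hB : B.card = b) :
    TriReachable n x a b (.walkB X A w B) := by
  obtain ⟨j, hj⟩ : B.Nonempty := card_pos.1 (by omega)
  have hc : (B.erase j).card = b - 1 := by rw [card_erase_of_mem hj]; omega
  have hs := (erase_subset j B).trans hBA
  have := TriReachable.step (.walkB2 X A w (B.erase j) j hX hA hs hc (hBA hj) (notMem_erase j B))
    (triReachable_walkB1 ha hb w hX hA hs hc)
  rwa [TriEdge.tgt, insert_erase hj] at this

theorem triReachable_src (hb : 2 ≤ b) (hba : b ≤ a) (e : TriEdge n x a b) :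
    TriReachable n x a b e.src := by
  have ha := hb.trans hba
  cases e with
  | star | walkA0 => exact .refl
  | starPair X t e hX ht => exact TriReachable.step (.star X t hX ht) .refl
  | walkA1 X A j hX hA hj => exact triReachable_walkA0 hX hA
  | walkA2 X A j hX hA hj => exact triReachable_walkA1 ha hX hA
  | walkB0 X A w B hX hA hBA hB => exact triReachable_walkA2 ha hX hA
  | walkB1 X A w B j hX hA hBA hB hjA hj => exact triReachable_walkB0 ha w hX hA hBA hB
  | walkB2 X A w B j hX hA hBA hB hjA hj => exact triReachable_walkB1 ha hb w hX hA hBA hB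
  | pair X A w B e hX hA hBA hB he => exact triReachable_walkB2 ha hb w hX hA hBA hB

end Levels

/-! ## Conservation of the flow -/

section FlowKinds

open Finset

variable {n : ℕ} (x a b : ℕ) (p : Fin n × Fin n × Fin n) (X : Finset (Fin n))

open Classical in
/-- The flow on the edges of the kind `star`. -/
noncomputable def flowStar (t : Fin n) : ℝ := if p.1 ∈ X ∧ t = p.1 then unif n x else 0

open Classical in
/-- The flow on the edges of the kind `starPair`. -/
noncomputable def flowStarPair (t : Fin n) (e : Slot n) : ℝ :=
  if p.1 ∈ X ∧ t = p.1 ∧ e.1 = s(p.2.1, p.2.2) then unif n x else 0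

open Classical in
/-- The flow on the edges of the kind `walkA0`. -/
noncomputable def flowA0 (_ : Finset (Fin n)) : ℝ :=
  if p.1 ∉ X then unif n x * unif n (a - 2) else 0

open Classical in
/-- The flow on the edges of the kind `walkA1`. -/
noncomputable def flowA1 (A : Finset (Fin n)) (j : Fin n) : ℝ :=
  if p.1 ∉ X then unif n x * walkFlow1 n a p.2.1 A j else 0

open Classical in
/-- The flow on the edges of the kind `walkA2`. -/
noncomputable def flowA2 (A : Finset (Fin n)) (j : Fin n) : ℝ :=
  if p.1 ∉ X then unif n x * walkFlow2 n a p.2.1 p.2.2 A j else 0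

open Classical in
/-- The flow on the edges of the kind `walkB0`. -/
noncomputable def flowB0 (A : Finset (Fin n)) (w : Fin n) (_ : Finset (Fin n)) : ℝ :=
  if p.1 ∉ X ∧ p.2.1 ∈ A ∧ p.2.2 ∈ A ∧ w = p.1 then
    unif n x * unif (n - 2) (a - 2) * unif a (b - 2) else 0

open Classical in
/-- The flow on the edges of the kind `walkB1`. -/
noncomputable def flowB1 (A : Finset (Fin n)) (w : Fin n) (B : Finset (Fin n)) (j : Fin n) : ℝ :=
  if p.1 ∉ X ∧ p.2.1 ∈ A ∧ p.2.2 ∈ A ∧ w = p.1 then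
    unif n x * unif (n - 2) (a - 2) * walkFlow1 a b p.2.1 B j else 0

open Classical in
/-- The flow on the edges of the kind `walkB2`. -/
noncomputable def flowB2 (A : Finset (Fin n)) (w : Fin n) (B : Finset (Fin n)) (j : Fin n) : ℝ :=
  if p.1 ∉ X ∧ p.2.1 ∈ A ∧ p.2.2 ∈ A ∧ w = p.1 then
    unif n x * unif (n - 2) (a - 2) * walkFlow2 a b p.2.1 p.2.2 B j else 0

open Classical in
/-- The flow on the edges of the kind `pair`. -/
noncomputable def flowPair (_ : Finset (Fin n)) (w : Fin n) (_ : Finset (Fin n))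
    (e : Slot n) : ℝ :=
  if p.1 ∉ X ∧ w = p.1 ∧ e.1 = s(p.2.1, p.2.2) then
    unif n x * unif (n - 2) (a - 2) * unif (a - 2) (b - 2) else 0

variable {x a b p X}

theorem sum_slot_eq {B : Finset (Slot n)} (huv : p.2.1 ≠ p.2.2) (c : ℝ) :
    (∑ e ∈ B, if e.1 = s(p.2.1, p.2.2) then c else 0) =
      if (⟨s(p.2.1, p.2.2), by simpa using huv⟩ : Slot n) ∈ B then c else 0 := by
  rw [← sum_ite_eq' B (⟨s(p.2.1, p.2.2), by simpa using huv⟩ : Slot n) fun _ => c]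
  exact sum_congr rfl fun e _ => if_congr
    ⟨fun h => Subtype.ext h, fun h => congrArg Subtype.val h⟩ rfl rfl

theorem sum_flowStarPair (huv : p.2.1 ≠ p.2.2) (t : Fin n) :
    ∑ e, flowStarPair x p X t e = flowStar x p X t := by
  classical
  unfold flowStarPair flowStar
  simp only [← and_assoc, ite_and (_ ∧ _)]
  split_ifs
  · rw [sum_slot_eq huv, if_pos (mem_univ _)]
  · exact sum_const_zero

theorem sum_flowA1_out (ha : 2 ≤ a) (han : a ≤ n) {A : Finset (Fin n)} (hA : A.card = a - 2) :
    ∑ j ∈ univ \ A, flowA1 x a p X A j = flowA0 x a p X A := by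
  have h := sum_walkFlow1_out (U := univ) (u := p.2.1) ha (by simpa using han) (mem_univ _)
    (subset_univ A) hA
  rw [card_fin] at h
  unfold flowA1 flowA0
  split_ifs
  · exact sum_const_zero
  · rw [← mul_sum, h]

theorem sum_flowA1_in (ha : 2 ≤ a) (han : a ≤ n) {A : Finset (Fin n)} (hA : A.card = a - 1) :
    ∑ j ∈ A, flowA1 x a p X (A.erase j) j = ∑ j ∈ univ \ A, flowA2 x a p X A j := by
  have h₁ := sum_walkFlow1_in (U := univ) (u := p.2.1) ha (by simpa using han) hA
  have h₂ := sum_walkFlow2_out (U := univ) (u := p.2.1) (v := p.2.2) ha (by simpa using han)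
    (mem_univ _) (subset_univ A) hA
  rw [card_fin] at h₁ h₂
  unfold flowA1 flowA2
  split_ifs
  · simp
  · rw [← mul_sum, ← mul_sum, h₁, h₂]

/-- The flow arriving at a full set `A` continues with the single vertex `w = t` and is shared
equally by the `(b-2)`-subsets of `A`, whose weights sum to `1`. -/
theorem sum_flowA2_in (hb : 2 ≤ b) (hba : b ≤ a) (han : a ≤ n) (huv : p.2.1 ≠ p.2.2)
    {A : Finset (Fin n)} (hA : A.card = a) :
    ∑ j ∈ A, flowA2 x a p X (A.erase j) j =
      ∑ w, ∑ B ∈ powersetCard (b - 2) A, flowB0 x a b p X A w B := by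
  have h₁ := sum_walkFlow2_in (U := univ) (hb.trans hba) (by simpa using han) huv hA
  rw [card_fin] at h₁
  have h₂ := card_mul_unif (U := A) (k := b - 2) (by omega)
  rw [hA] at h₂
  unfold flowA2 flowB0
  by_cases hX : p.1 ∈ X
  · simp [hX]
  simp only [hX, not_false_eq_true, true_and, if_true, sum_const, nsmul_eq_mul]
  rw [← mul_sum, h₁]
  by_cases h : p.2.1 ∈ A ∧ p.2.2 ∈ A
  · simp only [h, and_self, true_and, if_true, mul_ite, mul_zero]
    rw [sum_ite_eq', if_pos (mem_univ _)]
    linear_combination (- unif n x * unif (n - 2) (a - 2)) * h₂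
  · rw [if_neg h, mul_zero, eq_comm]
    exact sum_eq_zero fun w _ => by rw [if_neg fun h' => h ⟨h'.1, h'.2.1⟩, mul_zero]

theorem sum_flowB1_out (hb : 2 ≤ b) (hba : b ≤ a) {A B : Finset (Fin n)} {w : Fin n}
    (hA : A.card = a) (hBA : B ⊆ A) (hB : B.card = b - 2) :
    ∑ j ∈ A \ B, flowB1 x a b p X A w B j = flowB0 x a b p X A w B := by
  unfold flowB1 flowB0
  split_ifs with h
  · have h₁ := sum_walkFlow1_out (U := A) (u := p.2.1) hb (hba.trans_eq hA.symm) h.2.1 hBA hB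
    rw [hA] at h₁
    rw [← mul_sum, h₁]
  · exact sum_const_zero

theorem sum_flowB1_in (hb : 2 ≤ b) (hba : b ≤ a) {A B : Finset (Fin n)} {w : Fin n}
    (hA : A.card = a) (hBA : B ⊆ A) (hB : B.card = b - 1) :
    ∑ j ∈ B, flowB1 x a b p X A w (B.erase j) j = ∑ j ∈ A \ B, flowB2 x a b p X A w B j := by
  unfold flowB1 flowB2
  split_ifs with h
  · have h₁ := sum_walkFlow1_in (U := A) (u := p.2.1) hb (hba.trans_eq hA.symm) hB
    have h₂ := sum_walkFlow2_out (U := A) (u := p.2.1) (v := p.2.2) hb (hba.trans_eq hA.symm)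
      h.2.2.1 hBA hB
    rw [hA] at h₁ h₂
    rw [← mul_sum, ← mul_sum, h₁, h₂]
  · simp

/-- Since `B ⊆ A`, the condition `u, v ∈ A` is automatic when `u, v ∈ B`, and otherwise no flow
arrives. All the arriving flow leaves on the one edge that loads `uv`. -/
theorem sum_flowB2_in (hb : 2 ≤ b) (hba : b ≤ a) (huv : p.2.1 ≠ p.2.2)
    {A B : Finset (Fin n)} {w : Fin n} (hA : A.card = a) (hBA : B ⊆ A) (hB : B.card = b) :
    ∑ j ∈ B, flowB2 x a b p X A w (B.erase j) j = ∑ e ∈ pairsIn B, flowPair x a b p X A w B e := by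
  classical
  have h₁ := sum_walkFlow2_in (U := A) hb (hba.trans_eq hA.symm) huv hB
  rw [hA] at h₁
  unfold flowB2 flowPair
  simp only [← and_assoc, ite_and (_ ∧ _) (_ = s(_, _))]
  by_cases hw : p.1 ∉ X ∧ w = p.1
  · simp only [hw, not_false_eq_true, and_self, true_and, if_true, and_true]
    rw [sum_slot_eq huv]
    have hB' : (⟨s(p.2.1, p.2.2), by simpa using huv⟩ : Slot n) ∈ pairsIn B ↔
        p.2.1 ∈ B ∧ p.2.2 ∈ B := by
      simp [mem_pairsIn]
    by_cases h : p.2.1 ∈ B ∧ p.2.2 ∈ B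
    · rw [if_pos (hB'.2 h)]
      simp only [hBA h.1, hBA h.2, and_self, if_true]
      rw [← mul_sum, h₁, if_pos h]
    · rw [if_neg (mt hB'.1 h)]
      split_ifs
      · rw [← mul_sum, h₁, if_neg h, mul_zero]
      · exact sum_const_zero
  · have h2 : ¬ (((p.1 ∉ X ∧ p.2.1 ∈ A) ∧ p.2.2 ∈ A) ∧ w = p.1) :=
      fun h => hw ⟨h.1.1.1, h.2⟩
    simp only [hw, h2, if_false, sum_const_zero]

end FlowKinds

/-! ### Net flow at the vertices, and the layered structure. -/

section NetOut

open Finset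

variable {n x a b : ℕ} {y : Slot n → Bool}
  {T : Finset (Fin n) → Fin n × Fin n × Fin n}

-- Every vertex except the root records its `X`, so grouping the edges by `X` lets conservation be
-- checked within each part. The function `T` fixes the triangle used for each `X`.
open Classical in
theorem sum_flow_src (hT : ∀ X, IsChosen y X (T X)) (V : TriVert n) :
    (∑ e : TriEdge n x a b, if e.src = V then triFlow y e else 0) =
      ∑ X ∈ powersetCard x univ, localSum a b X
        (fun t => if .root = V then flowStar x (T X) X t else 0)
        (fun t e => if .star X t = V then flowStarPair x (T X) X t e else 0)
        (fun A => if .root = V then flowA0 x a (T X) X A else 0)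
        (fun A j => if .walkA X A = V then flowA1 x a (T X) X A j else 0)
        (fun A j => if .walkA X A = V then flowA2 x a (T X) X A j else 0)
        (fun A w B => if .walkA X A = V then flowB0 x a b (T X) X A w B else 0)
        (fun A w B j => if .walkB X A w B = V then flowB1 x a b (T X) X A w B j else 0)
        (fun A w B j => if .walkB X A w B = V then flowB2 x a b (T X) X A w B j else 0)
        (fun A w B e => if .walkB X A w B = V then flowPair x a b (T X) X A w B e else 0) := by
  apply sum_triEdge
    (f₁ := fun X t => if .root = V then flowStar x (T X) X t else 0)
    (f₂ := fun X t e => if .star X t = V then flowStarPair x (T X) X t e else 0)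
    (f₃ := fun X A => if .root = V then flowA0 x a (T X) X A else 0)
    (f₄ := fun X A j => if .walkA X A = V then flowA1 x a (T X) X A j else 0)
    (f₅ := fun X A j => if .walkA X A = V then flowA2 x a (T X) X A j else 0)
    (f₆ := fun X A w B => if .walkA X A = V then flowB0 x a b (T X) X A w B else 0)
    (f₇ := fun X A w B j => if .walkB X A w B = V then flowB1 x a b (T X) X A w B j else 0)
    (f₈ := fun X A w B j => if .walkB X A w B = V then flowB2 x a b (T X) X A w B j else 0)
    (f₉ := fun X A w B e => if .walkB X A w B = V then flowPair x a b (T X) X A w B e else 0)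
  all_goals
    intros
    rw [triFlow_eq (hT _)]
    rfl

open Classical in
theorem sum_flow_tgt (hT : ∀ X, IsChosen y X (T X)) (V : TriVert n) :
    (∑ e : TriEdge n x a b, if e.tgt = V then triFlow y e else 0) =
      ∑ X ∈ powersetCard x univ, localSum a b X
        (fun t => if .star X t = V then flowStar x (T X) X t else 0)
        (fun t e => if .starPair X t e = V then flowStarPair x (T X) X t e else 0)
        (fun A => if .walkA X A = V then flowA0 x a (T X) X A else 0)
        (fun A j => if .walkA X (insert j A) = V then flowA1 x a (T X) X A j else 0)
        (fun A j => if .walkA X (insert j A) = V then flowA2 x a (T X) X A j else 0)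
        (fun A w B => if .walkB X A w B = V then flowB0 x a b (T X) X A w B else 0)
        (fun A w B j => if .walkB X A w (insert j B) = V then flowB1 x a b (T X) X A w B j else 0)
        (fun A w B j => if .walkB X A w (insert j B) = V then flowB2 x a b (T X) X A w B j else 0)
        (fun A w B e => if .pair X A w B e = V then flowPair x a b (T X) X A w B e else 0) := by
  apply sum_triEdge
    (f₁ := fun X t => if .star X t = V then flowStar x (T X) X t else 0)
    (f₂ := fun X t e => if .starPair X t e = V then flowStarPair x (T X) X t e else 0)
    (f₃ := fun X A => if .walkA X A = V then flowA0 x a (T X) X A else 0)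
    (f₄ := fun X A j => if .walkA X (insert j A) = V then flowA1 x a (T X) X A j else 0)
    (f₅ := fun X A j => if .walkA X (insert j A) = V then flowA2 x a (T X) X A j else 0)
    (f₆ := fun X A w B => if .walkB X A w B = V then flowB0 x a b (T X) X A w B else 0)
    (f₇ := fun X A w B j =>
      if .walkB X A w (insert j B) = V then flowB1 x a b (T X) X A w B j else 0)
    (f₈ := fun X A w B j =>
      if .walkB X A w (insert j B) = V then flowB2 x a b (T X) X A w B j else 0)
    (f₉ := fun X A w B e => if .pair X A w B e = V then flowPair x a b (T X) X A w B e else 0)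
  all_goals
    intros
    rw [triFlow_eq (hT _)]
    rfl

open Classical in
theorem netOut_eq (V : TriVert n) :
    (triangleSuperGraph n x a b).netOut y V =
      (∑ e : TriEdge n x a b, if e.src = V then triFlow y e else 0) -
        ∑ e : TriEdge n x a b, if e.tgt = V then triFlow y e else 0 := by
  rfl

/-- Each `X` sends out `unif n x`: on one edge `star X t` if `t ∈ X`, and otherwise in equal shares
over the `(a-2)`-sets. -/
theorem netOut_root (hx : x ≤ n) (han : a ≤ n) (hT : ∀ X, IsChosen y X (T X)) :
    (triangleSuperGraph n x a b).netOut y TriVert.root = 1 := by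
  classical
  rw [netOut_eq, sum_flow_src hT, sum_flow_tgt hT]
  simp only [localSum, reduceCtorEq, if_false, if_true, sum_const_zero, add_zero, zero_add,
    sub_zero]
  have h : ∀ X ∈ powersetCard x (univ : Finset (Fin n)),
      (∑ t ∈ X, flowStar x (T X) X t) +
        ∑ A ∈ powersetCard (a - 2) univ, flowA0 x a (T X) X A = unif n x := by
    intro X _
    unfold flowStar flowA0
    by_cases hX : (T X).1 ∈ X
    · simp [hX]
    · have h1 := card_mul_unif (U := (univ : Finset (Fin n))) (k := a - 2)
        (by rw [card_fin]; omega)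
      rw [card_fin] at h1
      simp only [hX, false_and, if_false, sum_const_zero, zero_add, not_false_eq_true, if_true,
        sum_const, nsmul_eq_mul]
      linear_combination unif n x * h1
  have h1 := card_mul_unif (U := (univ : Finset (Fin n))) (k := x) (by rwa [card_fin])
  rw [card_fin] at h1
  rw [sum_congr rfl h, sum_const, nsmul_eq_mul, h1]

theorem netOut_star (hT : ∀ X, IsChosen y X (T X)) (X₀ : Finset (Fin n)) (t₀ : Fin n) :
    (triangleSuperGraph n x a b).netOut y (.star X₀ t₀) = 0 := by
  classical
  rw [netOut_eq, sum_flow_src hT, sum_flow_tgt hT, sub_eq_zero]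
  refine sum_congr rfl fun X _ => ?_
  simp only [localSum, reduceCtorEq, if_false, sum_const_zero, add_zero, zero_add]
  refine sum_congr rfl fun t _ => ?_
  split_ifs
  · exact sum_flowStarPair (hT X).adj₃.ne t
  · exact sum_const_zero

theorem sum_ite_eq_mem {α : Type} [DecidableEq α] (s : Finset α) (i : α) (f : α → ℝ) :
    (∑ j ∈ s, if j = i then f j else 0) = if i ∈ s then f i else 0 :=
  sum_ite_eq' s i f

/-- The size of `A₀` decides which stages meet at the vertex: `walkA0` and `walkA1` at `a-2`,
`walkA1` and `walkA2` at `a-1`, `walkA2` and `walkB0` at `a`, and none at other sizes. -/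
theorem netOut_walkA (hb : 2 ≤ b) (hba : b ≤ a) (han : a ≤ n) (hT : ∀ X, IsChosen y X (T X))
    (X₀ A₀ : Finset (Fin n)) :
    (triangleSuperGraph n x a b).netOut y (.walkA X₀ A₀) = 0 := by
  classical
  have ha := hb.trans hba
  rw [netOut_eq, sum_flow_src hT, sum_flow_tgt hT, sub_eq_zero]
  refine sum_congr rfl fun X _ => ?_
  simp only [localSum, reduceCtorEq, if_false, sum_const_zero, add_zero, zero_add,
    TriVert.walkA.injEq]
  by_cases hX : X = X₀
  swap
  · simp only [hX, false_and, if_false, sum_const_zero]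
  subst hX
  simp only [true_and, sum_insert_eq, sum_ite_irrel, sum_const_zero, sum_ite_eq_mem,
    mem_powersetCard, subset_univ]
  rw [show a - 2 + 1 = a - 1 by omega, show a - 1 + 1 = a by omega]
  rcases lt_trichotomy A₀.card (a - 1) with h | h | h
  · rw [if_neg (by omega : ¬ A₀.card = a - 1), if_neg (by omega : ¬ A₀.card = a - 1),
      if_neg (by omega : ¬ A₀.card = a), if_neg (by omega : ¬ A₀.card = a)]
    split_ifs with h'
    · rw [sum_flowA1_out ha han h']
    · rfl
  · rw [if_pos h, if_pos h, if_neg (by omega : ¬ A₀.card = a - 2),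
      if_neg (by omega : ¬ A₀.card = a - 2), if_neg (by omega : ¬ A₀.card = a),
      if_neg (by omega : ¬ A₀.card = a), sum_flowA1_in ha han h]
  · rw [if_neg (by omega : ¬ A₀.card = a - 1), if_neg (by omega : ¬ A₀.card = a - 1),
      if_neg (by omega : ¬ A₀.card = a - 2), if_neg (by omega : ¬ A₀.card = a - 2)]
    split_ifs with h'
    · rw [sum_flowA2_in hb hba han (hT X).adj₃.ne h']
    · rfl

/-- The second walk keeps `A` and `w`, so the balance holds term by term in `(A, w)`; the three
sizes of `B₀` are treated as for the first walk. -/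
theorem netOut_walkB (hb : 2 ≤ b) (hba : b ≤ a) (hT : ∀ X, IsChosen y X (T X))
    (X₀ A₀ : Finset (Fin n)) (w₀ : Fin n) (B₀ : Finset (Fin n)) :
    (triangleSuperGraph n x a b).netOut y (.walkB X₀ A₀ w₀ B₀) = 0 := by
  classical
  rw [netOut_eq, sum_flow_src hT, sum_flow_tgt hT, sub_eq_zero]
  refine sum_congr rfl fun X _ => ?_
  simp only [localSum, reduceCtorEq, if_false, sum_const_zero, add_zero, zero_add,
    TriVert.walkB.injEq]
  simp only [← sum_add_distrib]
  refine sum_congr rfl fun A hA => sum_congr rfl fun w _ => ?_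
  have hA' := mem_powersetCard_univ.1 hA
  by_cases hX : X = X₀ ∧ A = A₀ ∧ w = w₀
  swap
  · have h : ∀ B, ¬ (X = X₀ ∧ A = A₀ ∧ w = w₀ ∧ B = B₀) := fun B h => hX ⟨h.1, h.2.1, h.2.2.1⟩
    simp only [h, if_false, sum_const_zero]
  obtain ⟨rfl, rfl, rfl⟩ := hX
  simp only [true_and, sum_insert_eq, sum_ite_irrel, sum_const_zero, sum_ite_eq_mem,
    mem_powersetCard]
  by_cases hBA : B₀ ⊆ A
  swap
  · simp only [hBA, false_and, if_false]
  simp only [hBA, true_and]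
  rw [show b - 2 + 1 = b - 1 by omega, show b - 1 + 1 = b by omega]
  rcases lt_trichotomy B₀.card (b - 1) with h | h | h
  · rw [if_neg (by omega : ¬ B₀.card = b - 1), if_neg (by omega : ¬ B₀.card = b - 1),
      if_neg (by omega : ¬ B₀.card = b), if_neg (by omega : ¬ B₀.card = b)]
    split_ifs with h'
    · rw [sum_flowB1_out hb hba hA' hBA h']
    · rfl
  · rw [if_pos h, if_pos h, if_neg (by omega : ¬ B₀.card = b - 2),
      if_neg (by omega : ¬ B₀.card = b - 2), if_neg (by omega : ¬ B₀.card = b),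
      if_neg (by omega : ¬ B₀.card = b), sum_flowB1_in hb hba hA' hBA h]
  · rw [if_neg (by omega : ¬ B₀.card = b - 1), if_neg (by omega : ¬ B₀.card = b - 1),
      if_neg (by omega : ¬ B₀.card = b - 2), if_neg (by omega : ¬ B₀.card = b - 2)]
    split_ifs with h'
    · rw [sum_flowB2_in hb hba (hT X).adj₃.ne hA' hBA h']
    · rfl

theorem triFlow_nonneg (hba : b ≤ a) (han : a ≤ n) (hT : ∀ X, IsChosen y X (T X))
    (e : TriEdge n x a b) : 0 ≤ triFlow y e := by
  rw [triFlow_eq (hT _)]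
  exact triFlowTo_nonneg han hba _ _ _ e

theorem netOut_nonpos_of_sink (hba : b ≤ a) (han : a ≤ n) (hT : ∀ X, IsChosen y X (T X))
    {V : TriVert n} (hV : ∀ e : TriEdge n x a b, e.src ≠ V) :
    (triangleSuperGraph n x a b).netOut y V ≤ 0 := by
  classical
  rw [netOut_eq, sum_eq_zero fun e _ => if_neg (hV e), zero_sub, neg_nonpos]
  refine sum_nonneg fun e _ => ?_
  split_ifs
  · exact triFlow_nonneg hba han hT e
  · exact le_rfl

/-- A vertex that absorbs flow receives some along an edge; the conditions for flow on that edge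
identify the triangle contained in the label. -/
theorem exists_flow_ne_zero (hba : b ≤ a) (han : a ≤ n) (hT : ∀ X, IsChosen y X (T X))
    {V : TriVert n} (hV : (triangleSuperGraph n x a b).netOut y V < 0) :
    ∃ e : TriEdge n x a b, e.tgt = V ∧ triFlow y e ≠ 0 := by
  classical
  by_contra! h
  rw [netOut_eq, sub_neg] at hV
  have h₁ : (∑ e : TriEdge n x a b, if e.tgt = V then triFlow y e else 0) = 0 := by
    refine sum_eq_zero fun e _ => ?_
    split_ifs with he
    · exact h e he
    · rfl
  rw [h₁] at hV
  refine absurd hV (not_lt.2 (sum_nonneg fun e _ => ?_))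
  split_ifs
  · exact triFlow_nonneg hba han hT e
  · exact le_rfl

theorem triangleSuperGraph_isLayered (hx : x ≤ n) (hb : 2 ≤ b) (hba : b ≤ a) (han : a ≤ n) :
    (triangleSuperGraph n x a b).IsLayered HasTriangle (triLevel a b) where
  level_root := rfl
  level_step := triLevel_tgt hb hba
  rooted := triReachable_src hb hba
  label_root := rfl
  label_mono := triLabel_mono
  scale_nonneg := triScale_nonneg
  scale_local _ _ e h := triScale_local e h
  flow_nonneg y hy e := by
    choose T hT using exists_isChosen hy
    exact triFlow_nonneg hba han hT e
  flow_le_scale y hy e := by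
    choose T hT using exists_isChosen hy
    exact (triFlow_eq (hT _)).trans_le (triFlowTo_le_triScale han hba e (hT _))
  flow_root y hy := by
    choose T hT using exists_isChosen hy
    exact netOut_root hx han hT
  flow_source y hy V hV := by
    choose T hT using exists_isChosen hy
    cases V with
    | root => exact absurd rfl hV
    | star X t => exact (netOut_star hT X t).le
    | walkA X A => exact (netOut_walkA hb hba han hT X A).le
    | walkB X A w B => exact (netOut_walkB hb hba hT X A w B).le
    | starPair X t e => exact netOut_nonpos_of_sink hba han hT fun e => by cases e <;> nofun
    | pair X A w B e => exact netOut_nonpos_of_sink hba han hT fun e => by cases e <;> nofun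
  sink_certificate y hy V hV := by
    choose T hT using exists_isChosen hy
    have hmem : ∀ {t v : Fin n} {B : Finset (Fin n)} {e : Slot n}, v ∈ B → e.1 = s(t, v) →
        e ∈ crossSlots {t} B := fun hv he =>
      mem_crossSlots.2 ⟨_, mem_singleton_self _, _, hv, he⟩
    cases V with
    | root => exact absurd hV (by rw [netOut_root hx han hT]; norm_num)
    | star X t => exact absurd hV (by rw [netOut_star hT]; exact lt_irrefl _)
    | walkA X A => exact absurd hV (by rw [netOut_walkA hb hba han hT]; exact lt_irrefl _)
    | walkB X A w B => exact absurd hV (by rw [netOut_walkB hb hba hT]; exact lt_irrefl _)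
    | starPair X t e =>
      obtain ⟨e', he', hf⟩ := exists_flow_ne_zero hba han hT hV
      rw [triFlow_eq (hT _)] at hf
      cases e' with
      | starPair X t e hX ht =>
        simp only [TriEdge.tgt, TriVert.starPair.injEq] at he'
        obtain ⟨rfl, rfl, rfl⟩ := he'
        simp only [triFlowTo, TriEdge.setX] at hf
        obtain ⟨⟨-, rfl, he⟩, -⟩ := ite_ne_right_iff.1 hf
        have hc := hT X
        exact isOneCertificate_of_triangle hc.adj₁ hc.adj₂ hc.adj₃
          (fun _ h => mem_union_left _ (hmem (mem_univ _) h))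
          (fun _ h => mem_union_left _ (hmem (mem_univ _) h))
          (fun _ h => mem_union_right _ (mem_singleton.2 (Subtype.ext (h.trans he.symm))))
      | _ => simp only [TriEdge.tgt, reduceCtorEq] at he'
    | pair X A w B e =>
      obtain ⟨e', he', hf⟩ := exists_flow_ne_zero hba han hT hV
      rw [triFlow_eq (hT _)] at hf
      cases e' with
      | pair X A w B e hX hA hBA hB hu =>
        simp only [TriEdge.tgt, TriVert.pair.injEq] at he'
        obtain ⟨rfl, rfl, rfl, rfl, rfl⟩ := he'
        simp only [triFlowTo, TriEdge.setX] at hf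
        obtain ⟨⟨-, rfl, he⟩, -⟩ := ite_ne_right_iff.1 hf
        have hc := hT X
        rw [he] at hu
        exact isOneCertificate_of_triangle hc.adj₁ hc.adj₂ hc.adj₃
          (fun _ h => mem_union_left _ (mem_union_right _ (hmem (hu _ (Sym2.mem_mk_left _ _)) h)))
          (fun _ h => mem_union_left _ (mem_union_right _ (hmem (hu _ (Sym2.mem_mk_right _ _)) h)))
          (fun _ h => mem_union_right _ (mem_singleton.2 (Subtype.ext (h.trans he.symm))))
      | _ => simp only [TriEdge.tgt, reduceCtorEq] at he'

end NetOut

/-! ## Averages over subsets of a fixed size -/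

section Averages

open Finset

variable {n : ℕ}

theorem unif_pred_pred {N k : ℕ} (hk : 1 ≤ k) (hkN : k ≤ N) :
    unif (N - 1) (k - 1) = (N : ℝ) / k * unif N k := by
  obtain ⟨k, rfl⟩ := Nat.exists_eq_add_of_le' hk
  obtain ⟨N, rfl⟩ := Nat.exists_eq_add_of_le' (hk.trans hkN)
  have h1 : ((N.choose k : ℕ) : ℝ) ≠ 0 := by exact_mod_cast (Nat.choose_pos (by omega)).ne'
  have h2 : (((N + 1).choose (k + 1) : ℕ) : ℝ) ≠ 0 := by
    exact_mod_cast (Nat.choose_pos (by omega)).ne'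
  have h3 : ((N : ℝ) + 1) * (N.choose k : ℕ) = ((N + 1).choose (k + 1) : ℕ) * ((k : ℝ) + 1) := by
    exact_mod_cast Nat.add_one_mul_choose_eq N k
  unfold unif
  simp only [Nat.add_sub_cancel]
  push_cast
  field_simp
  linarith

/-- What follows a walk is scaled by the weight on an `(N-2)`-set. This converts it into the weight
on the `k`-subsets of the `N`-set, so that the sum becomes a multiple of an average. -/
theorem unif_sub_two {N k : ℕ} (hk : 2 ≤ k) (hkN : k ≤ N) :
    unif (N - 2) (k - 2) = (N : ℝ) * (N - 1) / (k * (k - 1)) * unif N k := by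
  have h1 := unif_pred_pred (N := N - 1) (k := k - 1) (by omega) (by omega)
  rw [unif_pred_pred (by omega) hkN, Nat.cast_sub (by omega), Nat.cast_sub (by omega)] at h1
  rw [show N - 2 = N - 1 - 1 by omega, show k - 2 = k - 1 - 1 by omega, h1]
  have h2 : (2 : ℝ) ≤ k := by exact_mod_cast hk
  have h3 : (k : ℝ) - 1 ≠ 0 := by linarith
  push_cast
  field_simp

/-- The average of `F` over the `k`-subsets of `U`. -/
noncomputable def avg (U : Finset (Fin n)) (k : ℕ) (F : Finset (Fin n) → ℝ) : ℝ :=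
  unif U.card k * ∑ A ∈ powersetCard k U, F A

theorem avg_mono {U : Finset (Fin n)} {k : ℕ} {F G : Finset (Fin n) → ℝ}
    (h : ∀ A ⊆ U, A.card = k → F A ≤ G A) : avg U k F ≤ avg U k G :=
  mul_le_mul_of_nonneg_left (sum_le_sum fun A hA =>
    h A (mem_powersetCard.1 hA).1 (mem_powersetCard.1 hA).2) (unif_nonneg _ _)

theorem avg_const {U : Finset (Fin n)} {k : ℕ} (hk : k ≤ U.card) (c : ℝ) :
    avg U k (fun _ => c) = c := by
  unfold avg
  rw [sum_const, nsmul_eq_mul]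
  linear_combination c * card_mul_unif hk

theorem avg_le_const {U : Finset (Fin n)} {k : ℕ} (hk : k ≤ U.card) {F : Finset (Fin n) → ℝ}
    {c : ℝ} (h : ∀ A ⊆ U, A.card = k → F A ≤ c) : avg U k F ≤ c :=
  (avg_mono h).trans_eq (avg_const hk c)

/-- Double counting: an element of `U` is in `(N-1 choose k-1)` of the `k`-subsets, a fraction `k /
N` of them. -/
theorem avg_sum {U : Finset (Fin n)} {k : ℕ} (hk : k ≤ U.card) (f : Fin n → ℝ) :
    avg U k (fun A => ∑ j ∈ A, f j) = (k : ℝ) / U.card * ∑ j ∈ U, f j := by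
  classical
  rcases Nat.eq_zero_or_pos k with rfl | hk0
  · simp [avg]
  have h : ∑ A ∈ powersetCard k U, ∑ j ∈ A, f j =
      ∑ j ∈ U, (((U.card - 1).choose (k - 1) : ℕ) : ℝ) * f j := by
    have h1 : ∀ A ∈ powersetCard k U, ∑ j ∈ A, f j = ∑ j ∈ U, if j ∈ A then f j else 0 := by
      intro A hA
      rw [sum_ite_mem, inter_eq_right.2 (mem_powersetCard.1 hA).1]
    rw [sum_congr rfl h1, sum_comm]
    refine sum_congr rfl fun j hj => ?_
    rw [← sum_filter, sum_const, nsmul_eq_mul]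
    have h2 := card_filter_powersetCard_subset {j} U k (singleton_subset_iff.2 hj)
      (by rw [card_singleton]; exact hk0)
    simp only [singleton_subset_iff, card_singleton] at h2
    rw [h2]
  have h3 := unif_pred_pred hk0 hk
  have h4 : (((U.card - 1).choose (k - 1) : ℕ) : ℝ) ≠ 0 := by
    exact_mod_cast (Nat.choose_pos (by omega)).ne'
  have h5 : (k : ℝ) ≠ 0 := by positivity
  have h6 : (U.card : ℝ) ≠ 0 := by
    have : 0 < U.card := by omega
    positivity
  unfold avg
  rw [h, ← mul_sum, ← mul_assoc]
  congr 1
  rw [unif] at h3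
  field_simp at h3 ⊢
  linarith

theorem avg_le {U : Finset (Fin n)} {k : ℕ} (hk : k ≤ U.card) {F : Finset (Fin n) → ℝ}
    (c₁ c₂ : ℝ) (f : Fin n → ℝ) (h : ∀ A ⊆ U, A.card = k → F A ≤ c₁ * ∑ j ∈ A, f j + c₂) :
    avg U k F ≤ c₁ * ((k : ℝ) / U.card * ∑ j ∈ U, f j) + c₂ := by
  refine (avg_mono h).trans_eq ?_
  have h1 : unif U.card k * ∑ _A ∈ powersetCard k U, c₂ = c₂ := avg_const hk c₂
  rw [← avg_sum hk]
  unfold avg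
  rw [sum_add_distrib, ← mul_sum]
  linear_combination h1

/-- Every pair in `U` is in the same number of `k`-subsets of `U`. -/
theorem sum_pairsIn {U : Finset (Fin n)} {k : ℕ} (hk : 2 ≤ k) (hkU : k ≤ U.card)
    (h : Slot n → ℝ) :
    unif (U.card - 2) (k - 2) * ∑ B ∈ powersetCard k U, ∑ e ∈ pairsIn B, h e =
      ∑ e ∈ pairsIn U, h e := by
  classical
  have h0 : ∑ B ∈ powersetCard k U, ∑ e ∈ pairsIn B, h e =
      ∑ e ∈ pairsIn U, (((U.card - 2).choose (k - 2) : ℕ) : ℝ) * h e := by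
    have h1 : ∀ B ∈ powersetCard k U, ∑ e ∈ pairsIn B, h e =
        ∑ e ∈ pairsIn U, if e ∈ pairsIn B then h e else 0 := by
      intro B hB
      have hs : pairsIn B ⊆ pairsIn U := fun e he => mem_pairsIn.2 fun u hu =>
        (mem_powersetCard.1 hB).1 (mem_pairsIn.1 he u hu)
      rw [sum_ite_mem, inter_eq_right.2 hs]
    rw [sum_congr rfl h1, sum_comm]
    refine sum_congr rfl fun e he => ?_
    rw [← sum_filter, sum_const, nsmul_eq_mul]
    congr 2
    obtain ⟨e, hd⟩ := e
    induction e using Sym2.ind with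
    | _ u v =>
    have huv : u ≠ v := by simpa using hd
    have h2 := card_filter_powersetCard_subset {u, v} U k
      (by simpa [mem_pairsIn, insert_subset_iff] using he) (by rwa [card_pair huv])
    rw [card_pair huv] at h2
    rw [← h2]
    congr 1
    ext B
    simp [mem_pairsIn, insert_subset_iff]
  have h1 : (((U.card - 2).choose (k - 2) : ℕ) : ℝ) ≠ 0 := by
    exact_mod_cast (Nat.choose_pos (by omega)).ne'
  rw [h0, ← mul_sum, ← mul_assoc, unif, one_div, inv_mul_cancel₀ h1, one_mul]

theorem pairsIn_univ : pairsIn (univ : Finset (Fin n)) = univ := by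
  simp [pairsIn]

/-- Few `x`-sets avoid a large set `D`. -/
theorem sum_disjoint_le (D : Finset (Fin n)) (x : ℕ) :
    (∑ X ∈ powersetCard x univ, if Disjoint X D then D.card else 0) ≤ n.choose (x + 1) := by
  classical
  have h : (∑ X ∈ powersetCard x univ, if Disjoint X D then D.card else 0) =
      (((powersetCard x univ).filter fun X => Disjoint X D) ×ˢ D).card := by
    rw [card_product, ← sum_filter, sum_const, smul_eq_mul]
  have h1 : n.choose (x + 1) = (powersetCard (x + 1) (univ : Finset (Fin n))).card := by
    rw [card_powersetCard, card_fin]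
  rw [h, h1]
  -- A pair `(X, w)` with `w ∈ D` and `X` disjoint from `D` is recovered from `X ∪ {w}`, because `w`
  -- is its only element in `D`.
  refine card_le_card_of_injOn (fun p => insert p.2 p.1) ?_ ?_
  · rintro ⟨X, w⟩ hp
    simp only [coe_product, Set.mem_prod, mem_coe, mem_filter, mem_powersetCard_univ] at hp
    have hw : w ∉ X := fun h => disjoint_left.1 hp.1.2 h hp.2
    simp only [mem_coe, mem_powersetCard_univ]
    rw [card_insert_of_notMem hw, hp.1.1]
  · rintro ⟨X, w⟩ hp ⟨X', w'⟩ hp' heq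
    simp only [coe_product, Set.mem_prod, mem_coe, mem_filter, mem_powersetCard_univ] at hp hp'
    have hw : w ∉ X := fun h => disjoint_left.1 hp.1.2 h hp.2
    have hw' : w' ∉ X' := fun h => disjoint_left.1 hp'.1.2 h hp'.2
    simp only at heq
    have hww : w = w' := by
      have : w ∈ insert w' X' := heq ▸ mem_insert_self w X
      exact (mem_insert.1 this).resolve_right fun h => disjoint_left.1 hp'.1.2 h hp.2
    subst hww
    rw [← erase_insert hw, heq, erase_insert hw']

/-- The quotient of the two binomial coefficients is `(n - x) / (x + 1)`. -/
theorem unif_mul_choose_succ_le {x : ℕ} (hx : 1 ≤ x) (hxn : x ≤ n) :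
    unif n x * (n.choose (x + 1) : ℕ) ≤ (n : ℝ) / x := by
  have h1 : (0 : ℝ) < (n.choose x : ℕ) := by exact_mod_cast Nat.choose_pos hxn
  have h2 : ((n.choose (x + 1) : ℕ) : ℝ) * (x + 1) = (n.choose x : ℕ) * ((n : ℝ) - x) := by
    have := congrArg (fun q : ℕ => (q : ℝ)) (Nat.choose_succ_right_eq n x)
    push_cast [Nat.cast_sub hxn] at this
    exact this
  have h3 : (0 : ℝ) < x := by exact_mod_cast hx
  have h4 : (0 : ℝ) ≤ (n.choose (x + 1) : ℕ) := Nat.cast_nonneg _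
  rw [unif, one_div_mul_eq_div, div_le_div_iff₀ h1 h3]
  nlinarith

end Averages

/-! ## The cost of loading -/

section Cost

open Finset

variable {n : ℕ}

/-- The negative complexity of `SparseLoad S` up to a logarithmic factor. -/
noncomputable def loadCost (z : Slot n → Bool) (S : Finset (Slot n)) : ℝ :=
  (S.card : ℝ) * (onesOn z S + 1)

theorem loadCost_nonneg (z : Slot n → Bool) (S : Finset (Slot n)) : 0 ≤ loadCost z S := by
  unfold loadCost
  positivity

theorem loadCost_mono (z : Slot n → Bool) {S S' : Finset (Slot n)} (h : S ⊆ S') :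
    loadCost z S ≤ loadCost z S' := by
  have h1 : (S.card : ℝ) ≤ S'.card := by exact_mod_cast card_le_card h
  have h2 : (onesOn z S : ℝ) ≤ onesOn z S' := by exact_mod_cast onesOn_mono z h
  unfold loadCost
  gcongr

open Classical in
/-- The adjacency indicator. -/
noncomputable def adjInd (z : Slot n → Bool) (u v : Fin n) : ℝ :=
  if (graphOf z).Adj u v then 1 else 0

theorem adjInd_nonneg (z : Slot n → Bool) (u v : Fin n) : 0 ≤ adjInd z u v := by
  unfold adjInd
  split_ifs <;> norm_num

/-- The degree of `u`. -/
noncomputable def degSum (z : Slot n → Bool) (u : Fin n) : ℝ := ∑ v, adjInd z u v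

theorem degSum_nonneg (z : Slot n → Bool) (u : Fin n) : 0 ≤ degSum z u :=
  sum_nonneg fun v _ => adjInd_nonneg z u v

theorem sum_degSum {m : ℕ} {z : Slot n → Bool} (hz : z ∈ graphsWithEdges n m) :
    ∑ u, degSum z u = 2 * m := by
  classical
  have h1 : ∀ u, degSum z u = (graphOf z).degree u := by
    intro u
    unfold degSum adjInd
    rw [sum_boole, ← SimpleGraph.card_neighborFinset_eq_degree,
      SimpleGraph.neighborFinset_eq_filter]
  have h2 : (graphOf z).edgeFinset.card = m := by
    rw [← hz, Set.ncard_eq_toFinset_card', SimpleGraph.edgeFinset]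
  have h3 := (graphOf z).sum_degrees_eq_twice_card_edges
  rw [h2] at h3
  rw [sum_congr rfl fun u _ => h1 u]
  exact_mod_cast h3

theorem card_slots_le {F : Finset (Slot n)} {R : Finset (Fin n × Fin n)}
    (h : ∀ e ∈ F, ∃ p ∈ R, e.1 = s(p.1, p.2)) : F.card ≤ R.card := by
  classical
  rw [← card_image_of_injective F Subtype.val_injective]
  refine (card_le_card (t := R.image fun p => s(p.1, p.2)) fun e he => ?_).trans card_image_le
  obtain ⟨e', he', rfl⟩ := mem_image.1 he
  obtain ⟨p, hp, h⟩ := h e' he'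
  exact mem_image.2 ⟨p, hp, h.symm⟩

theorem card_slot_le : Fintype.card (Slot n) ≤ n ^ 2 := by
  have h := card_slots_le (F := (univ : Finset (Slot n))) (R := univ) fun e _ => by
    obtain ⟨e, he⟩ := e
    induction e using Sym2.ind with
    | _ u v => exact ⟨(u, v), mem_univ _, rfl⟩
  rwa [card_univ, card_univ, Fintype.card_prod, Fintype.card_fin, ← pow_two] at h

theorem card_crossSlots_le (X A : Finset (Fin n)) :
    (crossSlots X A).card ≤ X.card * A.card := by
  rw [← card_product]
  refine card_slots_le fun e he => ?_
  obtain ⟨u, hu, v, hv, h⟩ := mem_crossSlots.1 he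
  exact ⟨(u, v), mk_mem_product hu hv, h⟩

/-- Only an inequality, since an edge inside `X ∩ A` is counted twice on the right. The right side
is linear in the indicators, as averaging requires. -/
theorem onesOn_crossSlots_le (z : Slot n → Bool) (X A : Finset (Fin n)) :
    (onesOn z (crossSlots X A) : ℝ) ≤ ∑ u ∈ X, ∑ v ∈ A, adjInd z u v := by
  classical
  have h : onesOn z (crossSlots X A) ≤
      ((X ×ˢ A).filter fun p => (graphOf z).Adj p.1 p.2).card := by
    refine card_slots_le fun e he => ?_
    obtain ⟨h1, h2⟩ := mem_filter.1 he
    obtain ⟨u, hu, v, hv, h⟩ := mem_crossSlots.1 h1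
    refine ⟨(u, v), mem_filter.2 ⟨mk_mem_product hu hv, ?_⟩, h⟩
    obtain ⟨e, hd⟩ := e
    simp only at h
    subst h
    exact ⟨hd, h2⟩
  unfold adjInd
  rw [← sum_product', sum_boole]
  exact_mod_cast h

theorem loadCost_crossSlots_le (z : Slot n → Bool) (X A : Finset (Fin n)) :
    loadCost z (crossSlots X A) ≤
      (X.card : ℝ) * A.card * ((∑ u ∈ X, ∑ v ∈ A, adjInd z u v) + 1) := by
  have h1 : ((crossSlots X A).card : ℝ) ≤ (X.card : ℝ) * A.card := by
    exact_mod_cast card_crossSlots_le X A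
  have h2 := onesOn_crossSlots_le z X A
  unfold loadCost
  gcongr

theorem loadCost_le_two (z : Slot n → Bool) {S : Finset (Slot n)} (h : S.card ≤ 1) :
    loadCost z S ≤ 2 := by
  have h1 : (S.card : ℝ) ≤ 1 := by exact_mod_cast h
  have h2 : (onesOn z S : ℝ) ≤ 1 := by exact_mod_cast (card_filter_le _ _).trans h
  unfold loadCost
  nlinarith [(Nat.cast_nonneg S.card : (0 : ℝ) ≤ S.card)]

theorem crossSlots_insert (X A : Finset (Fin n)) (j : Fin n) :
    crossSlots X (insert j A) = crossSlots X A ∪ crossSlots X {j} := by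
  ext e
  simp only [mem_crossSlots, mem_insert, mem_union, mem_singleton]
  constructor
  · rintro ⟨u, hu, v, rfl | hv, h⟩
    · exact Or.inr ⟨u, hu, v, rfl, h⟩
    · exact Or.inl ⟨u, hu, v, hv, h⟩
  · rintro (⟨u, hu, v, hv, h⟩ | ⟨u, hu, v, hv, h⟩)
    · exact ⟨u, hu, v, Or.inr hv, h⟩
    · exact ⟨u, hu, v, Or.inl hv, h⟩

open Classical in
/-- Few pairs have both ends in the neighbourhood of `t`. -/
theorem sum_inNbhd_le (z : Slot n → Bool) (t : Fin n) :
    (∑ e, if InNbhd z t e then (2 : ℝ) else 0) ≤ 2 * (n * degSum z t) := by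
  -- Only one end of the pair is required to be a neighbour. The loss from `deg²` to `n · deg` keeps
  -- the bound linear in the degree.
  have h : (univ.filter fun e => InNbhd z t e).card ≤
      ((univ.filter fun v => (graphOf z).Adj t v) ×ˢ (univ : Finset (Fin n))).card := by
    refine card_slots_le fun e he => ?_
    have he := (mem_filter.1 he).2
    obtain ⟨e, hd⟩ := e
    induction e using Sym2.ind with
    | _ u v =>
    exact ⟨(u, v), mk_mem_product (mem_filter.2 ⟨mem_univ _, he u (Sym2.mem_mk_left _ _)⟩)
      (mem_univ _), rfl⟩
  rw [card_product, card_fin] at h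
  have h' : ((univ.filter fun e => InNbhd z t e).card : ℝ) ≤
      (univ.filter fun v => (graphOf z).Adj t v).card * n := by exact_mod_cast h
  unfold degSum adjInd
  rw [← sum_filter, sum_const, nsmul_eq_mul, sum_boole]
  linarith

theorem sum_triEdge_le {x a b : ℕ} (F : TriEdge n x a b → ℝ)
    (f₁ : Finset (Fin n) → Fin n → ℝ) (f₂ : Finset (Fin n) → Fin n → Slot n → ℝ)
    (f₃ : Finset (Fin n) → Finset (Fin n) → ℝ)
    (f₄ f₅ : Finset (Fin n) → Finset (Fin n) → Fin n → ℝ)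
    (f₆ : Finset (Fin n) → Finset (Fin n) → Fin n → Finset (Fin n) → ℝ)
    (f₇ f₈ : Finset (Fin n) → Finset (Fin n) → Fin n → Finset (Fin n) → Fin n → ℝ)
    (f₉ : Finset (Fin n) → Finset (Fin n) → Fin n → Finset (Fin n) → Slot n → ℝ)
    (h₁ : ∀ X t hX ht, F (.star X t hX ht) ≤ f₁ X t)
    (h₂ : ∀ X t e hX ht, F (.starPair X t e hX ht) ≤ f₂ X t e)
    (h₃ : ∀ X A hX hA, F (.walkA0 X A hX hA) ≤ f₃ X A)
    (h₄ : ∀ X A j hX hA hj, F (.walkA1 X A j hX hA hj) ≤ f₄ X A j)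
    (h₅ : ∀ X A j hX hA hj, F (.walkA2 X A j hX hA hj) ≤ f₅ X A j)
    (h₆ : ∀ X A w B hX hA hBA hB, F (.walkB0 X A w B hX hA hBA hB) ≤ f₆ X A w B)
    (h₇ : ∀ X A w B j hX hA hBA hB hjA hj,
      F (.walkB1 X A w B j hX hA hBA hB hjA hj) ≤ f₇ X A w B j)
    (h₈ : ∀ X A w B j hX hA hBA hB hjA hj,
      F (.walkB2 X A w B j hX hA hBA hB hjA hj) ≤ f₈ X A w B j)
    (h₉ : ∀ X A w B e hX hA hBA hB he, F (.pair X A w B e hX hA hBA hB he) ≤ f₉ X A w B e) :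
    ∑ e, F e ≤ ∑ X ∈ powersetCard x univ, localSum a b X (f₁ X) (f₂ X) (f₃ X) (f₄ X) (f₅ X)
      (f₆ X) (f₇ X) (f₈ X) (f₉ X) := by
  let G : TriEdge n x a b → ℝ
    | .star X t _ _ => f₁ X t
    | .starPair X t e _ _ => f₂ X t e
    | .walkA0 X A _ _ => f₃ X A
    | .walkA1 X A j _ _ _ => f₄ X A j
    | .walkA2 X A j _ _ _ => f₅ X A j
    | .walkB0 X A w B _ _ _ _ => f₆ X A w B
    | .walkB1 X A w B j _ _ _ _ _ _ => f₇ X A w B j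
    | .walkB2 X A w B j _ _ _ _ _ _ => f₈ X A w B j
    | .pair X A w B e _ _ _ _ _ => f₉ X A w B e
  refine (sum_le_sum (g := G) fun e _ => ?_).trans_eq
    (sum_triEdge G f₁ f₂ f₃ f₄ f₅ f₆ f₇ f₈ f₉ (fun _ _ _ _ => rfl) (fun _ _ _ _ _ => rfl)
      (fun _ _ _ _ => rfl) (fun _ _ _ _ _ _ => rfl) (fun _ _ _ _ _ _ => rfl)
      (fun _ _ _ _ _ _ _ _ => rfl) (fun _ _ _ _ _ _ _ _ _ _ _ => rfl)
      (fun _ _ _ _ _ _ _ _ _ _ _ => rfl) (fun _ _ _ _ _ _ _ _ _ _ => rfl))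
  cases e <;> first
    | exact h₁ .. | exact h₂ .. | exact h₃ .. | exact h₄ .. | exact h₅ .. | exact h₆ ..
    | exact h₇ .. | exact h₈ .. | exact h₉ ..

open Classical in
/-- The negative complexity, split according to the kinds of super edges. -/
theorem sum_scale_mul_loadCost_le {x a b : ℕ} (z : Slot n → Bool) :
    (∑ e : TriEdge n x a b, triScale z e * loadCost z ((triangleSuperGraph n x a b).loadSet e)) ≤
      ∑ X ∈ powersetCard x univ, localSum a b X
        (fun t => unif n x * (n * (degSum z t + 1)))
        (fun t e => unif n x * if InNbhd z t e then 2 else 0)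
        (fun A => unif n x * unif n (a - 2) *
          ((x : ℝ) * a * ((∑ u ∈ X, ∑ v ∈ A, adjInd z u v) + 1)))
        (fun _ j => unif n x * unif n (a - 2) * (x * ((∑ u ∈ X, adjInd z u j) + 1)))
        (fun _ j => unif n x * unif (n - 1) (a - 2) * (x * ((∑ u ∈ X, adjInd z u j) + 1)))
        (fun _ w B => unif n x * unif (n - 2) (a - 2) * unif a (b - 2) *
          (b * ((∑ v ∈ B, adjInd z w v) + 1)))
        (fun _ _ _ _ => unif n x * unif (n - 2) (a - 2) * unif a (b - 2) * 2)
        (fun _ _ _ _ => unif n x * unif (n - 2) (a - 2) * unif (a - 1) (b - 2) * 2)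
        (fun _ w _ e => unif n x * unif (n - 2) (a - 2) * unif (a - 2) (b - 2) *
          if InNbhd z w e ∧ InDelta z X e then 2 else 0) := by
  have hu := unif_nonneg
  have hsd : ∀ {S T : Finset (Slot n)}, (S ∪ T) \ S ⊆ T := fun {S T} =>
    sdiff_le_iff.2 subset_rfl
  refine sum_triEdge_le _ (fun _ t => unif n x * (n * (degSum z t + 1)))
    (fun _ t e => unif n x * if InNbhd z t e then 2 else 0)
    (fun X A => unif n x * unif n (a - 2) *
      ((x : ℝ) * a * ((∑ u ∈ X, ∑ v ∈ A, adjInd z u v) + 1)))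
    (fun X _ j => unif n x * unif n (a - 2) * (x * ((∑ u ∈ X, adjInd z u j) + 1)))
    (fun X _ j => unif n x * unif (n - 1) (a - 2) * (x * ((∑ u ∈ X, adjInd z u j) + 1)))
    (fun _ _ w B => unif n x * unif (n - 2) (a - 2) * unif a (b - 2) *
      (b * ((∑ v ∈ B, adjInd z w v) + 1)))
    (fun _ _ _ _ _ => unif n x * unif (n - 2) (a - 2) * unif a (b - 2) * 2)
    (fun _ _ _ _ _ => unif n x * unif (n - 2) (a - 2) * unif (a - 1) (b - 2) * 2)
    (fun X _ w _ e => unif n x * unif (n - 2) (a - 2) * unif (a - 2) (b - 2) *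
      if InNbhd z w e ∧ InDelta z X e then 2 else 0) ?_ ?_ ?_ ?_ ?_ ?_ ?_ ?_ ?_
  · intro X t hX ht
    refine mul_le_mul_of_nonneg_left ?_ (hu _ _)
    refine (loadCost_mono z sdiff_subset).trans ((loadCost_crossSlots_le z _ _).trans_eq ?_)
    simp [degSum]
  · intro X t e hX ht
    have h2 : loadCost z ((triangleSuperGraph n x a b).loadSet (.starPair X t e hX ht)) ≤ 2 :=
      loadCost_le_two z ((card_le_card hsd).trans_eq (card_singleton e))
    simp only [triScale]
    split_ifs
    · exact mul_le_mul_of_nonneg_left h2 (hu _ _)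
    · simp
  · intro X A hX hA
    refine mul_le_mul_of_nonneg_left ?_ (mul_nonneg (hu _ _) (hu _ _))
    refine (loadCost_mono z sdiff_subset).trans ((loadCost_crossSlots_le z _ _).trans ?_)
    have h0 : 0 ≤ ∑ u ∈ X, ∑ v ∈ A, adjInd z u v :=
      sum_nonneg fun u _ => sum_nonneg fun v _ => adjInd_nonneg z u v
    have h1 : (A.card : ℝ) ≤ a := by exact_mod_cast hA.trans_le (Nat.sub_le _ _)
    rw [hX]
    gcongr
  · intro X A j hX hA hj
    refine mul_le_mul_of_nonneg_left ?_ (mul_nonneg (hu _ _) (hu _ _))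
    refine (loadCost_mono z (S' := crossSlots X {j}) ?_).trans
      ((loadCost_crossSlots_le z _ _).trans_eq ?_)
    · exact sdiff_le_iff.2 (crossSlots_insert X A j).subset
    · simp [hX]
  · intro X A j hX hA hj
    refine mul_le_mul_of_nonneg_left ?_ (mul_nonneg (hu _ _) (hu _ _))
    refine (loadCost_mono z (S' := crossSlots X {j}) ?_).trans
      ((loadCost_crossSlots_le z _ _).trans_eq ?_)
    · exact sdiff_le_iff.2 (crossSlots_insert X A j).subset
    · simp [hX]
  · intro X A w B hX hA hBA hB
    refine mul_le_mul_of_nonneg_left ?_ (mul_nonneg (mul_nonneg (hu _ _) (hu _ _)) (hu _ _))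
    refine (loadCost_mono z hsd).trans ((loadCost_crossSlots_le z _ _).trans ?_)
    have h0 : 0 ≤ ∑ v ∈ B, adjInd z w v := sum_nonneg fun v _ => adjInd_nonneg z w v
    have h1 : (B.card : ℝ) ≤ b := by exact_mod_cast hB.trans_le (Nat.sub_le _ _)
    rw [card_singleton, sum_singleton, Nat.cast_one, one_mul]
    gcongr
  · intro X A w B j hX hA hBA hB hjA hj
    refine mul_le_mul_of_nonneg_left ?_ (mul_nonneg (mul_nonneg (hu _ _) (hu _ _)) (hu _ _))
    refine loadCost_le_two z ((card_le_card (t := crossSlots {w} {j}) ?_).trans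
      (card_crossSlots_le _ _))
    refine sdiff_le_iff.2 (Eq.subset ?_)
    change crossSlots X A ∪ crossSlots {w} (insert j B) = _
    rw [crossSlots_insert, ← union_assoc]
    rfl
  · intro X A w B j hX hA hBA hB hjA hj
    refine mul_le_mul_of_nonneg_left ?_ (mul_nonneg (mul_nonneg (hu _ _) (hu _ _)) (hu _ _))
    refine loadCost_le_two z ((card_le_card (t := crossSlots {w} {j}) ?_).trans
      (card_crossSlots_le _ _))
    refine sdiff_le_iff.2 (Eq.subset ?_)
    change crossSlots X A ∪ crossSlots {w} (insert j B) = _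
    rw [crossSlots_insert, ← union_assoc]
    rfl
  · intro X A w B e hX hA hBA hB he
    have h2 : loadCost z ((triangleSuperGraph n x a b).loadSet
        (.pair X A w B e hX hA hBA hB he)) ≤ 2 :=
      loadCost_le_two z ((card_le_card hsd).trans_eq (card_singleton e))
    simp only [triScale]
    split_ifs
    · exact mul_le_mul_of_nonneg_left h2 (mul_nonneg (mul_nonneg (hu _ _) (hu _ _)) (hu _ _))
    · simp

end Cost

/-! ## The negative complexity of the nine kinds of super edges -/

section NegativeComplexity

open Finset

variable {n x a b : ℕ}

theorem avg_univ (k : ℕ) (F : Finset (Fin n) → ℝ) :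
    avg univ k F = unif n k * ∑ A ∈ powersetCard k univ, F A := by
  rw [avg, card_fin]

theorem avg_univ_le {k : ℕ} (hk : k ≤ n) {F : Finset (Fin n) → ℝ} (c₁ c₂ : ℝ) (f : Fin n → ℝ)
    (h : ∀ A : Finset (Fin n), A.card = k → F A ≤ c₁ * ∑ j ∈ A, f j + c₂) :
    unif n k * ∑ A ∈ powersetCard k univ, F A ≤ c₁ * ((k : ℝ) / n * ∑ j, f j) + c₂ := by
  have := avg_le (U := univ) (by rwa [card_fin]) c₁ c₂ f fun A _ hA => h A hA
  rwa [avg_univ, card_fin] at this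

theorem avg_univ_le_const {k : ℕ} (hk : k ≤ n) {F : Finset (Fin n) → ℝ} {c : ℝ}
    (h : ∀ A : Finset (Fin n), A.card = k → F A ≤ c) :
    unif n k * ∑ A ∈ powersetCard k univ, F A ≤ c := by
  have := avg_le_const (U := univ) (by rwa [card_fin]) fun A _ hA => h A hA
  rwa [avg_univ] at this

theorem sum_star_le (hx : x ≤ n) (z : Slot n → Bool) :
    ∑ X ∈ powersetCard x univ, ∑ t ∈ X, unif n x * (n * (degSum z t + 1)) ≤
      (x : ℝ) * (∑ u, degSum z u + n) := by
  have h := avg_univ_le hx 1 0 (fun t => n * (degSum z t + 1))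
    (F := fun X => ∑ t ∈ X, n * (degSum z t + 1)) fun X _ => by rw [one_mul, add_zero]
  simp only [← mul_sum, sum_add_distrib (s := univ), sum_const, card_univ, Fintype.card_fin,
    nsmul_eq_mul, mul_one] at h ⊢
  refine h.trans (le_of_eq ?_)
  rcases Nat.eq_zero_or_pos n with rfl | hn
  · simp
  · have hn' : (n : ℝ) ≠ 0 := by positivity
    field_simp
    ring

open Classical in
theorem sum_starPair_le (hx : x ≤ n) (z : Slot n → Bool) :
    (∑ X ∈ powersetCard x univ, ∑ t ∈ X, ∑ e, unif n x * if InNbhd z t e then (2 : ℝ) else 0) ≤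
      2 * (x : ℝ) * ∑ u, degSum z u := by
  have h := avg_univ_le hx 1 0 (fun t => 2 * (n * degSum z t))
    (F := fun X => ∑ t ∈ X, ∑ e, if InNbhd z t e then (2 : ℝ) else 0) fun X _ => by
      rw [one_mul, add_zero]
      exact sum_le_sum fun t _ => sum_inNbhd_le z t
  simp only [← mul_sum] at h ⊢
  refine h.trans (le_of_eq ?_)
  rcases Nat.eq_zero_or_pos n with rfl | hn
  · simp
  · have hn' : (n : ℝ) ≠ 0 := by positivity
    field_simp
    ring

/-- The ones in `X × A` are linear in `A` and then in `X`: averaging over `A` gives the fraction `a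
/ n` of the degrees in `X`, and averaging over `X` the fraction `x / n` of the degree sum. -/
theorem sum_walkA0_le (hx : x ≤ n) (han : a ≤ n) (z : Slot n → Bool) :
    ∑ X ∈ powersetCard x univ, ∑ A ∈ powersetCard (a - 2) univ, unif n x * unif n (a - 2) *
        ((x : ℝ) * a * ((∑ u ∈ X, ∑ v ∈ A, adjInd z u v) + 1)) ≤
      (x : ℝ) * a * ((a : ℝ) / n * ((x : ℝ) / n * ∑ u, degSum z u) + 1) := by
  have h1 : ∀ X : Finset (Fin n), unif n (a - 2) * ∑ A ∈ powersetCard (a - 2) univ,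
      ((x : ℝ) * a * ((∑ u ∈ X, ∑ v ∈ A, adjInd z u v) + 1)) ≤
        (x : ℝ) * a * ((a : ℝ) / n) * (∑ u ∈ X, degSum z u) + x * a := by
    intro X
    refine (avg_univ_le ((Nat.sub_le a 2).trans han) ((x : ℝ) * a) (x * a)
      (fun v => ∑ u ∈ X, adjInd z u v) fun A _ => ?_).trans ?_
    · rw [sum_comm]
      linarith
    · have h2 : ((a - 2 : ℕ) : ℝ) ≤ a := by exact_mod_cast Nat.sub_le a 2
      have h3 : 0 ≤ ∑ u ∈ X, degSum z u := sum_nonneg fun u _ => degSum_nonneg z u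
      rw [sum_comm, mul_assoc ((x : ℝ) * a)]
      change _ * (_ * ∑ u ∈ X, degSum z u) + _ ≤ _
      gcongr
  have h := avg_univ_le hx _ _ (degSum z) fun X _ => h1 X
  simp only [mul_assoc, ← mul_sum] at h ⊢
  linarith

/-- The sum is extended to all `j`; the ones in the sets `X × {j}` then add up to the degrees in
`X`. -/
theorem sum_compl_le (z : Slot n → Bool) {X : Finset (Fin n)} (A : Finset (Fin n)) :
    ∑ j ∈ univ \ A, (x : ℝ) * ((∑ u ∈ X, adjInd z u j) + 1) ≤
      x * (∑ u ∈ X, degSum z u) + x * n := by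
  have h : ∀ j, 0 ≤ (x : ℝ) * ((∑ u ∈ X, adjInd z u j) + 1) := fun j => by
    have : 0 ≤ ∑ u ∈ X, adjInd z u j := sum_nonneg fun u _ => adjInd_nonneg z u j
    positivity
  refine (sum_le_sum_of_subset_of_nonneg (subset_univ _) fun j _ _ => h j).trans_eq ?_
  rw [← mul_sum, sum_add_distrib, sum_comm]
  simp only [degSum, sum_const, card_univ, Fintype.card_fin, nsmul_eq_mul, mul_one]
  ring

theorem sum_walkA1_le (hx : x ≤ n) (han : a ≤ n) (z : Slot n → Bool) :
    ∑ X ∈ powersetCard x univ, ∑ A ∈ powersetCard (a - 2) univ, ∑ j ∈ univ \ A,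
        unif n x * unif n (a - 2) * ((x : ℝ) * ((∑ u ∈ X, adjInd z u j) + 1)) ≤
      (x : ℝ) * ((x : ℝ) / n * ∑ u, degSum z u) + x * n := by
  have h1 : ∀ X : Finset (Fin n), unif n (a - 2) * ∑ A ∈ powersetCard (a - 2) univ,
      ∑ j ∈ univ \ A, (x : ℝ) * ((∑ u ∈ X, adjInd z u j) + 1) ≤
        x * (∑ u ∈ X, degSum z u) + x * n := fun X =>
    avg_univ_le_const ((Nat.sub_le a 2).trans han) fun A _ => sum_compl_le z A
  have h := avg_univ_le hx _ _ (degSum z) fun X _ => h1 X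
  simp only [mul_assoc, ← mul_sum] at h ⊢
  linarith

theorem sum_walkA2_le (hx : x ≤ n) (ha : 2 ≤ a) (han : a ≤ n) (z : Slot n → Bool) :
    ∑ X ∈ powersetCard x univ, ∑ A ∈ powersetCard (a - 1) univ, ∑ j ∈ univ \ A,
        unif n x * unif (n - 1) (a - 2) * ((x : ℝ) * ((∑ u ∈ X, adjInd z u j) + 1)) ≤
      (n : ℝ) / (a - 1) * ((x : ℝ) * ((x : ℝ) / n * ∑ u, degSum z u) + x * n) := by
  have hu := unif_pred_pred (N := n) (k := a - 1) (by omega) (by omega)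
  rw [show a - 1 - 1 = a - 2 by omega, Nat.cast_sub (by omega), Nat.cast_one] at hu
  have ha' : (0 : ℝ) ≤ (n : ℝ) / (a - 1) := by
    have : (2 : ℝ) ≤ a := by exact_mod_cast ha
    exact div_nonneg (Nat.cast_nonneg _) (by linarith)
  have h1 : ∀ X : Finset (Fin n), unif n (a - 1) * ∑ A ∈ powersetCard (a - 1) univ,
      ∑ j ∈ univ \ A, (x : ℝ) * ((∑ u ∈ X, adjInd z u j) + 1) ≤
        x * (∑ u ∈ X, degSum z u) + x * n := fun X =>
    avg_univ_le_const ((Nat.sub_le a 1).trans han) fun A _ => sum_compl_le z A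
  have h := mul_le_mul_of_nonneg_left (avg_univ_le hx _ _ (degSum z) fun X _ => h1 X) ha'
  rw [hu]
  simp only [mul_assoc, ← mul_sum] at h ⊢
  linarith

/-- Common frame for the stages of the second walk: a cost `G` affine in `A` is averaged over `A`,
and the ratio in front is the price of forcing `u` and `v` into `A`. -/
theorem sum_walkB_le (hx : x ≤ n) (ha : 2 ≤ a) (han : a ≤ n)
    {G : Finset (Fin n) → Finset (Fin n) → ℝ} (c₁ c₂ : ℝ) (f : Fin n → ℝ)
    (h : ∀ X A : Finset (Fin n), A.card = a → G X A ≤ c₁ * ∑ j ∈ A, f j + c₂) :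
    ∑ X ∈ powersetCard x univ, ∑ A ∈ powersetCard a univ,
        unif n x * unif (n - 2) (a - 2) * G X A ≤
      (n : ℝ) * (n - 1) / (a * (a - 1)) * (c₁ * ((a : ℝ) / n * ∑ j, f j) + c₂) := by
  have ha2 : (2 : ℝ) ≤ a := by exact_mod_cast ha
  have hn2 : (2 : ℝ) ≤ n := by exact_mod_cast ha.trans han
  have hR : 0 ≤ (n : ℝ) * (n - 1) / (a * (a - 1)) :=
    div_nonneg (mul_nonneg (by linarith) (by linarith))
      (mul_nonneg (by linarith) (by linarith))
  have h1 : ∀ X : Finset (Fin n), (n : ℝ) * (n - 1) / (a * (a - 1)) *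
      (unif n a * ∑ A ∈ powersetCard a univ, G X A) ≤
        (n : ℝ) * (n - 1) / (a * (a - 1)) * (c₁ * ((a : ℝ) / n * ∑ j, f j) + c₂) := fun X =>
    mul_le_mul_of_nonneg_left (avg_univ_le han c₁ c₂ f (h X)) hR
  have h2 := avg_univ_le_const hx fun X _ => h1 X
  rw [unif_sub_two ha han]
  simp only [mul_assoc, ← mul_sum] at h2 ⊢
  exact h2

/-- For fixed `A` and `w`, averaging over `B` leaves the fraction `b / a` of the neighbours of `w`
in `A`; summed over all `w` these become the degrees in `A`. -/
theorem sum_walkB0_le (hx : x ≤ n) (hb : 2 ≤ b) (hba : b ≤ a) (han : a ≤ n)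
    (z : Slot n → Bool) :
    ∑ _X ∈ powersetCard x (univ : Finset (Fin n)), ∑ A ∈ powersetCard a univ, ∑ w,
        ∑ B ∈ powersetCard (b - 2) A, unif n x * unif (n - 2) (a - 2) * unif a (b - 2) *
          (b * ((∑ v ∈ B, adjInd z w v) + 1)) ≤
      (n : ℝ) * (n - 1) / (a * (a - 1)) *
        (b * ((b : ℝ) / a) * ((a : ℝ) / n * ∑ u, degSum z u) + n * b) := by
  have h1 : ∀ _ A : Finset (Fin n), A.card = a →
      ∑ w, unif a (b - 2) * ∑ B ∈ powersetCard (b - 2) A, (b * ((∑ v ∈ B, adjInd z w v) + 1)) ≤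
        b * ((b : ℝ) / a) * (∑ v ∈ A, ∑ w, adjInd z w v) + n * b := by
    intro _ A hA
    have h2 : ∀ w ∈ (univ : Finset (Fin n)), unif a (b - 2) * ∑ B ∈ powersetCard (b - 2) A,
        (b * ((∑ v ∈ B, adjInd z w v) + 1)) ≤
          b * ((b : ℝ) / a) * (∑ v ∈ A, adjInd z w v) + b := by
      intro w _
      have h3 := avg_le (U := A) (k := b - 2) (by omega) (b : ℝ) b (adjInd z w)
        (F := fun B => b * ((∑ v ∈ B, adjInd z w v) + 1)) fun B _ _ => by linarith
      rw [avg, hA] at h3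
      refine h3.trans ?_
      have h4 : ((b - 2 : ℕ) : ℝ) ≤ b := by exact_mod_cast Nat.sub_le b 2
      have h5 : 0 ≤ ∑ v ∈ A, adjInd z w v := sum_nonneg fun v _ => adjInd_nonneg z w v
      rw [mul_assoc (b : ℝ)]
      gcongr
    refine (sum_le_sum h2).trans_eq ?_
    rw [sum_add_distrib, ← mul_sum, sum_comm]
    simp only [sum_const, card_univ, Fintype.card_fin, nsmul_eq_mul]
  have h := sum_walkB_le hx (hb.trans hba) han _ _ _ h1
  rw [sum_comm (s := (univ : Finset (Fin n))) (t := (univ : Finset (Fin n)))] at h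
  simp only [mul_assoc, ← mul_sum] at h ⊢
  exact h

theorem sum_walkB1_le (hx : x ≤ n) (hb : 2 ≤ b) (hba : b ≤ a) (han : a ≤ n) :
    ∑ _X ∈ powersetCard x (univ : Finset (Fin n)), ∑ A ∈ powersetCard a (univ : Finset (Fin n)),
        ∑ _w : Fin n, ∑ B ∈ powersetCard (b - 2) A, ∑ _j ∈ A \ B,
          unif n x * unif (n - 2) (a - 2) * unif a (b - 2) * 2 ≤
      (n : ℝ) * (n - 1) / (a * (a - 1)) * (n * (a * 2)) := by
  have h1 : ∀ _ A : Finset (Fin n), A.card = a →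
      ∑ _w : Fin n, unif a (b - 2) * ∑ B ∈ powersetCard (b - 2) A, ∑ _j ∈ A \ B, (2 : ℝ) ≤
        0 * (∑ v ∈ A, (0 : ℝ)) + n * (a * 2) := by
    intro _ A hA
    have h3 := avg_le_const (U := A) (k := b - 2) (by omega) (c := (a : ℝ) * 2)
      (F := fun B => ∑ _j ∈ A \ B, (2 : ℝ)) fun B _ _ => by
        rw [sum_const, nsmul_eq_mul]
        have : ((A \ B).card : ℝ) ≤ a := by
          exact_mod_cast (card_le_card sdiff_subset).trans_eq hA
        linarith
    rw [avg, hA] at h3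
    rw [sum_const, card_univ, Fintype.card_fin, nsmul_eq_mul]
    simp only [zero_mul, zero_add]
    gcongr
  have h := sum_walkB_le hx (hb.trans hba) han _ _ _ h1
  simp only [mul_assoc, ← mul_sum, zero_mul, zero_add] at h ⊢
  exact h

theorem sum_walkB2_le (hx : x ≤ n) (hb : 2 ≤ b) (hba : b ≤ a) (han : a ≤ n) :
    ∑ _X ∈ powersetCard x (univ : Finset (Fin n)), ∑ A ∈ powersetCard a (univ : Finset (Fin n)),
        ∑ _w : Fin n, ∑ B ∈ powersetCard (b - 1) A, ∑ _j ∈ A \ B,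
          unif n x * unif (n - 2) (a - 2) * unif (a - 1) (b - 2) * 2 ≤
      (n : ℝ) * (n - 1) / (a * (a - 1)) * (n * ((a : ℝ) / (b - 1) * (a * 2))) := by
  have hu := unif_pred_pred (N := a) (k := b - 1) (by omega) (by omega)
  rw [show b - 1 - 1 = b - 2 by omega, Nat.cast_sub (by omega), Nat.cast_one] at hu
  have hb' : (0 : ℝ) ≤ (a : ℝ) / (b - 1) := by
    have : (2 : ℝ) ≤ b := by exact_mod_cast hb
    exact div_nonneg (Nat.cast_nonneg _) (by linarith)
  have h1 : ∀ _ A : Finset (Fin n), A.card = a →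
      ∑ _w : Fin n, unif (a - 1) (b - 2) *
        ∑ B ∈ powersetCard (b - 1) A, ∑ _j ∈ A \ B, (2 : ℝ) ≤
        0 * (∑ v ∈ A, (0 : ℝ)) + n * ((a : ℝ) / (b - 1) * (a * 2)) := by
    intro _ A hA
    have h3 := avg_le_const (U := A) (k := b - 1) (by omega) (c := (a : ℝ) * 2)
      (F := fun B => ∑ _j ∈ A \ B, (2 : ℝ)) fun B _ _ => by
        rw [sum_const, nsmul_eq_mul]
        have : ((A \ B).card : ℝ) ≤ a := by
          exact_mod_cast (card_le_card sdiff_subset).trans_eq hA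
        linarith
    rw [avg, hA] at h3
    rw [sum_const, card_univ, Fintype.card_fin, nsmul_eq_mul, hu, mul_assoc ((a : ℝ) / (b - 1))]
    simp only [zero_mul, zero_add]
    gcongr
  have h := sum_walkB_le hx (hb.trans hba) han _ _ _ h1
  simp only [mul_assoc, ← mul_sum, zero_mul, zero_add] at h ⊢
  exact h

-- By `sum_pairsIn`, applied to `B ⊆ A` and then to `A ⊆ V`, the scales of both walks cancel
-- exactly. There remains an average over `X` of the number of `(w, e)` with `e ∈ (N_w)² ∩ Δ(X)`,
-- which is bounded for each `e` separately.
open Classical in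
theorem sum_pair_le (hx1 : 1 ≤ x) (hx : x ≤ n) (hb : 2 ≤ b) (hba : b ≤ a) (han : a ≤ n)
    (z : Slot n → Bool) :
    (∑ X ∈ powersetCard x univ, ∑ A ∈ powersetCard a univ, ∑ w, ∑ B ∈ powersetCard b A,
        ∑ e ∈ pairsIn B, unif n x * unif (n - 2) (a - 2) * unif (a - 2) (b - 2) *
          if InNbhd z w e ∧ InDelta z X e then (2 : ℝ) else 0) ≤
      2 * (n ^ 2 * ((n : ℝ) / x)) := by
  have h1 : ∀ X, ∑ A ∈ powersetCard a (univ : Finset (Fin n)), ∑ w, ∑ B ∈ powersetCard b A,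
      ∑ e ∈ pairsIn B, unif n x * unif (n - 2) (a - 2) * unif (a - 2) (b - 2) *
          (if InNbhd z w e ∧ InDelta z X e then (2 : ℝ) else 0) =
      unif n x * ∑ w, ∑ e, if InNbhd z w e ∧ InDelta z X e then (2 : ℝ) else 0 := by
    intro X
    have h2 : ∀ w, ∀ A ∈ powersetCard a (univ : Finset (Fin n)),
        unif (a - 2) (b - 2) * ∑ B ∈ powersetCard b A, ∑ e ∈ pairsIn B,
          (if InNbhd z w e ∧ InDelta z X e then (2 : ℝ) else 0) =
        ∑ e ∈ pairsIn A, if InNbhd z w e ∧ InDelta z X e then (2 : ℝ) else 0 := by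
      intro w A hA
      have hA := mem_powersetCard_univ.1 hA
      have := sum_pairsIn (U := A) hb (hba.trans_eq hA.symm)
        fun e => if InNbhd z w e ∧ InDelta z X e then (2 : ℝ) else 0
      rwa [hA] at this
    have h3 : ∀ w, unif (n - 2) (a - 2) * ∑ A ∈ powersetCard a (univ : Finset (Fin n)),
        ∑ e ∈ pairsIn A, (if InNbhd z w e ∧ InDelta z X e then (2 : ℝ) else 0) =
          ∑ e, if InNbhd z w e ∧ InDelta z X e then (2 : ℝ) else 0 := by
      intro w
      have := sum_pairsIn (U := (univ : Finset (Fin n))) (hb.trans hba) (by rwa [card_fin])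
        fun e => if InNbhd z w e ∧ InDelta z X e then (2 : ℝ) else 0
      rwa [card_fin, pairsIn_univ] at this
    rw [sum_comm]
    simp only [mul_assoc, ← mul_sum]
    congr 1
    rw [mul_sum, mul_sum]
    refine sum_congr rfl fun w _ => ?_
    rw [← h3 w, mul_sum]
    congr 1
    exact sum_congr rfl fun A hA => h2 w A hA
  -- For fixed `e` with common neighbourhood `D`, the vertex `w` ranges over `D`, and `e ∈ Δ(X)`
  -- means that `X` misses `D`.
  have h4 : ∀ e : Slot n, (∑ X ∈ powersetCard x (univ : Finset (Fin n)), ∑ w,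
      if InNbhd z w e ∧ InDelta z X e then (2 : ℝ) else 0) ≤ 2 * (n.choose (x + 1) : ℕ) := by
    intro e
    have h5 := sum_disjoint_le (univ.filter fun w => InNbhd z w e) x
    have h6 : (∑ X ∈ powersetCard x (univ : Finset (Fin n)),
        if Disjoint X (univ.filter fun w => InNbhd z w e) then
          ((univ.filter fun w => InNbhd z w e).card : ℝ) else 0) ≤ (n.choose (x + 1) : ℕ) := by
      exact_mod_cast h5
    refine le_trans (le_of_eq ?_) (mul_le_mul_of_nonneg_left h6 zero_le_two)
    rw [mul_sum]
    refine sum_congr rfl fun X _ => ?_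
    have h7 : InDelta z X e ↔ Disjoint X (univ.filter fun w => InNbhd z w e) := by
      rw [disjoint_left]
      simp [InDelta]
    by_cases h8 : InDelta z X e
    · rw [if_pos (h7.1 h8)]
      simp only [h8, and_true]
      rw [← sum_filter, sum_const, nsmul_eq_mul, mul_comm]
    · rw [if_neg (mt h7.2 h8)]
      simp [h8]
  have h9 := unif_mul_choose_succ_le hx1 hx
  have h10 : (Fintype.card (Slot n) : ℝ) ≤ (n : ℝ) ^ 2 := by exact_mod_cast card_slot_le
  calc _ = unif n x * ∑ e : Slot n, ∑ X ∈ powersetCard x (univ : Finset (Fin n)), ∑ w,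
        (if InNbhd z w e ∧ InDelta z X e then (2 : ℝ) else 0) := by
        simp only [h1]
        rw [← mul_sum]
        congr 1
        refine Eq.trans ?_ sum_comm
        exact sum_congr rfl fun X _ => sum_comm
    _ ≤ unif n x * ∑ _e : Slot n, 2 * ((n.choose (x + 1) : ℕ) : ℝ) :=
        mul_le_mul_of_nonneg_left (sum_le_sum fun e _ => h4 e) (unif_nonneg _ _)
    _ = 2 * (Fintype.card (Slot n) * (unif n x * (n.choose (x + 1) : ℕ))) := by
        rw [sum_const, card_univ, nsmul_eq_mul]
        ring
    _ ≤ 2 * (n ^ 2 * ((n : ℝ) / x)) := by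
        have : 0 ≤ unif n x := unif_nonneg _ _
        gcongr

end NegativeComplexity

/-! ## The complexity bounds -/

section Numeric

/-- The bound on the squared complexity, without the logarithmic factor. -/
noncomputable def triBound (n x a b m : ℝ) : ℝ :=
  x * m + (a * x) ^ 2 * (m / n ^ 2) + (n / a) ^ 2 * (a * x ^ 2 * (m / n ^ 2) +
    n * (b ^ 2 * (m / n ^ 2) + (a / b) ^ 2 * (b + b ^ 2 / x)))

theorem triBound_eq {n x a b : ℝ} (m : ℝ) (hn : 0 < n) (hx : 0 < x) (ha : 0 < a) (hb : 0 < b) :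
    triBound n x a b m = x * m + (a * x) ^ 2 * m / n ^ 2 + x ^ 2 * m / a + n * b ^ 2 * m / a ^ 2 +
      n ^ 3 / b + n ^ 3 / x := by
  unfold triBound
  field_simp
  ring

theorem triBound_nonneg {n x a b m : ℝ} (hn : 0 ≤ n) (hx : 0 ≤ x) (ha : 0 ≤ a) (hb : 0 ≤ b)
    (hm : 0 ≤ m) : 0 ≤ triBound n x a b m := by
  unfold triBound
  positivity

theorem kinds_le_triBound {n x a b m : ℝ} (hx1 : 1 ≤ x) (hx : x ≤ n) (hb : 2 ≤ b) (hba : b ≤ a)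
    (han : a ≤ n) (hm : 0 ≤ m) :
    x * (2 * m + n) + (2 * x * (2 * m) + (x * a * (a / n * (x / n * (2 * m)) + 1) +
      ((x * (x / n * (2 * m)) + x * n) + (n / (a - 1) * (x * (x / n * (2 * m)) + x * n) +
      (n * (n - 1) / (a * (a - 1)) * (b * (b / a) * (a / n * (2 * m)) + n * b) +
      (n * (n - 1) / (a * (a - 1)) * (n * (a * 2)) +
      (n * (n - 1) / (a * (a - 1)) * (n * (a / (b - 1) * (a * 2))) +
      2 * (n ^ 2 * (n / x))))))))) ≤ 20 * triBound n x a b m := by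
  have hx0 : 0 < x := by linarith
  have hb0 : 0 < b := by linarith
  have ha0 : 0 < a := by linarith
  have hn0 : 0 < n := by linarith
  rw [triBound_eq m hn0 hx0 ha0 hb0]
  have hbn : b ≤ n := hba.trans han
  set T₁ := x * m
  set T₂ := (a * x) ^ 2 * m / n ^ 2 with hT₂
  set T₃ := x ^ 2 * m / a with hT₃
  set T₄ := n * b ^ 2 * m / a ^ 2 with hT₄
  set T₅ := n ^ 3 / b with hT₅
  set T₆ := n ^ 3 / x with hT₆
  have p₁ : 0 ≤ T₁ := by positivity
  have p₂ : 0 ≤ T₂ := by positivity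
  have p₃ : 0 ≤ T₃ := by positivity
  have p₄ : 0 ≤ T₄ := by positivity
  have p₅ : 0 ≤ T₅ := by positivity
  have p₆ : 0 ≤ T₆ := by positivity
  -- The lower-order terms `x n`, `x a`, `n² x / a`, `n³ b / a²` and `n³ / a` are all absorbed by
  -- `T₅`, since `x ≤ n` and `b ≤ a ≤ n`.
  have h5 : ∀ y, y * b ≤ n ^ 3 → y ≤ T₅ := fun y hy => (le_div_iff₀ hb0).2 hy
  have hxn : x * n ≤ T₅ := h5 _ (by
    calc x * n * b ≤ n * n * n := by gcongr
      _ = n ^ 3 := by ring)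
  have hxa : x * a ≤ T₅ := le_trans (by gcongr) hxn
  -- As `a ≥ 2`, `a ≤ 2 (a - 1)`; the next two bounds come from the same remark for `a` and `b`.
  have hR : n * (n - 1) / (a * (a - 1)) ≤ 2 * (n ^ 2 / a ^ 2) := by
    rw [← mul_div_assoc, div_le_div_iff₀ (mul_pos ha0 (by linarith)) (by positivity)]
    have h1 : (n - 1) * a ≤ 2 * n * (a - 1) := by nlinarith
    have h2 : 0 ≤ n * a := by positivity
    nlinarith [mul_le_mul_of_nonneg_left h1 h2]
  have hA : n / (a - 1) ≤ 2 * (n / a) := by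
    rw [← mul_div_assoc, div_le_div_iff₀ (by linarith) ha0]
    nlinarith
  have hB : a / (b - 1) ≤ 2 * (a / b) := by
    rw [← mul_div_assoc, div_le_div_iff₀ (by linarith) hb0]
    nlinarith
  have hx2 : x * (x / n * (2 * m)) ≤ 2 * T₃ := by
    have : x * (x / n * (2 * m)) = 2 * (x ^ 2 * m / n) := by ring
    rw [this, hT₃]
    gcongr
  have s₁ : x * (2 * m + n) ≤ 2 * T₁ + T₅ := by
    have : x * (2 * m + n) = 2 * T₁ + x * n := by ring
    linarith
  have s₂ : 2 * x * (2 * m) = 4 * T₁ := by ring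
  have s₃ : x * a * (a / n * (x / n * (2 * m)) + 1) ≤ 2 * T₂ + T₅ := by
    have : x * a * (a / n * (x / n * (2 * m)) + 1) = 2 * T₂ + x * a := by
      rw [hT₂]
      field_simp
    linarith
  have s₄ : x * (x / n * (2 * m)) + x * n ≤ 2 * T₃ + T₅ := by linarith
  have s₅ : n / (a - 1) * (x * (x / n * (2 * m)) + x * n) ≤ 4 * T₃ + 2 * T₅ := by
    have h1 : n / (a - 1) * (x * (x / n * (2 * m)) + x * n) ≤
        2 * (n / a) * (x * (x / n * (2 * m)) + x * n) := by gcongr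
    have h2 : 2 * (n / a) * (x * (x / n * (2 * m)) + x * n) = 4 * T₃ + 2 * (n ^ 2 * x / a) := by
      rw [hT₃]
      field_simp
      ring
    have h3 : n ^ 2 * x / a ≤ T₅ := by
      rw [hT₅, div_le_div_iff₀ ha0 hb0]
      calc n ^ 2 * x * b ≤ n ^ 2 * n * a := by gcongr
        _ = n ^ 3 * a := by ring
    linarith
  have s₆ : n * (n - 1) / (a * (a - 1)) * (b * (b / a) * (a / n * (2 * m)) + n * b) ≤
      4 * T₄ + 2 * T₅ := by
    have h1 : n * (n - 1) / (a * (a - 1)) * (b * (b / a) * (a / n * (2 * m)) + n * b) ≤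
      2 * (n ^ 2 / a ^ 2) * (b * (b / a) * (a / n * (2 * m)) + n * b) := by gcongr
    have h2 : 2 * (n ^ 2 / a ^ 2) * (b * (b / a) * (a / n * (2 * m)) + n * b) =
        4 * T₄ + 2 * (n ^ 3 * b / a ^ 2) := by
      rw [hT₄]
      field_simp
      ring
    have h3 : n ^ 3 * b / a ^ 2 ≤ T₅ := by
      rw [hT₅, div_le_div_iff₀ (by positivity) hb0]
      calc n ^ 3 * b * b ≤ n ^ 3 * a * a := by gcongr
        _ = n ^ 3 * a ^ 2 := by ring
    linarith
  have s₇ : n * (n - 1) / (a * (a - 1)) * (n * (a * 2)) ≤ 4 * T₅ := by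
    have h1 : n * (n - 1) / (a * (a - 1)) * (n * (a * 2)) ≤
      2 * (n ^ 2 / a ^ 2) * (n * (a * 2)) := by gcongr
    have h2 : 2 * (n ^ 2 / a ^ 2) * (n * (a * 2)) = 4 * (n ^ 3 / a) := by
      field_simp
      ring
    have h3 : n ^ 3 / a ≤ T₅ := by
      rw [hT₅]
      gcongr
    linarith
  have s₈ : n * (n - 1) / (a * (a - 1)) * (n * (a / (b - 1) * (a * 2))) ≤ 8 * T₅ := by
    have h0 : 0 ≤ a / (b - 1) := div_nonneg ha0.le (by linarith)
    have h1 : n * (n - 1) / (a * (a - 1)) * (n * (a / (b - 1) * (a * 2))) ≤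
      2 * (n ^ 2 / a ^ 2) * (n * (2 * (a / b) * (a * 2))) := by gcongr
    have h2 : 2 * (n ^ 2 / a ^ 2) * (n * (2 * (a / b) * (a * 2))) = 8 * T₅ := by
      rw [hT₅]
      field_simp
      ring
    linarith
  have s₉ : 2 * (n ^ 2 * (n / x)) = 2 * T₆ := by
    rw [hT₆]
    ring
  -- The largest total coefficient is that of `T₅`: `1 + 1 + 1 + 2 + 2 + 4 + 8 = 19`.
  linarith

theorem log_succ_le {n N : ℕ} (hn : 2 ≤ n) (hN : N ≤ n ^ 2) :
    Real.log ((N : ℝ) + 1) ≤ 3 * Real.log n := by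
  have h1 : N + 1 ≤ n ^ 3 := by nlinarith [Nat.pow_le_pow_left hn 2]
  have h2 : (N : ℝ) + 1 ≤ (n : ℝ) ^ 3 := by exact_mod_cast h1
  have h3 := Real.log_le_log (by positivity) h2
  rw [Real.log_pow] at h3
  exact_mod_cast h3

end Numeric

/-! ### Assembling the two complexities. -/

section Complexity

open Finset

variable {n x a b : ℕ}

theorem sum_scale_mul_loadCost_le_triBound (hx1 : 1 ≤ x) (hx : x ≤ n) (hb : 2 ≤ b) (hba : b ≤ a)
    (han : a ≤ n) {m : ℕ} {z : Slot n → Bool} (hz : z ∈ graphsWithEdges n m) :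
    (∑ e : TriEdge n x a b, triScale z e * loadCost z ((triangleSuperGraph n x a b).loadSet e)) ≤
      20 * triBound n x a b m := by
  classical
  have ha := hb.trans hba
  refine (sum_scale_mul_loadCost_le z).trans (le_trans ?_ (kinds_le_triBound
    (n := n) (x := x) (a := a) (b := b) (m := m) (by exact_mod_cast hx1) (by exact_mod_cast hx)
    (by exact_mod_cast hb) (by exact_mod_cast hba) (by exact_mod_cast han) (Nat.cast_nonneg m)))
  simp only [localSum, sum_add_distrib]
  rw [← sum_degSum hz]
  refine add_le_add (sum_star_le hx z) (add_le_add (sum_starPair_le hx z)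
    (add_le_add (sum_walkA0_le hx han z) (add_le_add (sum_walkA1_le hx han z)
    (add_le_add (sum_walkA2_le hx ha han z) (add_le_add (sum_walkB0_le hx hb hba han z)
    (add_le_add (sum_walkB1_le hx hb hba han) (add_le_add (sum_walkB2_le hx hb hba han)
    (sum_pair_le hx1 hx hb hba han z))))))))

/-- The constant is `6 · 3 · 20`: from `SparseLoad`, from `log (N + 1) ≤ 3 log n`, and from adding
the nine kinds. -/
theorem negComplexity_triangle_le (hx1 : 1 ≤ x) (hx : x ≤ n) (hb : 2 ≤ b) (hba : b ≤ a)
    (han : a ≤ n) {m : ℕ} {z : Slot n → Bool} (hz : z ∈ graphsWithEdges n m) :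
    (triangleLearningGraph n x a b).negComplexity z ≤
      360 * (triBound n x a b m * Real.log n) := by
  have hn : 2 ≤ n := (hb.trans hba).trans han
  have hlog : 0 ≤ Real.log n := Real.log_natCast_nonneg n
  refine ((triangleSuperGraph_isLayered hx hb hba han).negComplexity_le z).trans ?_
  have h : ∀ e : TriEdge n x a b, triScale z e *
      (6 * ((((triangleSuperGraph n x a b).loadSet e).card : ℝ) *
        (onesOn z ((triangleSuperGraph n x a b).loadSet e) + 1)) *
        Real.log ((((triangleSuperGraph n x a b).loadSet e).card : ℝ) + 1)) ≤
      18 * Real.log n *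
        (triScale z e * loadCost z ((triangleSuperGraph n x a b).loadSet e)) := by
    intro e
    set S := (triangleSuperGraph n x a b).loadSet e
    have h1 := log_succ_le hn ((card_le_univ S).trans card_slot_le)
    have h2 := loadCost_nonneg z S
    have h3 := triScale_nonneg z e
    calc triScale z e * (6 * loadCost z S * Real.log ((S.card : ℝ) + 1)) ≤
        triScale z e * (6 * loadCost z S * (3 * Real.log n)) := by gcongr
      _ = _ := by ring
  refine (sum_le_sum fun e _ => h e).trans ((mul_sum _ _ _).symm.trans_le ?_)
  refine (mul_le_mul_of_nonneg_left
    (sum_scale_mul_loadCost_le_triBound hx1 hx hb hba han hz) (by positivity)).trans_eq ?_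
  ring

/-- The constant comes from `360 · 14 = 5040 ≤ 71²`. -/
theorem complexity_triangle_le (hx1 : 1 ≤ x) (hx : x ≤ n) (hb : 2 ≤ b) (hba : b ≤ a)
    (han : a ≤ n) (m : ℕ) :
    (triangleLearningGraph n x a b).complexity (graphsWithEdges n m) HasTriangle ≤
      71 * Real.sqrt (triBound n x a b m * Real.log n) := by
  have hL := triangleSuperGraph_isLayered hx hb hba han
  have hG := hL.isLearningGraphFor
  have hlog : 0 ≤ Real.log n := Real.log_natCast_nonneg n
  have hQ : 0 ≤ triBound n x a b m := triBound_nonneg (Nat.cast_nonneg n) (Nat.cast_nonneg x)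
    (Nat.cast_nonneg a) (Nat.cast_nonneg b) (Nat.cast_nonneg m)
  have hY : 0 ≤ triBound n x a b m * Real.log n := mul_nonneg hQ hlog
  set Y := triBound n x a b m * Real.log n
  -- The real supremum over an empty type is `0`, so the bound must also be nonnegative.
  have h1 : (⨆ z : {z // z ∈ graphsWithEdges n m ∧ ¬ HasTriangle z},
      (triangleLearningGraph n x a b).negComplexity z.1) ≤ 360 * Y :=
    Real.iSup_le (fun z => negComplexity_triangle_le hx1 hx hb hba han z.2.1) (by positivity)
  have h2 : (⨆ y : {y // y ∈ graphsWithEdges n m ∧ HasTriangle y},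
      (triangleLearningGraph n x a b).posComplexity y.1) ≤ 2 * (7 : ℕ) :=
    Real.iSup_le (fun y => hL.posComplexity_le (triLevel_tgt_le hb (hb.trans hba)) y.2.2)
      (by positivity)
  have h3 : 0 ≤ ⨆ y : {y // y ∈ graphsWithEdges n m ∧ HasTriangle y},
      (triangleLearningGraph n x a b).posComplexity y.1 := by
    refine Real.iSup_nonneg fun y => sum_nonneg fun e _ => ?_
    split_ifs
    · exact div_nonneg (sq_nonneg _) (hG.weight_nonneg _ _ (Set.mem_univ _) e)
    · exact le_rfl
  unfold LGraph.complexity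
  rw [show (71 : ℝ) = Real.sqrt (71 ^ 2) by rw [Real.sqrt_sq (by norm_num)],
    ← Real.sqrt_mul (by norm_num)]
  refine Real.sqrt_le_sqrt ((mul_le_mul h1 h2 h3 (by positivity)).trans ?_)
  push_cast
  linarith

/-- The choice of parameters for a given number of edges. -/
theorem triBound_parameters {r q a b : ℝ} (hr : 1 ≤ r) (hq : 0 < q) (hq1 : q ≤ 1)
    (ha : r ^ 3 ≤ a) (ha' : a ≤ 2 * r ^ 3) (hb : r ^ 2 ≤ b * q) (hb' : b * q ≤ 2 * r ^ 2) :
    triBound (r ^ 4) b a b (q ^ 3 * r ^ 8) ≤ 36 * (r ^ 10 * q) := by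
  have hr0 : 0 < r := by linarith
  have ha0 : 0 < a := lt_of_lt_of_le (by positivity) ha
  have hb0 : 0 < b := pos_of_mul_pos_left (lt_of_lt_of_le (by positivity) hb) hq.le
  have hbq : 0 ≤ b * q := by positivity
  -- The six monomials get the coefficients `2, 16, 4, 4, 1, 1` of `r¹⁰ q`, in total `28`; the bound
  -- `36` is a square for the root taken later. The last two monomials coincide because `x = b`.
  have h₁ : b * (q ^ 3 * r ^ 8) ≤ 2 * (r ^ 10 * q) := by
    calc b * (q ^ 3 * r ^ 8) = (b * q) * r ^ 8 * q * q := by ring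
      _ ≤ (2 * r ^ 2) * r ^ 8 * q * 1 := by gcongr
      _ = _ := by ring
  have h₂ : (a * b) ^ 2 * (q ^ 3 * r ^ 8) / (r ^ 4) ^ 2 ≤ 16 * (r ^ 10 * q) := by
    calc (a * b) ^ 2 * (q ^ 3 * r ^ 8) / (r ^ 4) ^ 2 = a ^ 2 * (b * q) ^ 2 * q := by
          field_simp
      _ ≤ (2 * r ^ 3) ^ 2 * (2 * r ^ 2) ^ 2 * q := by gcongr
      _ = _ := by ring
  have hr9 : r ^ 9 ≤ r ^ 10 := pow_le_pow_right₀ hr (by norm_num)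
  have h₃ : b ^ 2 * (q ^ 3 * r ^ 8) / a ≤ 4 * (r ^ 10 * q) := by
    calc b ^ 2 * (q ^ 3 * r ^ 8) / a = (b * q) ^ 2 * q * r ^ 8 / a := by ring
      _ ≤ (2 * r ^ 2) ^ 2 * q * r ^ 8 / r ^ 3 := by gcongr
      _ = 4 * (r ^ 9 * q) := by field_simp; ring
      _ ≤ 4 * (r ^ 10 * q) := by gcongr
  have h₄ : r ^ 4 * b ^ 2 * (q ^ 3 * r ^ 8) / a ^ 2 ≤ 4 * (r ^ 10 * q) := by
    calc r ^ 4 * b ^ 2 * (q ^ 3 * r ^ 8) / a ^ 2 = r ^ 12 * (b * q) ^ 2 * q / a ^ 2 := by ring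
      _ ≤ r ^ 12 * (2 * r ^ 2) ^ 2 * q / (r ^ 3) ^ 2 := by gcongr
      _ = 4 * (r ^ 10 * q) := by field_simp; ring
  have h₅ : (r ^ 4) ^ 3 / b ≤ r ^ 10 * q := by
    rw [div_le_iff₀ hb0]
    calc (r ^ 4) ^ 3 = r ^ 10 * r ^ 2 := by ring
      _ ≤ r ^ 10 * (b * q) := by gcongr
      _ = _ := by ring
  rw [triBound_eq _ (by positivity) hb0 ha0 hb0]
  have : 0 ≤ r ^ 10 * q := by positivity
  linarith

end Complexity

/-! ### The parameters for a given number of edges. -/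

section Parameters

/-- Both sides are nonnegative, so sixth powers can be compared; these clear the fractional
exponents. -/
theorem target_sq {n m r q : ℝ} (hn : 0 ≤ n) (hm : 0 ≤ m) (hq : 0 ≤ q)
    (hnr : n = r ^ 4) (hmq : m = q ^ 3 * r ^ 8) :
    (n ^ (11 / 12 : ℝ) * m ^ (1 / 6 : ℝ)) ^ 2 = r ^ 10 * q := by
  have h1 : (n ^ (11 / 12 : ℝ)) ^ 12 = n ^ 11 := by
    rw [← Real.rpow_natCast, ← Real.rpow_mul hn, ← Real.rpow_natCast]
    norm_num
  have h2 : (m ^ (1 / 6 : ℝ)) ^ 6 = m := by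
    rw [← Real.rpow_natCast, ← Real.rpow_mul hm]
    norm_num
  refine (pow_left_inj₀ (by positivity) (by positivity) (n := 6) (by norm_num)).1 ?_
  calc ((n ^ (11 / 12 : ℝ) * m ^ (1 / 6 : ℝ)) ^ 2) ^ 6 =
        (n ^ (11 / 12 : ℝ)) ^ 12 * ((m ^ (1 / 6 : ℝ)) ^ 6) ^ 2 := by ring
    _ = (r ^ 10 * q) ^ 6 := by
        rw [h1, h2, hnr, hmq]
        ring

/-- With `r = n^(1/4)` and `q = (m/n²)^(1/3)`, the hypothesis `n^(5/4) ≤ m` becomes `q r ≥ 1`, which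
is `r²/q ≤ r³` and gives `b ≤ a`. The bound `m ≤ n(n-1)/2` gives `q < 1`, hence `r²/q > 1` and `b ≥
2`. Rounding up costs a factor of at most `2`, since both rounded numbers are at least `1`. -/
theorem complexity_triangle_parameters_le {n m a b : ℕ} (hn : 1 ≤ n) (hm : m ≤ n.choose 2)
    (hnm : (n : ℝ) ^ (5 / 4 : ℝ) ≤ m) (ha : a = ⌈(n : ℝ) ^ (3 / 4 : ℝ)⌉₊)
    (hb : b = ⌈Real.sqrt n / ((m : ℝ) / (n : ℝ) ^ 2) ^ (1 / 3 : ℝ)⌉₊) :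
    2 ≤ b ∧ b ≤ a ∧ a ≤ n ∧
      (triangleLearningGraph n b a b).complexity (graphsWithEdges n m) HasTriangle ≤
        500 * ((n : ℝ) ^ (11 / 12 : ℝ) * (m : ℝ) ^ (1 / 6 : ℝ) * Real.sqrt (Real.log n)) := by
  have hn1 : (1 : ℝ) ≤ n := by exact_mod_cast hn
  have hn0 : (0 : ℝ) ≤ n := by linarith
  obtain ⟨r, hr⟩ : ∃ r : ℝ, r = (n : ℝ) ^ (1 / 4 : ℝ) := ⟨_, rfl⟩
  obtain ⟨q, hq⟩ : ∃ q : ℝ, q = ((m : ℝ) / (n : ℝ) ^ 2) ^ (1 / 3 : ℝ) := ⟨_, rfl⟩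
  have hr1 : 1 ≤ r := hr ▸ Real.one_le_rpow hn1 (by norm_num)
  have hr0 : 0 < r := by linarith
  have hpow : ∀ k : ℕ, r ^ k = (n : ℝ) ^ ((k : ℝ) / 4) := by
    intro k
    rw [hr, ← Real.rpow_natCast, ← Real.rpow_mul hn0]
    congr 1
    ring
  have hr4 : (n : ℝ) = r ^ 4 := by
    rw [hpow]
    norm_num
  have hr3 : (n : ℝ) ^ (3 / 4 : ℝ) = r ^ 3 := by
    rw [hpow]
    norm_num
  have hr5 : (n : ℝ) ^ (5 / 4 : ℝ) = r ^ 5 := by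
    rw [hpow]
    norm_num
  have hr2 : Real.sqrt n = r ^ 2 := by
    rw [hr4, show r ^ 4 = (r ^ 2) ^ 2 by ring, Real.sqrt_sq (by positivity)]
  have hm0 : (0 : ℝ) < m := lt_of_lt_of_le (by rw [hr5]; positivity) hnm
  have hp0 : 0 < (m : ℝ) / (n : ℝ) ^ 2 := by positivity
  have hq0 : 0 < q := hq ▸ Real.rpow_pos_of_pos hp0 _
  have hq3 : q ^ 3 = (m : ℝ) / (n : ℝ) ^ 2 := by
    rw [hq, ← Real.rpow_natCast, ← Real.rpow_mul hp0.le]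
    norm_num
  have hmq : (m : ℝ) = q ^ 3 * r ^ 8 := by
    rw [hq3, hr4]
    field_simp
  have hm2 : (m : ℝ) ≤ (n : ℝ) * (n - 1) / 2 := by
    rw [← Nat.cast_choose_two]
    exact_mod_cast hm
  have hq1 : q < 1 := by
    refine (pow_lt_one_iff_of_nonneg hq0.le (n := 3) (by norm_num)).1 ?_
    rw [hq3, div_lt_one (by positivity)]
    nlinarith
  have hqr : 1 ≤ q * r := by
    refine (one_le_pow_iff_of_nonneg (by positivity) (n := 3) (by norm_num)).1 ?_
    rw [hr5, hmq] at hnm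
    have : r ^ 5 * 1 ≤ r ^ 5 * (q * r) ^ 3 := by
      calc r ^ 5 * 1 ≤ q ^ 3 * r ^ 8 := by linarith
        _ = _ := by ring
    exact le_of_mul_le_mul_left this (by positivity)
  rw [hr3] at ha
  rw [hr2, ← hq] at hb
  have hβ1 : 1 < r ^ 2 / q := by
    rw [lt_div_iff₀ hq0]
    nlinarith
  have hβ : r ^ 2 / q ≤ r ^ 3 := by
    rw [div_le_iff₀ hq0]
    calc r ^ 2 = r ^ 2 * 1 := by ring
      _ ≤ r ^ 2 * (q * r) := by gcongr
      _ = _ := by ring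
  have hb2 : 2 ≤ b := by
    rw [hb]
    exact Nat.lt_ceil.2 (by exact_mod_cast hβ1)
  have hba : b ≤ a := by
    rw [ha, hb]
    exact Nat.ceil_mono hβ
  have han : a ≤ n := by
    rw [ha, Nat.ceil_le, hr4]
    exact pow_le_pow_right₀ hr1 (by norm_num)
  refine ⟨hb2, hba, han, ?_⟩
  have ha₁ : r ^ 3 ≤ a := ha ▸ Nat.le_ceil _
  have ha₂ : (a : ℝ) ≤ 2 * r ^ 3 := by
    have h1 : (a : ℝ) < r ^ 3 + 1 := ha ▸ Nat.ceil_lt_add_one (by positivity)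
    have h2 : 1 ≤ r ^ 3 := one_le_pow₀ hr1
    linarith
  have hb₁ : r ^ 2 ≤ b * q := (div_le_iff₀ hq0).1 (hb ▸ Nat.le_ceil _)
  have hb₂ : b * q ≤ 2 * r ^ 2 := by
    have h1 : (b : ℝ) < r ^ 2 / q + 1 := hb ▸ Nat.ceil_lt_add_one (by positivity)
    have h2 : (b : ℝ) ≤ 2 * r ^ 2 / q := by
      rw [mul_div_assoc]
      linarith
    exact (le_div_iff₀ hq0).1 h2
  have hQ : triBound n b a b m ≤ 36 * (r ^ 10 * q) := by
    rw [hr4, hmq]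
    exact triBound_parameters hr1 hq0 hq1.le ha₁ ha₂ hb₁ hb₂
  have hlog : 0 ≤ Real.log n := Real.log_natCast_nonneg n
  have hT : 0 ≤ (n : ℝ) ^ (11 / 12 : ℝ) * (m : ℝ) ^ (1 / 6 : ℝ) := by positivity
  have hS : Real.sqrt (triBound n b a b m * Real.log n) ≤
      6 * ((n : ℝ) ^ (11 / 12 : ℝ) * (m : ℝ) ^ (1 / 6 : ℝ) * Real.sqrt (Real.log n)) := by
    rw [← target_sq hn0 hm0.le hq0.le hr4 hmq] at hQ
    set T := (n : ℝ) ^ (11 / 12 : ℝ) * (m : ℝ) ^ (1 / 6 : ℝ)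
    refine (Real.sqrt_le_sqrt (mul_le_mul_of_nonneg_right hQ hlog)).trans_eq ?_
    rw [show 36 * T ^ 2 = (6 * T) ^ 2 by ring, Real.sqrt_mul (sq_nonneg _),
      Real.sqrt_sq (by positivity)]
    ring
  refine (complexity_triangle_le (by omega) (hba.trans han) hb2 hba han m).trans ?_
  have h0 := mul_nonneg hT (Real.sqrt_nonneg (Real.log n))
  linarith

end Parameters

theorem mainTheorem3 :
    ∃ C : ℝ, 0 < C ∧
      (∀ n x a b : ℕ, 1 ≤ x → x ≤ n → 2 ≤ b → b ≤ a → a ≤ n →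
        (triangleLearningGraph n x a b).IsLearningGraphFor Set.univ HasTriangle ∧
        ∀ m : ℕ,
          (triangleLearningGraph n x a b).complexity (graphsWithEdges n m) HasTriangle ≤
            C * Real.sqrt
              (((x : ℝ) * m + ((a : ℝ) * x) ^ 2 * ((m : ℝ) / (n : ℝ) ^ 2) +
                ((n : ℝ) / a) ^ 2 *
                  ((a : ℝ) * (x : ℝ) ^ 2 * ((m : ℝ) / (n : ℝ) ^ 2) +
                    (n : ℝ) * ((b : ℝ) ^ 2 * ((m : ℝ) / (n : ℝ) ^ 2) +
                      ((a : ℝ) / b) ^ 2 * ((b : ℝ) + (b : ℝ) ^ 2 / x)))) * Real.log n)) ∧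
      (∀ n m a b : ℕ, 1 ≤ n → m ≤ n.choose 2 → (n : ℝ) ^ (5 / 4 : ℝ) ≤ m →
        a = ⌈(n : ℝ) ^ (3 / 4 : ℝ)⌉₊ →
        b = ⌈Real.sqrt n / ((m : ℝ) / (n : ℝ) ^ 2) ^ (1 / 3 : ℝ)⌉₊ →
        (triangleLearningGraph n b a b).IsLearningGraphFor Set.univ HasTriangle ∧
        (triangleLearningGraph n b a b).complexity (graphsWithEdges n m) HasTriangle ≤
          C * ((n : ℝ) ^ (11 / 12 : ℝ) * (m : ℝ) ^ (1 / 6 : ℝ) * Real.sqrt (Real.log n))) := by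
  -- The constant exceeds both `71`, for (i), and `71 · 6 = 426`, for (ii).
  refine ⟨500, by norm_num, fun n x a b hx1 hx hb hba han => ⟨?_, fun m => ?_⟩,
    fun n m a b hn hm hnm ha hb => ?_⟩
  · exact (triangleSuperGraph_isLayered hx hb hba han).isLearningGraphFor
  · refine (complexity_triangle_le hx1 hx hb hba han m).trans ?_
    have h := Real.sqrt_nonneg (triBound n x a b m * Real.log n)
    exact mul_le_mul_of_nonneg_right (by norm_num) h
  · obtain ⟨hb2, hba, han, h⟩ := complexity_triangle_parameters_le hn hm hnm ha hb
    exact ⟨(triangleSuperGraph_isLayered (hba.trans han) hb2 hba han).isLearningGraphFor, h⟩
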